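/- Let $d\ge 1$ and let $X=(X_t)_{t\ge 0}$ be a pure-jump isotropic Lévy process in $\mathbb{R}^d$ started at $0$, with Lévy measure $\nu(|x|)\,dx$; that is, $\int_{\mathbb{R}^d}(1\wedge|x|^2)\,\nu(|x|)\,dx<\infty$ and, for $t\ge 0$ and $\xi\in\mathbb{R}^d$, $$\mathbb{E}\,e^{i\langle\xi, X_t\rangle}=e^{-t\psi(|\xi|)},\qquad \psi(|\xi|)=\int_{\mathbb{R}^d}\bigl(1-\cos\langle\xi,x\rangle\bigr)\,\nu(|x|)\,dx .$$ Assume that the Lévy measure is infinite, $\int_{\mathbb{R}^d}\nu(|x|)\,dx=\infty$, that $\nu$ is nonincreasing on $(0,\infty)$, and that it is absolutely continuous with a version $\nu'$ of its derivative (that is, $\nu'$ is integrable on $(r,\infty)$ and $\nu(r)=-\int_r^\infty\nu'(\rho)\,d\rho$ for every $r>0$) for which $r\mapsto-\nu'(r)/r$ is nonincreasing on $(0,\infty)$. Then $X$ has radially nonincreasing transition densities: for every $t>0$ the law of $X_t$ is $p_t(|x|)\,dx$ with a finite, nonnegative, nonincreasing function $p_t$ on $(0,\infty)$. Moreover, there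 is a Lévy process $X^{(d+2)}$ in $\mathbb{R}^{d+2}$, started at $0$, with characteristic exponent $\psi(|\xi|)$, $\xi\in\mathbb{R}^{d+2}$, i.e. $\mathbb{E}\,e^{i\langle\xi,X^{(d+2)}_t\rangle}=e^{-t\psi(|\xi|)}$, such that for every $t>0$ the law of $X^{(d+2)}_t$ is $p^{(d+2)}_t(|x|)\,dx$, where $p^{(d+2)}_t$ is finite, nonnegative and nonincreasing on $(0,\infty)$, the function $x\mapsto p^{(d+2)}_t(|x|)$ is continuous at every $x\in\mathbb{R}^{d+2}\setminus\{0\}$, and for every nonincreasing radial version $p_t$ of the transition density of $X$, the derivative of $p_t$ exists at every $r>0$ and $$p_t^{(d+2)}(r)=-\frac{1}{2\pi r}\,\frac{d}{dr}p_t(r),\qquad t>0,\ r>0 .$$ -/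

import Mathlib

open MeasureTheory ProbabilityTheory Filter Topology Set
open scoped ENNReal NNReal RealInnerProductSpace

section LevyDefs

variable {Ω : Type*} [MeasurableSpace Ω]
variable {E : Type*} [NormedAddCommGroup E] [InnerProductSpace ℝ E] [MeasurableSpace E]

/-- `X` is a Lévy process under `P`, started at the origin: independent and stationary increments,
and almost surely right-continuous paths with left limits. -/
structure IsLevyProcess (X : ℝ≥0 → Ω → E) (P : Measure Ω) : Prop where
  isProbabilityMeasure : IsProbabilityMeasure P
  measurable : ∀ t, Measurable (X t)
  zero : ∀ᵐ ω ∂P, X 0 ω = 0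
  indep : HasIndepIncrements X P
  stationary : ∀ s t : ℝ≥0, IdentDistrib (fun ω => X (s + t) ω - X s ω) (X t) P P
  cadlag : ∀ᵐ ω ∂P, ∀ t : ℝ≥0,
    ContinuousWithinAt (fun s => X s ω) (Ici t) t ∧
      ∃ l : E, Tendsto (fun s => X s ω) (𝓝[<] t) (𝓝 l)

/-- `Ψ` is the characteristic exponent of `X`: `E exp(i⟪ξ, X_t⟫) = exp(-t Ψ(ξ))`. -/
def HasCharExponent (X : ℝ≥0 → Ω → E) (P : Measure Ω) (Ψ : E → ℂ) : Prop :=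
  ∀ (t : ℝ≥0) (ξ : E), charFun (P.map (X t)) ξ = Complex.exp (-((t : ℝ) : ℂ) * Ψ ξ)

/-- A Lévy measure: no mass at the origin, and `∫ (1 ∧ |x|²) dμ < ∞`. -/
def IsLevyMeasure (μ : Measure E) : Prop :=
  μ {0} = 0 ∧ ∫⁻ x, ENNReal.ofReal (min 1 (‖x‖ ^ 2)) ∂μ < ∞

/-- `ξ ↦ ∫ (1 - cos⟪ξ, x⟫) dμ(x)`, the exponent of the Lévy–Khintchine formula without drift and
without Gaussian part, for a symmetric Lévy measure `μ`. -/
noncomputable def jumpExponent (μ : Measure E) (ξ : E) : ℝ :=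
  ∫ x, (1 - Real.cos ⟪ξ, x⟫) ∂μ

/-- `X` is a pure-jump isotropic Lévy process with Lévy measure `μ`. -/
structure IsPureJumpIsotropicLevyProcess (X : ℝ≥0 → Ω → E) (P : Measure Ω) (μ : Measure E) :
    Prop where
  isLevyProcess : IsLevyProcess X P
  isLevyMeasure : IsLevyMeasure μ
  isotropic : ∀ R : E ≃ₗᵢ[ℝ] E, μ.map R = μ
  charExponent : HasCharExponent X P (fun ξ => (jumpExponent μ ξ : ℂ))

end LevyDefs

/-- The measure `f(|x|) dx` on `ℝᵈ`. -/
noncomputable def radialMeasure (d : ℕ) (f : ℝ → ℝ) : Measure (EuclideanSpace ℝ (Fin d)) :=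
  volume.withDensity (fun x => ENNReal.ofReal (f ‖x‖))

/-- The functions `x ↦ p_t(|x|)`, `t > 0`, are radially nonincreasing transition densities of `X`.
They are finite off the origin; the value `p t 0` is irrelevant (the true density may have
an infinite limit there). -/
structure IsRadialTransitionDensity {Ω : Type*} [MeasurableSpace Ω] {d : ℕ}
    (X : ℝ≥0 → Ω → EuclideanSpace ℝ (Fin d)) (P : Measure Ω) (p : ℝ≥0 → ℝ → ℝ) : Prop where
  nonneg : ∀ t, 0 < t → ∀ r, 0 < r → 0 ≤ p t r
  antitoneOn : ∀ t, 0 < t → AntitoneOn (p t) (Ioi 0)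
  law_eq : ∀ t, 0 < t → P.map (X t) = radialMeasure d (p t)

/-- `f'` is a version of the derivative of the (locally) absolutely continuous function `f` on
`(0, ∞)`, in the sense that `f(r) = -∫_r^∞ f'(ρ) dρ` for all `r > 0`. -/
def IsRadialDerivative (f f' : ℝ → ℝ) : Prop :=
  ∀ r, 0 < r → IntegrableOn f' (Ioi r) ∧ f r = -∫ ρ in Ioi r, f' ρ

/-!
For a radial function on `ℝ^(d+2)` with profile `q`, integration over the planes orthogonal to
`ℝ^d` gives, in polar coordinates of the plane, the radial function on `ℝ^d` with profile
`p(r) = 2π ∫_r^∞ u q(u) du` (`map_planarProjection_withDensity`). Where `q` is continuous this says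
`q(r) = -p'(r) / (2πr)`. Projecting a measure on `ℝ^(d+2)` to `ℝ^d` also restricts its
characteristic function, or jump exponent, to `ℝ^d`; for isotropic measures nothing is lost, since
these functions depend only on the norm. So it is enough to construct a Lévy process `Y` on
`ℝ^(d+2)` with exponent `ψ(|ξ|)` whose laws have radially nonincreasing densities that are
continuous off the origin: the law of `X_t` is then the projection of the law of `Y_t`.

The same formula, applied to the Lévy density `ν` in place of `p`, gives the Lévy density of `Y`,
namely `g(r) = -ν'(r) / (2πr)` (`raisedDensity`). By hypothesis it is nonincreasing; integrability
of `ν'` makes it nonnegative; and `g(|x|) dx` is a Lévy measure because its image `ν(|x|) dx`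
is one: `1 ∧ |x|²` is at most the sum of the functions `1 ∧ x_i²`, and by isotropy each of these
has the integral of `1 ∧ y_1²` under `ν(|y|) dy` (`isLevyMeasure_of_map_planarProjection`).

Unimodality of measures is expressed through masses of balls (`IsUnimodal`). In this form it is
stable under convolution (`IsUnimodal.conv`) and limits (`isUnimodal_map_of_tendsto_ae`), and a
finite unimodal measure without atom at the origin has a radially nonincreasing density
(`IsUnimodal.exists_density`). The process `Y` is a sum of independent compound Poisson processes
(`exists_compoundPoisson`), whose jump measures are the layers of `g` between rapidly increasing
heights. Each layer is a difference of truncations of `g`, hence nonincreasing, and the second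
moments of the layers decrease geometrically; Ottaviani's inequality and the Borel–Cantelli lemma
then give almost surely locally uniform convergence (`exists_unimodal_levyProcess`).

Since the Lévy measure is infinite, the exponent of `Y` tends to infinity, by the Riemann–Lebesgue
lemma for truncations of `g` (`tendsto_jumpExponent_radialMeasure`). Therefore the laws of `Y_t`,
`t > 0`, have no atom. Their densities are continuous off the origin, because the law of `Y_t` is
the convolution square of the law of `Y_{t/2}` (`continuousAt_density_selfConvolution`). Finally,
a nonincreasing version of a radial density which has a continuous version coincides with the
latter (`continuousAt_of_ae_eq_of_antitoneOn`), so that the derivative formula holds for all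
nonincreasing versions of the transition density of `X`.
-/

/-! ### Unimodal measures, their convolutions and limits -/

section Unimodal

variable {E : Type*} [NormedAddCommGroup E] [MeasurableSpace E]

/-- A measure is unimodal if the mass of a closed ball of given radius does not increase when its
centre moves away from the origin. In particular this mass depends only on the norm of the centre.
For measures with a density (and possibly an atom at the origin) this is equivalent to having a
radially nonincreasing density; stated through balls, the property passes to convolutions and to
limits. -/
def IsUnimodal (μ : Measure E) : Prop :=
  ∀ (r : ℝ) (x y : E), ‖x‖ ≤ ‖y‖ → μ (Metric.closedBall y r) ≤ μ (Metric.closedBall x r)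

theorem isUnimodal_dirac_zero [OpensMeasurableSpace E] :
    IsUnimodal (Measure.dirac (0 : E)) := by
  intro r x y hxy
  by_cases h : (0 : E) ∈ Metric.closedBall y r
  · have h' : (0 : E) ∈ Metric.closedBall x r := by
      rw [Metric.mem_closedBall, dist_zero_left] at h ⊢
      exact hxy.trans h
    rw [Measure.dirac_apply_of_mem h, Measure.dirac_apply_of_mem h']
  · rw [Measure.dirac_apply' _ Metric.isClosed_closedBall.measurableSet, indicator_of_notMem h]
    exact zero_le

/-- A mixture of unimodal laws is unimodal. -/
theorem isUnimodal_map_prod [OpensMeasurableSpace E] {A B : Type*} [MeasurableSpace A]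
    [MeasurableSpace B] {α : Measure A} {β : Measure B} [SFinite β] {f : A × B → E}
    (hf : Measurable f) (h : ∀ a, IsUnimodal (β.map fun b => f (a, b))) :
    IsUnimodal ((α.prod β).map f) := by
  intro r x y hxy
  have key : ∀ z : E, (α.prod β).map f (Metric.closedBall z r) =
      ∫⁻ a, (β.map fun b => f (a, b)) (Metric.closedBall z r) ∂α := by
    intro z
    have hm := Metric.isClosed_closedBall (x := z) (ε := r) |>.measurableSet
    rw [Measure.map_apply hf hm, Measure.prod_apply (hf hm)]
    refine lintegral_congr fun a => ?_
    rw [Measure.map_apply (by fun_prop) hm]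
    rfl
  rw [key, key]
  exact lintegral_mono fun a => h a r x y hxy

/-- Unimodal measures are monotone not only on balls but on all radially decreasing sets. -/
theorem IsUnimodal.measure_sub_mem_le [OpensMeasurableSpace E] {ρ : Measure E} (hρ : IsUnimodal ρ)
    {D : Set E} (hD : ∀ w w' : E, ‖w‖ ≤ ‖w'‖ → w' ∈ D → w ∈ D) {x y : E} (hxy : ‖x‖ ≤ ‖y‖) :
    ρ {z | y - z ∈ D} ≤ ρ {z | x - z ∈ D} := by
  rcases D.eq_empty_or_nonempty with rfl | hne
  · simp
  by_cases hb : BddAbove (norm '' D)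
  · set s := sSup (norm '' D) with hs
    have hle : ∀ w ∈ D, ‖w‖ ≤ s := fun w hw => le_csSup hb ⟨w, hw, rfl⟩
    by_cases hatt : ∃ w ∈ D, ‖w‖ = s
    · obtain ⟨w₀, hw₀, hw₀s⟩ := hatt
      have : ∀ v : E, {z | v - z ∈ D} = Metric.closedBall v s := by
        intro v
        ext z
        rw [mem_ofPred_eq, Metric.mem_closedBall, dist_comm, dist_eq_norm]
        exact ⟨hle _, fun h => hD _ w₀ (hw₀s ▸ h) hw₀⟩
      rw [this, this]
      exact hρ s x y hxy
    · push Not at hatt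
      have hball : ∀ v : E, {z | v - z ∈ D} = ⋃ n : ℕ, Metric.closedBall v (s - 1 / (n + 1)) := by
        intro v
        ext z
        simp only [mem_ofPred_eq, mem_iUnion, Metric.mem_closedBall]
        rw [dist_comm, dist_eq_norm]
        constructor
        · intro h
          have hlt : 0 < s - ‖v - z‖ := sub_pos.2 (lt_of_le_of_ne (hle _ h) (hatt _ h))
          obtain ⟨n, hn⟩ := exists_nat_one_div_lt hlt
          exact ⟨n, by linarith⟩
        · rintro ⟨n, hn⟩
          have hlt : ‖v - z‖ < s := by
            have : (0 : ℝ) < 1 / (n + 1) := by positivity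
            linarith
          obtain ⟨_, ⟨w, hw, rfl⟩, hw'⟩ := exists_lt_of_lt_csSup (hne.image _) hlt
          exact hD _ w hw'.le hw
      have hmono : ∀ v : E, Monotone fun n : ℕ => Metric.closedBall v (s - 1 / ((n : ℝ) + 1)) := by
        intro v m n hmn
        refine Metric.closedBall_subset_closedBall ?_
        have : (1 : ℝ) / (n + 1) ≤ 1 / (m + 1) := Nat.one_div_le_one_div hmn
        linarith
      rw [hball, hball, (hmono y).measure_iUnion, (hmono x).measure_iUnion]
      exact iSup_mono fun n => hρ _ x y hxy
  · have : D = univ := by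
      refine eq_univ_of_forall fun w => ?_
      simp only [bddAbove_def, not_exists, not_forall, not_le] at hb
      obtain ⟨_, ⟨w', hw', rfl⟩, h⟩ := hb ‖w‖
      exact hD w w' h.le hw'
    simp [this]

/-- By Fubini, `μ ∗ ρ` is a mixture over `t` of the `ρ`-masses of translates of the sets
`{w | t < μ (closedBall w r)}`, which are radially decreasing by the unimodality of `μ`. -/
theorem IsUnimodal.conv [BorelSpace E] [SecondCountableTopology E] {μ ρ : Measure E}
    [IsFiniteMeasure μ] [IsFiniteMeasure ρ] (hμ : IsUnimodal μ) (hρ : IsUnimodal ρ) :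
    IsUnimodal (μ ∗ ρ) := by
  intro r x y hxy
  have hmeas : ∀ v : E, Measurable fun z => μ (Metric.closedBall (v - z) r) := by
    intro v
    have hS : MeasurableSet {p : E × E | dist p.2 (v - p.1) ≤ r} :=
      measurableSet_le (by fun_prop) (by fun_prop)
    exact measurable_measure_prodMk_left hS
  have hconv : ∀ v : E, (μ ∗ ρ) (Metric.closedBall v r) =
      ∫⁻ t in Ioi (0 : ℝ), ρ {z | t < (μ (Metric.closedBall (v - z) r)).toReal} := by
    intro v
    have hm := Metric.isClosed_closedBall (x := v) (ε := r) |>.measurableSet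
    have hadd : Measurable fun p : E × E => p.1 + p.2 := by fun_prop
    have h1 : (μ ∗ ρ) (Metric.closedBall v r) = ∫⁻ z, μ (Metric.closedBall (v - z) r) ∂ρ := by
      rw [Measure.conv, Measure.map_apply (by fun_prop) hm,
        Measure.prod_apply_symm (hadd hm)]
      refine lintegral_congr fun z => ?_
      congr 1
      ext w
      simp [dist_eq_norm, sub_sub_eq_add_sub]
    rw [h1, ← lintegral_eq_lintegral_meas_lt ρ (Eventually.of_forall fun z => ENNReal.toReal_nonneg)
      (hmeas v).ennreal_toReal.aemeasurable]
    refine lintegral_congr fun z => ?_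
    rw [ENNReal.ofReal_toReal (measure_ne_top _ _)]
  rw [hconv, hconv]
  refine lintegral_mono fun t => ?_
  refine hρ.measure_sub_mem_le (D := {w | t < (μ (Metric.closedBall w r)).toReal}) ?_ hxy
  intro w w' hw hw'
  exact lt_of_lt_of_le hw'
    (ENNReal.toReal_mono (measure_ne_top _ _) (hμ r w w' hw))

/-- Unimodality of the laws passes to almost sure limits. -/
theorem isUnimodal_map_of_tendsto_ae [BorelSpace E] [SecondCountableTopology E] {Ω : Type*}
    [MeasurableSpace Ω] {P : Measure Ω} [IsProbabilityMeasure P] {S : ℕ → Ω → E} {Y : Ω → E}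
    (hS : ∀ n, Measurable (S n)) (hY : Measurable Y)
    (hlim : ∀ᵐ ω ∂P, Tendsto (fun n => S n ω) atTop (𝓝 (Y ω)))
    (h : ∀ n, IsUnimodal (P.map (S n))) : IsUnimodal (P.map Y) := by
  intro r x y hxy
  have hmb : ∀ (v : E) (s : ℝ), MeasurableSet (Metric.closedBall v s) := fun v s =>
    Metric.isClosed_closedBall.measurableSet
  have hstep : ∀ ε : ℝ, 0 < ε →
      P.map Y (Metric.closedBall y r) ≤ P.map Y (Metric.closedBall x (r + 2 * ε)) := by
    intro ε hε
    have htm := tendstoInMeasure_of_tendsto_ae (fun n => (hS n).aestronglyMeasurable) hlim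
    have htm' := tendstoInMeasure_iff_dist.1 htm ε hε
    have hbound : ∀ n, P.map Y (Metric.closedBall y r) ≤
        P.map Y (Metric.closedBall x (r + 2 * ε)) +
          (P {ω | ε ≤ dist (S n ω) (Y ω)} + P {ω | ε ≤ dist (S n ω) (Y ω)}) := by
      intro n
      calc P.map Y (Metric.closedBall y r) = P (Y ⁻¹' Metric.closedBall y r) :=
            Measure.map_apply hY (hmb _ _)
        _ ≤ P (S n ⁻¹' Metric.closedBall y (r + ε) ∪ {ω | ε ≤ dist (S n ω) (Y ω)}) := by
            refine measure_mono fun ω hω => ?_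
            by_cases hc : ε ≤ dist (S n ω) (Y ω)
            · exact Or.inr hc
            · left
              have h1 : dist (Y ω) y ≤ r := hω
              have := dist_triangle (S n ω) (Y ω) y
              show dist (S n ω) y ≤ r + ε
              linarith [not_le.1 hc]
        _ ≤ P (S n ⁻¹' Metric.closedBall y (r + ε)) + P {ω | ε ≤ dist (S n ω) (Y ω)} :=
            measure_union_le _ _
        _ ≤ P (S n ⁻¹' Metric.closedBall x (r + ε)) + P {ω | ε ≤ dist (S n ω) (Y ω)} := by
            refine add_le_add_left ?_ _
            have := h n (r + ε) x y hxy
            rwa [Measure.map_apply (hS n) (hmb _ _), Measure.map_apply (hS n) (hmb _ _)] at this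
        _ ≤ P (Y ⁻¹' Metric.closedBall x (r + 2 * ε) ∪ {ω | ε ≤ dist (S n ω) (Y ω)}) +
              P {ω | ε ≤ dist (S n ω) (Y ω)} := by
            gcongr
            intro ω hω
            by_cases hc : ε ≤ dist (S n ω) (Y ω)
            · exact Or.inr hc
            · left
              have h1 : dist (S n ω) x ≤ r + ε := hω
              have := dist_triangle_left (Y ω) x (S n ω)
              show dist (Y ω) x ≤ r + 2 * ε
              linarith [not_le.1 hc]
        _ ≤ _ := by
            rw [Measure.map_apply hY (hmb _ _), ← add_assoc]
            gcongr
            exact measure_union_le _ _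
    have hlim0 : Tendsto (fun n => P.map Y (Metric.closedBall x (r + 2 * ε)) +
          (P {ω | ε ≤ dist (S n ω) (Y ω)} + P {ω | ε ≤ dist (S n ω) (Y ω)})) atTop
          (𝓝 (P.map Y (Metric.closedBall x (r + 2 * ε)) + (0 + 0))) :=
      tendsto_const_nhds.add (htm'.add htm')
    simpa using ge_of_tendsto' hlim0 hbound
  have hinter : Metric.closedBall x r = ⋂ n : ℕ, Metric.closedBall x (r + 2 * (1 / (n + 1))) := by
    ext z
    simp only [Metric.mem_closedBall, mem_iInter]
    constructor
    · intro hz n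
      have : (0 : ℝ) < 1 / (n + 1) := by positivity
      linarith
    · intro hz
      have : Tendsto (fun n : ℕ => r + 2 * (1 / ((n : ℝ) + 1))) atTop (𝓝 (r + 2 * 0)) :=
        tendsto_const_nhds.add (tendsto_one_div_add_atTop_nhds_zero_nat.const_mul 2)
      simpa using ge_of_tendsto' this hz
  have : IsProbabilityMeasure (P.map Y) := Measure.isProbabilityMeasure_map hY.aemeasurable
  have hanti : Antitone fun n : ℕ => Metric.closedBall x (r + 2 * (1 / ((n : ℝ) + 1))) := by
    intro m n hmn
    refine Metric.closedBall_subset_closedBall ?_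
    have : (1 : ℝ) / (n + 1) ≤ 1 / (m + 1) := Nat.one_div_le_one_div hmn
    linarith
  rw [hinter, hanti.measure_iInter (fun n => (hmb _ _).nullMeasurableSet)
    ⟨0, measure_ne_top _ _⟩]
  exact le_iInf fun n => hstep _ (by positivity)

end Unimodal

/-! ### Unimodality and radially nonincreasing densities -/

/-- The reflection `z ↦ L (z - m) + m` in the bisector of `x` and `y` moves points that are
closer to `y` than to `x` towards the origin, if the origin is closer to `x`. -/
theorem norm_bisector_reflection_le {E : Type*} [NormedAddCommGroup E] [InnerProductSpace ℝ E]
    {x y z : E} (hxy : ‖x‖ ≤ ‖y‖) (hz : ‖z - y‖ ≤ ‖z - x‖) :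
    ‖(ℝ ∙ (x - y))ᗮ.reflection (z - (2⁻¹ : ℝ) • (x + y)) + (2⁻¹ : ℝ) • (x + y)‖ ≤ ‖z‖ := by
  set m : E := (2⁻¹ : ℝ) • (x + y) with hm
  set u : E := x - y with hu
  rcases eq_or_ne u 0 with h0 | h0
  · rw [Submodule.reflection_mem_subspace_eq_self (by simp [h0]), sub_add_cancel]
  have hL : (ℝ ∙ u)ᗮ.reflection (z - m) = (z - m) - (2 * (⟪u, z - m⟫ / ‖u‖ ^ 2)) • u := by
    rw [Submodule.reflection_orthogonal_apply, Submodule.reflection_singleton_apply]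
    simp only [RCLike.ofReal_real_eq_id, id, two_smul, two_mul, add_smul]
    abel
  have hmu : ⟪u, m⟫ ≤ 0 := by
    have : ⟪u, m⟫ = 2⁻¹ * (‖x‖ ^ 2 - ‖y‖ ^ 2) := by
      rw [hm, hu, inner_smul_right, inner_sub_left, inner_add_right, inner_add_right,
        real_inner_self_eq_norm_sq, real_inner_self_eq_norm_sq, real_inner_comm x y]
      ring
    rw [this]
    nlinarith [norm_nonneg x, norm_nonneg y]
  have hzu : ⟪u, z - m⟫ ≤ 0 := by
    have h1 : ‖z - y‖ ^ 2 ≤ ‖z - x‖ ^ 2 := by gcongr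
    have h2 : z - y = (z - m) + (2⁻¹ : ℝ) • u := by rw [hm, hu]; module
    have h3 : z - x = (z - m) - (2⁻¹ : ℝ) • u := by rw [hm, hu]; module
    rw [h2, h3] at h1
    generalize z - m = w at h1 ⊢
    rw [norm_add_sq_real, norm_sub_sq_real, inner_smul_right, real_inner_comm] at h1
    linarith
  rw [hL]
  have hu2 : 0 < ‖u‖ ^ 2 := by positivity
  have hval : ‖z - m - (2 * (⟪u, z - m⟫ / ‖u‖ ^ 2)) • u + m‖ ^ 2 =
      ‖z‖ ^ 2 - 4 * (⟪u, z - m⟫ * ⟪u, m⟫) / ‖u‖ ^ 2 := by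
    have : z - m - (2 * (⟪u, z - m⟫ / ‖u‖ ^ 2)) • u + m =
        z - (2 * (⟪u, z - m⟫ / ‖u‖ ^ 2)) • u := by abel
    have hzz : ⟪z, u⟫ = ⟪u, z - m⟫ + ⟪u, m⟫ := by
      rw [← inner_add_right, sub_add_cancel, real_inner_comm]
    rw [this, norm_sub_sq_real, inner_smul_right, norm_smul, mul_pow, Real.norm_eq_abs, sq_abs, hzz]
    generalize ⟪u, z - m⟫ = a
    field_simp
    ring
  have hpos : 0 ≤ 4 * (⟪u, z - m⟫ * ⟪u, m⟫) / ‖u‖ ^ 2 :=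
    div_nonneg (by nlinarith [mul_nonneg_of_nonpos_of_nonpos hzu hmu]) hu2.le
  exact le_of_sq_le_sq (by linarith) (norm_nonneg _)

section Density

variable {E : Type*} [NormedAddCommGroup E] [InnerProductSpace ℝ E] [FiniteDimensional ℝ E]
  [MeasurableSpace E] [BorelSpace E]

/-- The reflection in the bisector of `x` and `y` exchanges the differences of the balls around `x`
and around `y`, and increases the density on the second one. The value of the density at the origin
is irrelevant. -/
theorem isUnimodal_withDensity [Nontrivial E] {f : E → ℝ≥0∞}
    (hf : ∀ x y, x ≠ 0 → ‖x‖ ≤ ‖y‖ → f y ≤ f x) :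
    IsUnimodal ((volume : Measure E).withDensity f) := by
  intro r x y hxy
  have hmb : ∀ v : E, MeasurableSet (Metric.closedBall v r) := fun v =>
    Metric.isClosed_closedBall.measurableSet
  rw [withDensity_apply _ (hmb y), withDensity_apply _ (hmb x)]
  set L := (ℝ ∙ (x - y))ᗮ.reflection with hL
  set m : E := (2⁻¹ : ℝ) • (x + y) with hm
  set σ : E → E := fun z => L (z - m) + m with hσ
  have hσmp : MeasurePreserving σ :=
    (measurePreserving_add_right volume m).comp
      (L.measurePreserving.comp (measurePreserving_sub_right volume m))
  have hσσ : Function.Involutive σ := by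
    intro z
    simp only [hσ, add_sub_cancel_right, hL, Submodule.reflection_reflection, sub_add_cancel]
  have hLu : L (x - y) = -(x - y) := Submodule.reflection_orthogonalComplement_singleton_eq_neg _
  have hσx : σ x = y := by
    have : x - m = (2⁻¹ : ℝ) • (x - y) := by rw [hm]; module
    show L (x - m) + m = y
    rw [this, map_smul, hLu, hm]
    module
  have hσdist : ∀ z w, dist (σ z) (σ w) = dist z w := by
    intro z w
    simp [hσ]
  have hemb : MeasurableEmbedding σ := by
    have : Continuous σ := by fun_prop
    exact this.measurableEmbedding hσσ.injective
  have hpre : σ ⁻¹' (Metric.closedBall y r \ Metric.closedBall x r) =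
      Metric.closedBall x r \ Metric.closedBall y r := by
    ext z
    have h1 : dist (σ z) y = dist z x := by rw [← hσx, hσdist]
    have h2 : dist (σ z) x = dist z y := by
      rw [← hσσ x, hσdist, hσx]
    simp [Metric.mem_closedBall, h1, h2]
  have hne : ∀ᵐ z : E, σ z ≠ 0 := by
    have : (volume : Measure E) {z | σ z = 0} = 0 := by
      have := hσmp.measure_preimage (s := {0}) (measurableSet_singleton _).nullMeasurableSet
      rw [measure_singleton] at this
      exact this
    exact measure_eq_zero_iff_ae_notMem.1 this
  have hdiff : ∫⁻ z in Metric.closedBall y r \ Metric.closedBall x r, f z ≤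
      ∫⁻ z in Metric.closedBall x r \ Metric.closedBall y r, f z := by
    calc ∫⁻ z in Metric.closedBall y r \ Metric.closedBall x r, f z
        ≤ ∫⁻ z in Metric.closedBall y r \ Metric.closedBall x r, f (σ z) := by
          refine setLIntegral_mono_ae' ((hmb y).diff (hmb x)) ?_
          filter_upwards [hne] with z hz hzA
          refine hf _ _ hz (norm_bisector_reflection_le hxy ?_)
          have h1 := hzA.1
          have h2 := hzA.2
          rw [Metric.mem_closedBall, dist_eq_norm] at h1 h2
          linarith
      _ = ∫⁻ z in Metric.closedBall x r \ Metric.closedBall y r, f z := by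
          rw [← hσmp.setLIntegral_comp_preimage_emb hemb f (_ \ _)]
          congr 2
          rw [← hpre, ← preimage_comp, hσσ.comp_self, preimage_id]
  rw [← lintegral_inter_add_sdiff f (Metric.closedBall y r) (hmb x),
    ← lintegral_inter_add_sdiff f (Metric.closedBall x r) (hmb y), inter_comm]
  gcongr

/-- Averaging the mass of `closedBall y s` over `‖y‖ ≤ R` bounds the mass of balls centred
outside of `closedBall 0 R`. -/
theorem IsUnimodal.measure_closedBall_mul_le {μ : Measure E} [IsFiniteMeasure μ]
    (hμ : IsUnimodal μ) {x : E} {R s : ℝ} (hx : R ≤ ‖x‖) :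
    μ (Metric.closedBall x s) * volume (Metric.closedBall (0 : E) R) ≤
      μ univ * volume (Metric.closedBall (0 : E) s) := by
  have hS : MeasurableSet {p : E × E | dist p.2 p.1 ≤ s} :=
    measurableSet_le (by fun_prop) (by fun_prop)
  calc μ (Metric.closedBall x s) * volume (Metric.closedBall (0 : E) R)
      = ∫⁻ _ in Metric.closedBall (0 : E) R, μ (Metric.closedBall x s) := by simp
    _ ≤ ∫⁻ y in Metric.closedBall (0 : E) R, μ (Metric.closedBall y s) := by
        refine setLIntegral_mono' Metric.isClosed_closedBall.measurableSet fun y hy => ?_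
        exact hμ s y x ((mem_closedBall_zero_iff.1 hy).trans hx)
    _ ≤ ∫⁻ y, μ (Metric.closedBall y s) := setLIntegral_le_lintegral _ _
    _ = (volume.prod μ) {p : E × E | dist p.2 p.1 ≤ s} := by
        rw [Measure.prod_apply hS]
        rfl
    _ = ∫⁻ z, volume (Metric.closedBall z s) ∂μ := by
        rw [Measure.prod_apply_symm hS]
        refine lintegral_congr fun z => ?_
        congr 1
        ext w
        simp [dist_comm]
    _ = μ univ * volume (Metric.closedBall (0 : E) s) := by
        simp_rw [Measure.addHaar_closedBall_center volume _ s]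
        simp [mul_comm]

theorem IsUnimodal.exists_measure_closedBall_le {μ : Measure E} [IsFiniteMeasure μ]
    (hμ : IsUnimodal μ) {R : ℝ} (hR : 0 < R) : ∃ C : ℝ≥0, ∀ (x : E) (s : ℝ), R ≤ ‖x‖ →
      μ (Metric.closedBall x s) ≤ C * volume (Metric.closedBall x s) := by
  have hV0 : volume (Metric.closedBall (0 : E) R) ≠ 0 := (Metric.measure_closedBall_pos _ _ hR).ne'
  have hVt : volume (Metric.closedBall (0 : E) R) ≠ ∞ := measure_closedBall_lt_top.ne
  have hC : μ univ / volume (Metric.closedBall (0 : E) R) ≠ ∞ :=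
    ENNReal.div_ne_top (measure_ne_top _ _) hV0
  refine ⟨(μ univ / volume (Metric.closedBall (0 : E) R)).toNNReal, fun x s hx => ?_⟩
  rw [ENNReal.coe_toNNReal hC, Measure.addHaar_closedBall_center volume x s, ENNReal.mul_comm_div,
    ← mul_div_assoc, ENNReal.le_div_iff_mul_le (Or.inl hV0) (Or.inl hVt)]
  exact hμ.measure_closedBall_mul_le hx

/-- Away from the origin a finite unimodal measure has locally bounded density, so it can only
charge Lebesgue null sets through an atom at the origin. -/
theorem IsUnimodal.absolutelyContinuous {μ : Measure E} [IsFiniteMeasure μ]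
    (hμ : IsUnimodal μ) (h0 : μ {0} = 0) : μ ≪ volume := by
  intro A hA
  have hcover : A ⊆ {0} ∪ ⋃ n : ℕ, A ∩ {x | 1 / ((n : ℝ) + 1) ≤ ‖x‖} := by
    intro x hx
    rcases eq_or_ne x 0 with rfl | hx0
    · exact Or.inl rfl
    · obtain ⟨n, hn⟩ := exists_nat_one_div_lt (norm_pos_iff.2 hx0)
      exact Or.inr (mem_iUnion.2 ⟨n, hx, hn.le⟩)
  refine measure_mono_null hcover (measure_union_null h0 (measure_iUnion_null fun n => ?_))
  obtain ⟨C, hC⟩ := hμ.exists_measure_closedBall_le (R := 1 / ((n : ℝ) + 1)) (by positivity)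
  have hle := (Besicovitch.vitaliFamily μ).measure_le_of_frequently_le (C • volume : Measure E)
    (Measure.AbsolutelyContinuous.refl μ) (A ∩ {x | 1 / ((n : ℝ) + 1) ≤ ‖x‖}) (by
      intro x hx
      refine (Besicovitch.tendsto_filterAt μ x).frequently (Eventually.frequently ?_)
      exact Eventually.of_forall fun s => by simpa using hC x s hx.2)
  refine le_antisymm (hle.trans ?_) zero_le
  rw [Measure.smul_apply, measure_mono_null inter_subset_left hA, smul_zero]

/-- A finite unimodal measure without atom at the origin has a radially nonincreasing density,
obtained by differentiating the measure along balls. -/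
theorem IsUnimodal.exists_density [Nontrivial E] {μ : Measure E} [IsFiniteMeasure μ]
    (hμ : IsUnimodal μ) (h0 : μ {0} = 0) :
    ∃ q : ℝ → ℝ, (∀ r, 0 ≤ q r) ∧ AntitoneOn q (Ioi 0) ∧
      μ = volume.withDensity fun x => ENNReal.ofReal (q ‖x‖) := by
  set D : E → ℝ≥0∞ := fun x =>
    limsup (fun s => μ (Metric.closedBall x s) / volume (Metric.closedBall x s)) (𝓝[>] (0 : ℝ))
    with hD
  have hDanti : ∀ x y : E, ‖x‖ ≤ ‖y‖ → D y ≤ D x := by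
    intro x y hxy
    refine limsup_le_limsup (Eventually.of_forall fun s => ?_)
    simp only [Measure.addHaar_closedBall_center volume _ s]
    exact ENNReal.div_le_div_right (hμ s x y hxy) _
  have hDfin : ∀ x : E, x ≠ 0 → D x ≠ ∞ := by
    intro x hx
    obtain ⟨C, hC⟩ := hμ.exists_measure_closedBall_le (norm_pos_iff.2 hx)
    refine ne_top_of_le_ne_top (b := (C : ℝ≥0∞)) ENNReal.coe_ne_top ?_
    refine limsup_le_of_le (by isBoundedDefault) (Eventually.of_forall fun s => ?_)
    exact ENNReal.div_le_of_le_mul (hC x s le_rfl)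
  obtain ⟨e, he⟩ := exists_norm_eq E zero_le_one
  have hDe : ∀ x : E, D x = D (‖x‖ • e) := by
    intro x
    have : ‖‖x‖ • e‖ = ‖x‖ := by simp [norm_smul, he]
    exact le_antisymm (hDanti _ _ this.le) (hDanti _ _ this.ge)
  refine ⟨fun r => (D (r • e)).toReal, fun r => ENNReal.toReal_nonneg, ?_, ?_⟩
  · intro a ha b hb hab
    have ha' : 0 < a := ha
    have he0 : e ≠ 0 := by rintro rfl; simp at he
    refine ENNReal.toReal_mono (hDfin _ (smul_ne_zero ha'.ne' he0)) (hDanti _ _ ?_)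
    rw [norm_smul, norm_smul, he, Real.norm_of_nonneg ha'.le,
      Real.norm_of_nonneg (ha'.le.trans hab)]
    simpa using hab
  · conv_lhs => rw [← Measure.withDensity_rnDeriv_eq μ volume (hμ.absolutelyContinuous h0)]
    refine withDensity_congr_ae ?_
    have hne : ∀ᵐ x : E, x ≠ 0 := by
      rw [ae_iff]
      simp
    filter_upwards [Besicovitch.ae_tendsto_rnDeriv μ (volume : Measure E), hne] with x hx hx0
    rw [← hDe, ENNReal.ofReal_toReal (hDfin x hx0)]
    exact hx.limsup_eq.symm

end Density

/-! ### Continuity of radially nonincreasing densities, and absence of atoms -/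

section ContinuousDensity

variable {E : Type*} [NormedAddCommGroup E] [InnerProductSpace ℝ E] [FiniteDimensional ℝ E]
  [MeasurableSpace E] [BorelSpace E]

/-- A radially nonincreasing function which agrees almost everywhere with a function continuous at
`x ≠ 0` is continuous at the radius `‖x‖`, with the same value. -/
theorem continuousAt_of_ae_eq_of_antitoneOn {q : ℝ → ℝ} (hq : AntitoneOn q (Ioi 0)) {G : E → ℝ}
    {x : E} (hx : x ≠ 0) (hG : ContinuousAt G x) (hqG : ∀ᵐ y : E, q ‖y‖ = G y) :
    q ‖x‖ = G x ∧ ContinuousAt q ‖x‖ := by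
  have hxpos : 0 < ‖x‖ := norm_pos_iff.2 hx
  have hcurve : ContinuousAt (fun c : ℝ => c • x) 1 := by fun_prop
  -- good points, with norms on both sides of `‖x‖`, at which `q` is close to `G x`
  have hgood : ∀ ε : ℝ, 0 < ε → ∀ J : Set ℝ, IsOpen J → (∃ᶠ c in 𝓝 (1 : ℝ), c * ‖x‖ ∈ J) →
      ∃ y : E, 0 < ‖y‖ ∧ ‖y‖ ∈ J ∧ |q ‖y‖ - G x| < ε := by
    intro ε hε J hJ hfr
    have h1 : ∀ᶠ y in 𝓝 x, |G y - G x| < ε := by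
      simpa [Real.dist_eq] using Metric.tendsto_nhds.1 hG.tendsto ε hε
    obtain ⟨U, hUsub, hUo, hxU⟩ := eventually_nhds_iff.1 (h1.and (eventually_ne_nhds hx))
    have h2 : ∀ᶠ c in 𝓝 (1 : ℝ), c • x ∈ U ∧ 0 < c := by
      refine (hcurve.eventually_mem ?_).and (lt_mem_nhds one_pos)
      simpa using hUo.mem_nhds hxU
    obtain ⟨c, hcJ, hcU, hc0⟩ := (hfr.and_eventually h2).exists
    have hopen : IsOpen (U ∩ {y | ‖y‖ ∈ J}) := hUo.inter (hJ.preimage continuous_norm)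
    have hne : (U ∩ {y | ‖y‖ ∈ J}).Nonempty := ⟨c • x, hcU, by
      simpa [norm_smul, abs_of_pos hc0] using hcJ⟩
    obtain ⟨y, ⟨hyU, hyJ⟩, hy⟩ := Measure.exists_mem_of_measure_ne_zero_of_ae
      (hopen.measure_pos volume hne).ne' (ae_restrict_of_ae hqG)
    exact ⟨y, norm_pos_iff.2 (hUsub y hyU).2, hyJ, by rw [hy]; exact (hUsub y hyU).1⟩
  have hlow : ∃ᶠ c in 𝓝 (1 : ℝ), c * ‖x‖ ∈ Iio ‖x‖ := by
    have : ∃ᶠ c in 𝓝 (1 : ℝ), c < 1 := frequently_lt_nhds 1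
    exact this.mono fun c hc => by rw [mem_Iio]; nlinarith
  have hhigh : ∃ᶠ c in 𝓝 (1 : ℝ), c * ‖x‖ ∈ Ioi ‖x‖ := by
    have : ∃ᶠ c in 𝓝 (1 : ℝ), 1 < c := frequently_gt_nhds 1
    exact this.mono fun c hc => by rw [mem_Ioi]; nlinarith
  have hmain : ∀ ε : ℝ, 0 < ε → ∀ᶠ r in 𝓝 ‖x‖, |q r - G x| < ε := by
    intro ε hε
    obtain ⟨y₁, hy₁, hy₁J, hy₁ε⟩ := hgood ε hε _ isOpen_Iio hlow
    obtain ⟨y₂, hy₂, hy₂J, hy₂ε⟩ := hgood ε hε _ isOpen_Ioi hhigh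
    filter_upwards [Ioo_mem_nhds hy₁J hy₂J] with r hr
    have hr0 : 0 < r := hy₁.trans hr.1
    have h1 := hq hy₁ hr0 hr.1.le
    have h2 := hq hr0 hy₂ hr.2.le
    rw [abs_lt] at *
    constructor <;> linarith
  have heq : q ‖x‖ = G x := by
    by_contra hne
    have := (hmain _ (abs_pos.2 (sub_ne_zero.2 hne))).self_of_nhds
    exact lt_irrefl _ this
  refine ⟨heq, Metric.tendsto_nhds.2 fun ε hε => ?_⟩
  rw [heq]
  simpa [Real.dist_eq] using hmain ε hε

/-- A monotone function has countably many discontinuities, and spheres are Lebesgue null. -/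
theorem ae_continuousAt_norm_sub [Nontrivial E] {q : ℝ → ℝ} (hq : AntitoneOn q (Ioi 0)) (x : E) :
    ∀ᵐ y : E, ContinuousAt q ‖x - y‖ := by
  have hc : Set.Countable ({0} ∪ {r ∈ Ioi (0 : ℝ) | ¬ContinuousWithinAt q (Ioi 0) r}) :=
    (countable_singleton 0).union hq.countable_not_continuousWithinAt
  have hnull : (volume : Measure E)
      (⋃ r ∈ ({0} ∪ {r ∈ Ioi (0 : ℝ) | ¬ContinuousWithinAt q (Ioi 0) r}), Metric.sphere x r) = 0 :=
    (measure_biUnion_null_iff hc).2 fun r _ => Measure.addHaar_sphere volume x r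
  filter_upwards [measure_eq_zero_iff_ae_notMem.1 hnull] with y hy
  simp only [mem_iUnion, Metric.mem_sphere, not_exists, exists_prop, not_and] at hy
  have hy' : ‖x - y‖ ∉ ({0} ∪ {r ∈ Ioi (0 : ℝ) | ¬ContinuousWithinAt q (Ioi 0) r}) := by
    intro h
    exact hy _ h (by rw [dist_comm, dist_eq_norm])
  rw [mem_union, not_or, mem_singleton_iff, mem_ofPred_eq, not_and, not_not] at hy'
  have hpos : 0 < ‖x - y‖ := lt_of_le_of_ne (norm_nonneg _) (Ne.symm hy'.1)
  exact (hy'.2 hpos).continuousAt (Ioi_mem_nhds hpos)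

theorem ae_norm_sub_ne_norm {x : E} (hx : x ≠ 0) : ∀ᵐ y : E, ‖x - y‖ ≠ ‖y‖ := by
  have hsub : {y : E | ‖x - y‖ = ‖y‖} ⊆ (AffineSubspace.perpBisector x (0 : E) : Set E) := by
    intro y hy
    rw [SetLike.mem_coe, AffineSubspace.mem_perpBisector_iff_dist_eq, dist_comm, dist_eq_norm,
      dist_zero_right]
    exact hy
  have hne : AffineSubspace.perpBisector x (0 : E) ≠ ⊤ := by
    rw [Ne, AffineSubspace.perpBisector_eq_top]
    exact hx
  exact measure_eq_zero_iff_ae_notMem.1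
    (measure_mono_null hsub (Measure.addHaar_affineSubspace volume _ hne))

/-- A function monotone on `(0, ∞)` may be arbitrary elsewhere; its extension by zero is
measurable. -/
theorem measurable_indicator_of_antitoneOn {q : ℝ → ℝ} (hq : AntitoneOn q (Ioi 0)) :
    Measurable ((Ioi 0).indicator q) := by
  refine measurable_of_restrict_of_restrict_compl (s := Ioi 0) measurableSet_Ioi ?_ ?_
  · have : (Ioi 0).domRestrict ((Ioi 0).indicator q) = fun x : Ioi (0 : ℝ) => q x := by
      ext x
      exact indicator_of_mem x.2 q
    rw [this]
    exact Antitone.measurable fun x y hxy => hq x.2 y.2 hxy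
  · have : (Ioi 0)ᶜ.domRestrict ((Ioi 0).indicator q) = fun _ => 0 := by
      ext x
      exact indicator_of_notMem x.2 q
    rw [this]
    exact measurable_const

/-- The half `{y | ‖y‖ < ‖x - y‖}` of the self-convolution of the density `q (‖y‖)`, where the
factor `q (‖x - y‖)` stays bounded, depends continuously on `x ≠ 0`. -/
theorem continuousAt_half_selfConvolution [Nontrivial E] {q : ℝ → ℝ} (hm : Measurable q)
    (hq : AntitoneOn q (Ioi 0)) (hfin : ∫⁻ y : E, ENNReal.ofReal (q ‖y‖) ≠ ∞) {x : E} (hx : x ≠ 0) :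
    ContinuousAt (fun z : E => ∫⁻ y in {y | ‖y‖ < ‖z - y‖},
      ENNReal.ofReal (q ‖y‖) * ENNReal.ofReal (q ‖z - y‖)) x ∧
    ∫⁻ y in {y | ‖y‖ < ‖x - y‖}, ENNReal.ofReal (q ‖y‖) * ENNReal.ofReal (q ‖x - y‖) ≠ ∞ := by
  have hxpos : 0 < ‖x‖ := norm_pos_iff.2 hx
  set F : E → E → ℝ≥0∞ := fun z => ({y | ‖y‖ < ‖z - y‖} : Set E).indicator
    fun y => ENNReal.ofReal (q ‖y‖) * ENNReal.ofReal (q ‖z - y‖) with hF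
  have hset : ∀ z : E, MeasurableSet ({y | ‖y‖ < ‖z - y‖} : Set E) := fun z =>
    measurableSet_lt (by fun_prop) (by fun_prop)
  have hFm : ∀ z, Measurable (F z) := fun z =>
    Measurable.indicator (by fun_prop) (hset z)
  have hFint : ∀ z : E, ∫⁻ y in {y | ‖y‖ < ‖z - y‖},
      ENNReal.ofReal (q ‖y‖) * ENNReal.ofReal (q ‖z - y‖) = ∫⁻ y, F z y := fun z =>
    (lintegral_indicator (hset z) _).symm
  set b : E → ℝ≥0∞ := fun y => ENNReal.ofReal (q ‖y‖) * ENNReal.ofReal (q (‖x‖ / 4)) with hb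
  have hbfin : ∫⁻ y, b y ≠ ∞ := by
    rw [hb, lintegral_mul_const _ (by fun_prop)]
    exact ENNReal.mul_ne_top hfin ENNReal.ofReal_ne_top
  have hFb : ∀ z : E, ‖x‖ / 2 < ‖z‖ → ∀ y, F z y ≤ b y := by
    intro z hz y
    refine indicator_le (fun y hy => ?_) y
    refine mul_le_mul_right (ENNReal.ofReal_le_ofReal ?_) _
    have hy' : ‖y‖ < ‖z - y‖ := hy
    have := norm_add_le (z - y) y
    rw [sub_add_cancel] at this
    exact hq (by rw [mem_Ioi]; linarith) (by rw [mem_Ioi]; linarith) (by linarith)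
  simp_rw [hFint]
  constructor
  · refine tendsto_lintegral_filter_of_dominated_convergence b (Eventually.of_forall hFm) ?_
      hbfin ?_
    · have : ∀ᶠ z in 𝓝 x, ‖x‖ / 2 < ‖z‖ :=
        continuous_norm.continuousAt.eventually_const_lt (by linarith)
      filter_upwards [this] with z hz using Eventually.of_forall (hFb z hz)
    · filter_upwards [ae_continuousAt_norm_sub hq x, ae_norm_sub_ne_norm hx] with y hy hyne
      have hcn : ContinuousAt (fun z : E => ‖z - y‖) x := by fun_prop
      rcases lt_or_gt_of_ne hyne with hlt | hlt
      · have : ∀ᶠ z in 𝓝 x, F z y = 0 := by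
          filter_upwards [hcn.eventually_lt_const hlt] with z hz
          exact indicator_of_notMem (by simpa using hz.le) _
        rw [show F x y = 0 from this.self_of_nhds]
        exact tendsto_const_nhds.congr' (this.mono fun z hz => hz.symm)
      · have : ∀ᶠ z in 𝓝 x, F z y = ENNReal.ofReal (q ‖y‖) * ENNReal.ofReal (q ‖z - y‖) := by
          filter_upwards [hcn.eventually_const_lt hlt] with z hz
          exact indicator_of_mem (show y ∈ ({y | ‖y‖ < ‖z - y‖} : Set E) from hz) _
        rw [this.self_of_nhds]
        refine Tendsto.congr' (this.mono fun z hz => hz.symm) ?_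
        refine ENNReal.Tendsto.const_mul ?_ (Or.inr ENNReal.ofReal_ne_top)
        refine (ENNReal.continuous_ofReal.tendsto _).comp ?_
        exact ContinuousAt.comp (f := fun z : E => ‖z - y‖) (g := q) hy hcn
  · exact ne_top_of_le_ne_top hbfin (lintegral_mono (hFb x (by linarith)))

/-- The radially nonincreasing density of a self-convolution of a finite measure with radially
nonincreasing density is continuous away from the origin. -/
theorem continuousAt_density_selfConvolution [Nontrivial E] {q₀ q : ℝ → ℝ}
    (hq₀ : AntitoneOn q₀ (Ioi 0)) (hq : AntitoneOn q (Ioi 0)) (hqnn : ∀ r, 0 < r → 0 ≤ q r)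
    {μ : Measure E} [IsFiniteMeasure μ]
    (hμ : μ = volume.withDensity fun x => ENNReal.ofReal (q₀ ‖x‖))
    (hconv : μ ∗ μ = volume.withDensity fun x => ENNReal.ofReal (q ‖x‖)) {r : ℝ} (hr : 0 < r) :
    ContinuousAt q r := by
  -- measurable versions of the two functions, which may be arbitrary outside of `(0, ∞)`
  set q₁ : ℝ → ℝ := (Ioi 0).indicator q₀
  set q₂ : ℝ → ℝ := (Ioi 0).indicator q
  have hm₁ : Measurable q₁ := measurable_indicator_of_antitoneOn hq₀
  have hm₂ : Measurable q₂ := measurable_indicator_of_antitoneOn hq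
  have hq₁eq : ∀ r, 0 < r → q₁ r = q₀ r := fun r hr => indicator_of_mem hr q₀
  have hq₂eq : ∀ r, 0 < r → q₂ r = q r := fun r hr => indicator_of_mem hr q
  have hq₁ : AntitoneOn q₁ (Ioi 0) := hq₀.congr fun r hr => (hq₁eq r hr).symm
  have hne : ∀ᵐ x : E, 0 < ‖x‖ := by
    have : ∀ᵐ x : E, x ≠ 0 := by rw [ae_iff]; simp
    filter_upwards [this] with x hx using norm_pos_iff.2 hx
  have hμ₁ : μ = volume.withDensity fun x => ENNReal.ofReal (q₁ ‖x‖) := by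
    rw [hμ]
    refine withDensity_congr_ae ?_
    filter_upwards [hne] with x hx
    rw [hq₁eq _ hx]
  set f : E → ℝ≥0∞ := fun x => ENNReal.ofReal (q₁ ‖x‖) with hf
  have hfm : Measurable f := by fun_prop
  have hfin : ∫⁻ y : E, f y ≠ ∞ := by
    have : μ univ = ∫⁻ y : E, f y := by
      rw [hμ₁, withDensity_apply _ MeasurableSet.univ, Measure.restrict_univ]
    rw [← this]
    exact measure_ne_top _ _
  set K : E → ℝ≥0∞ := fun z => ∫⁻ y in {y | ‖y‖ < ‖z - y‖}, f y * f (z - y) with hK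
  have hsplit : ∀ x : E, x ≠ 0 → ∫⁻ y, f y * f (x - y) = 2 * K x := by
    intro x hx
    have hset : MeasurableSet ({y | ‖y‖ < ‖x - y‖} : Set E) :=
      measurableSet_lt (by fun_prop) (by fun_prop)
    have hswap : ∫⁻ y in ({y | ‖y‖ < ‖x - y‖} : Set E)ᶜ, f y * f (x - y) = K x := by
      have hmp : MeasurePreserving (fun y : E => x - y) :=
        Measure.measurePreserving_sub_left volume x
      have hemb : MeasurableEmbedding (fun y : E => x - y) :=
        (MeasurableEquiv.subLeft x).measurableEmbedding
      have h1 := hmp.setLIntegral_comp_preimage_emb hemb (fun y => f y * f (x - y))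
        {y | ‖y‖ < ‖x - y‖}
      rw [hK]
      beta_reduce at h1 ⊢
      rw [← h1]
      have h2 : (({y | ‖y‖ < ‖x - y‖} : Set E)ᶜ : Set E) =ᵐ[volume]
          ((fun y : E => x - y) ⁻¹' {y | ‖y‖ < ‖x - y‖} : Set E) := by
        filter_upwards [ae_norm_sub_ne_norm hx] with y hy
        refine propext ?_
        show ¬ (‖y‖ < ‖x - y‖) ↔ ‖x - y‖ < ‖x - (x - y)‖
        rw [sub_sub_cancel, not_lt]
        exact ⟨fun h => lt_of_le_of_ne h hy, le_of_lt⟩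
      rw [setLIntegral_congr h2]
      refine lintegral_congr fun y => ?_
      rw [sub_sub_cancel, mul_comm]
    rw [← lintegral_add_compl _ hset, hswap, two_mul]
  have hdens : (fun x : E => ENNReal.ofReal (q₂ ‖x‖)) =ᵐ[volume]
      lconvolution f f (volume : Measure E) := by
    have hm : Measurable (lconvolution f f (volume : Measure E)) :=
      measurable_lconvolution volume hfm hfm
    refine (withDensity_eq_iff_of_sigmaFinite (by fun_prop) hm.aemeasurable).1 ?_
    rw [← conv_withDensity_eq_lconvolution hfm hfm, ← hμ₁, hconv]
    refine withDensity_congr_ae ?_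
    filter_upwards [hne] with x hx
    rw [hq₂eq _ hx]
  have hae : ∀ᵐ x : E, q ‖x‖ = (2 * K x).toReal := by
    filter_upwards [hdens, hne] with x hx hx0
    rw [lconvolution_def] at hx
    rw [← hsplit x (norm_pos_iff.1 hx0)]
    simp_rw [neg_add_eq_sub] at hx
    rw [← hx, hq₂eq _ hx0, ENNReal.toReal_ofReal (hqnn _ hx0)]
  obtain ⟨x, hxr⟩ := exists_norm_eq E hr.le
  have hx : x ≠ 0 := by
    rintro rfl
    rw [norm_zero] at hxr
    exact hr.ne hxr
  obtain ⟨hKc, hKfin⟩ := continuousAt_half_selfConvolution hm₁ hq₁ hfin hx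
  have hG : ContinuousAt (fun x : E => (2 * K x).toReal) x := by
    refine (ENNReal.tendsto_toReal (ENNReal.mul_ne_top (by simp) hKfin)).comp ?_
    exact ENNReal.Tendsto.const_mul hKc (Or.inr (by simp))
  rw [← hxr]
  exact (continuousAt_of_ae_eq_of_antitoneOn hq hx hG hae).2

theorem measure_singleton_zero_of_tendsto_charFun_real {μ : Measure ℝ} [IsFiniteMeasure μ]
    (h : Tendsto (fun t : ℝ => charFun μ t) (cocompact ℝ) (𝓝 0)) : μ {0} = 0 := by
  -- the averages of the characteristic function over `[-n, n]` tend to `μ {0}`, and to zero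
  have h1 : Tendsto (fun n : ℕ => ∫ x, Real.sinc (n * x) ∂μ) atTop
      (𝓝 (∫ x, ({0} : Set ℝ).indicator 1 x ∂μ)) := by
    refine tendsto_integral_of_dominated_convergence (fun _ => 1)
      (fun n => by fun_prop) (integrable_const _)
      (fun n => Eventually.of_forall fun x => Real.abs_sinc_le_one _)
      (Eventually.of_forall fun x => ?_)
    rcases eq_or_ne x 0 with rfl | hx
    · simp
    · rw [indicator_of_notMem (by simpa using hx)]
      refine squeeze_zero_norm' (a := fun n : ℕ => |x|⁻¹ * (n : ℝ)⁻¹) ?_ ?_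
      · filter_upwards [eventually_gt_atTop 0] with n hn
        have hn' : (0 : ℝ) < n := by exact_mod_cast hn
        rw [Real.sinc_of_ne_zero (by positivity), norm_div, Real.norm_eq_abs, Real.norm_eq_abs,
          abs_mul, abs_of_pos hn', div_le_iff₀ (by positivity)]
        have : |x|⁻¹ * (n : ℝ)⁻¹ * (n * |x|) = 1 := by
          have := abs_pos.2 hx
          field_simp
        rw [this]
        exact Real.abs_sin_le_one _
      · simpa using (tendsto_inv_atTop_nhds_zero_nat (𝕜 := ℝ)).const_mul |x|⁻¹
  have h2 : Tendsto (fun n : ℕ => ∫ s in (-1 : ℝ)..1, charFun μ (n * s)) atTop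
      (𝓝 (∫ _ in (-1 : ℝ)..1, (0 : ℂ))) := by
    refine intervalIntegral.tendsto_integral_filter_of_dominated_convergence
      (fun _ => μ.real univ) ?_ ?_ (by simp) ?_
    · refine Eventually.of_forall fun n => ?_
      exact ((measurable_charFun (μ := μ)).comp (by fun_prop)).aestronglyMeasurable
    · exact Eventually.of_forall fun n => Eventually.of_forall fun s _ => norm_charFun_le _
    · have : ∀ᵐ s : ℝ, s ≠ 0 := by rw [ae_iff]; simp
      filter_upwards [this] with s hs _
      refine h.comp ?_
      rw [← Metric.cobounded_eq_cocompact, ← tendsto_norm_atTop_iff_cobounded]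
      simp only [norm_mul, Real.norm_natCast]
      exact tendsto_natCast_atTop_atTop.atTop_mul_const (by positivity)
  have h3 : ∀ᶠ n : ℕ in atTop, ∫ s in (-1 : ℝ)..1, charFun μ (n * s) =
      ((2 * ∫ x, Real.sinc (n * x) ∂μ : ℝ) : ℂ) := by
    filter_upwards [eventually_gt_atTop 0] with n hn
    have hn' : (0 : ℝ) < n := by exact_mod_cast hn
    rw [intervalIntegral.integral_comp_mul_left (fun t => charFun μ t) hn'.ne', mul_neg, mul_one,
      integral_charFun_Icc hn', Complex.real_smul]
    push_cast
    have : (n : ℂ) ≠ 0 := by exact_mod_cast hn.ne'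
    field_simp
  have h4 : Tendsto (fun n : ℕ => ((2 * ∫ x, Real.sinc (n * x) ∂μ : ℝ) : ℂ)) atTop (𝓝 0) := by
    simpa using h2.congr' h3
  have h5 : Tendsto (fun n : ℕ => ((2 * ∫ x, Real.sinc (n * x) ∂μ : ℝ) : ℂ)) atTop
      (𝓝 ((2 * ∫ x, ({0} : Set ℝ).indicator 1 x ∂μ : ℝ) : ℂ)) :=
    (Complex.continuous_ofReal.tendsto _).comp (h1.const_mul 2)
  have h6 := tendsto_nhds_unique h5 h4
  rw [integral_indicator_one (measurableSet_singleton _)] at h6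
  have h7 : μ.real {0} = 0 := by
    have : (2 * μ.real {0} : ℝ) = 0 := by exact_mod_cast h6
    linarith
  exact (measureReal_eq_zero_iff).1 h7

/-- A finite measure whose characteristic function vanishes at infinity has no atom at the
origin. -/
theorem measure_singleton_zero_of_tendsto_charFun [Nontrivial E] {μ : Measure E}
    [IsFiniteMeasure μ] (h : Tendsto (charFun μ) (cocompact E) (𝓝 0)) : μ {0} = 0 := by
  obtain ⟨e, he⟩ := exists_norm_eq E zero_le_one
  have hm : Measurable fun x : E => ⟪x, e⟫ := by fun_prop
  have hc : Tendsto (fun t : ℝ => charFun (μ.map fun x => ⟪x, e⟫) t) (cocompact ℝ) (𝓝 0) := by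
    have h1 : ∀ t : ℝ, charFun (μ.map fun x => ⟪x, e⟫) t = charFun μ (t • e) := by
      intro t
      rw [charFun_apply, charFun_apply, integral_map hm.aemeasurable (by fun_prop)]
      refine integral_congr_ae (Eventually.of_forall fun x => ?_)
      simp [inner_smul_right]
    simp_rw [h1]
    refine h.comp ?_
    rw [← Metric.cobounded_eq_cocompact (α := E), ← tendsto_norm_atTop_iff_cobounded]
    simp only [norm_smul, he, mul_one]
    exact tendsto_norm_cocompact_atTop
  have h0 := measure_singleton_zero_of_tendsto_charFun_real hc
  rw [Measure.map_apply hm (measurableSet_singleton _)] at h0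
  refine measure_mono_null ?_ h0
  rintro x rfl
  simp

end ContinuousDensity

/-! ### Càdlàg paths -/

section Cadlag

variable {E : Type*} [NormedAddCommGroup E]

/-- Right-continuous paths with left limits, indexed by `[0, ∞)`. -/
def IsCadlagPath (f : ℝ≥0 → E) : Prop :=
  ∀ t, ContinuousWithinAt f (Ici t) t ∧ ∃ l : E, Tendsto f (𝓝[<] t) (𝓝 l)

theorem isCadlagPath_zero : IsCadlagPath (fun _ : ℝ≥0 => (0 : E)) := fun _ =>
  ⟨continuousWithinAt_const, 0, tendsto_const_nhds⟩

theorem IsCadlagPath.add {f g : ℝ≥0 → E} (hf : IsCadlagPath f) (hg : IsCadlagPath g) :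
    IsCadlagPath fun t => f t + g t := by
  intro t
  obtain ⟨l, hl⟩ := (hf t).2
  obtain ⟨m, hm⟩ := (hg t).2
  exact ⟨(hf t).1.add (hg t).1, l + m, hl.add hm⟩

theorem IsCadlagPath.sum {ι : Type*} {f : ι → ℝ≥0 → E} (s : Finset ι)
    (hf : ∀ i ∈ s, IsCadlagPath (f i)) : IsCadlagPath fun t => ∑ i ∈ s, f i t := by
  classical
  induction s using Finset.induction_on with
  | empty => simpa using isCadlagPath_zero
  | insert a s ha ih =>
    simp_rw [Finset.sum_insert ha]
    exact (hf a (Finset.mem_insert_self _ _)).add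
      (ih fun i hi => hf i (Finset.mem_insert_of_mem hi))

/-- The path of a single jump `x` at time `u`. -/
theorem isCadlagPath_step (u : ℝ) (x : E) :
    IsCadlagPath fun t : ℝ≥0 => if u ≤ (t : ℝ) then x else 0 := by
  intro t
  constructor
  · by_cases h : u ≤ (t : ℝ)
    · refine (continuousWithinAt_const (b := x)).congr (fun s hs => ?_) (if_pos h)
      exact if_pos (h.trans (by exact_mod_cast hs))
    · refine ContinuousAt.continuousWithinAt ?_
      refine (continuousAt_const (y := (0 : E))).congr ?_
      have : ∀ᶠ s : ℝ≥0 in 𝓝 t, (s : ℝ) < u :=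
        NNReal.continuous_coe.continuousAt.eventually_lt_const (not_le.1 h)
      filter_upwards [this] with s hs
      exact (if_neg (not_le.2 hs)).symm
  · by_cases h : u < (t : ℝ)
    · refine ⟨x, tendsto_const_nhds.congr' ?_⟩
      have : ∀ᶠ s : ℝ≥0 in 𝓝 t, u < (s : ℝ) :=
        NNReal.continuous_coe.continuousAt.eventually_const_lt h
      filter_upwards [this.filter_mono nhdsWithin_le_nhds] with s hs
      exact (if_pos hs.le).symm
    · refine ⟨0, tendsto_const_nhds.congr' ?_⟩
      filter_upwards [self_mem_nhdsWithin] with s hs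
      have hs' : (s : ℝ) < t := by exact_mod_cast hs
      exact (if_neg (by linarith)).symm

/-- A series of càdlàg paths which is eventually dominated, on every bounded interval, by a
summable sequence converges to a càdlàg path. -/
theorem isCadlagPath_tsum [CompleteSpace E] {g : ℕ → ℝ≥0 → E} (hg : ∀ p, IsCadlagPath (g p))
    {b : ℕ → ℝ} (hb : Summable b) (hgb : ∀ T : ℝ≥0, ∀ᶠ p in atTop, ∀ t ≤ T, ‖g p t‖ ≤ b p) :
    (∀ t, Tendsto (fun n => ∑ p ∈ Finset.range n, g p t) atTop (𝓝 (∑' p, g p t))) ∧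
      IsCadlagPath fun t => ∑' p, g p t := by
  have hunif : ∀ T : ℝ≥0, TendstoUniformlyOn (fun n t => ∑ p ∈ Finset.range n, g p t)
      (fun t => ∑' p, g p t) atTop (Iic T) := fun T =>
    tendstoUniformlyOn_tsum_nat_eventually hb (hgb T)
  refine ⟨fun t => (hunif t).tendsto_at self_mem_Iic, fun t => ⟨?_, ?_⟩⟩
  · have hnhds : Iic (t + 1) ∈ 𝓝 t := Iic_mem_nhds (by simp)
    have hf : TendstoLocallyUniformlyOn (fun n t => ∑ p ∈ Finset.range n, g p t)
      (fun t => ∑' p, g p t) atTop (Iic (t + 1)) := (hunif (t + 1)).tendstoLocallyUniformlyOn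
    refine continuousWithinAt_of_locally_uniform_approx_of_continuousWithinAt self_mem_Ici ?_
    intro u hu
    refine ⟨Iic (t + 1), mem_nhdsWithin_of_mem_nhds hnhds, ?_⟩
    obtain ⟨n, hn⟩ := (hunif (t + 1) u hu).exists
    exact ⟨fun t => ∑ p ∈ Finset.range n, g p t,
      (IsCadlagPath.sum _ fun p _ => hg p) t |>.1, hn⟩
  · rcases eq_or_ne (𝓝[<] t) ⊥ with hbot | hbot
    · exact ⟨0, by rw [hbot]; exact tendsto_bot⟩
    have : (𝓝[<] t).NeBot := ⟨hbot⟩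
    choose l hl using fun p => (hg p t).2
    have hlb : ∀ᶠ p in atTop, ‖l p‖ ≤ b p := by
      filter_upwards [hgb t] with p hp
      refine le_of_tendsto (hl p).norm ?_
      filter_upwards [self_mem_nhdsWithin] with s hs using hp s hs.le
    have hls : Summable l := by
      refine Summable.of_norm_bounded_eventually_nat hb hlb
    refine ⟨∑' p, l p, ?_⟩
    have hfil : 𝓝[<] t ≤ 𝓟 (Iic t) :=
      le_principal_iff.2 (mem_of_superset self_mem_nhdsWithin fun s (hs : s < t) => mem_Iic.2 hs.le)
    refine TendstoUniformlyOnFilter.tendsto_of_eventually_tendsto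
      ((tendstoUniformlyOn_iff_tendstoUniformlyOnFilter.1 (hunif t)).mono_right hfil)
      (Eventually.of_forall fun n => tendsto_finsetSum (Finset.range n) fun p _ => hl p)
      hls.hasSum.tendsto_sum_nat

end Cadlag

/-! ### Additive processes with unimodal laws -/

section Additive

variable {Ω : Type*} [MeasurableSpace Ω] {E : Type*} [NormedAddCommGroup E]
  [InnerProductSpace ℝ E] [MeasurableSpace E]

/-- The vector of increments of `X` along `t 0 ≤ t 1 ≤ ⋯ ≤ t n`. -/
def incrementVector (X : ℝ≥0 → Ω → E) {n : ℕ} (t : Fin (n + 1) → ℝ≥0) (ω : Ω) :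
    PiLp 2 (fun _ : Fin n => E) :=
  WithLp.toLp 2 fun i => X (t i.succ) ω - X (t i.castSucc) ω

/-- `X` is a càdlàg additive process with unimodal laws and with cumulative characteristic exponent
`Φ t ξ = -log E exp(i⟪ξ, X_t⟫)`. Independence of increments is encoded in the factorization of
their joint characteristic function, a form which passes to independent sums and to limits. -/
structure IsUnimodalAdditiveProcess (X : ℝ≥0 → Ω → E) (P : Measure Ω) (Φ : ℝ≥0 → E → ℂ) :
    Prop where
  isProbabilityMeasure : IsProbabilityMeasure P
  measurable : ∀ t, Measurable (X t)
  zero : ∀ᵐ ω ∂P, X 0 ω = 0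
  cadlag : ∀ᵐ ω ∂P, IsCadlagPath fun t => X t ω
  unimodal : ∀ t, IsUnimodal (P.map (X t))
  charFun_eq : ∀ (n : ℕ) (t : Fin (n + 1) → ℝ≥0), Monotone t → ∀ ξ : PiLp 2 (fun _ : Fin n => E),
    charFun (P.map (incrementVector X t)) ξ =
      ∏ i, Complex.exp (-(Φ (t i.succ) (ξ i) - Φ (t i.castSucc) (ξ i)))

variable [BorelSpace E] [FiniteDimensional ℝ E] {X : ℝ≥0 → Ω → E} {P : Measure Ω}
  {Φ : ℝ≥0 → E → ℂ}

theorem measurable_incrementVector (hX : ∀ t, Measurable (X t)) {n : ℕ} (t : Fin (n + 1) → ℝ≥0) :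
    Measurable (incrementVector X t) := by
  have : ∀ i : Fin n, Measurable fun ω => X (t i.succ) ω - X (t i.castSucc) ω := fun i =>
    (hX _).sub (hX _)
  unfold incrementVector
  fun_prop

theorem IsUnimodalAdditiveProcess.charFun_sub (h : IsUnimodalAdditiveProcess X P Φ) {s t : ℝ≥0}
    (hst : s ≤ t) (ξ : E) :
    charFun (P.map fun ω => X t ω - X s ω) ξ = Complex.exp (-(Φ t ξ - Φ s ξ)) := by
  have hmono : Monotone ![s, t] := by
    intro i j hij
    fin_cases i <;> fin_cases j <;> simp_all
  have h1 := h.charFun_eq 1 ![s, t] hmono (WithLp.toLp 2 fun _ => ξ)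
  have hm := measurable_incrementVector h.measurable ![s, t]
  have hm' : Measurable fun ω => X t ω - X s ω := (h.measurable t).sub (h.measurable s)
  rw [charFun_apply, integral_map hm.aemeasurable (by fun_prop)] at h1
  rw [charFun_apply, integral_map hm'.aemeasurable (by fun_prop)]
  simpa [incrementVector, PiLp.inner_apply] using h1

theorem IsUnimodalAdditiveProcess.hasIndepIncrements (h : IsUnimodalAdditiveProcess X P Φ) :
    HasIndepIncrements X P := by
  have := h.isProbabilityMeasure
  intro n t ht
  have hm : ∀ i : Fin n, AEMeasurable (fun ω => X (t i.succ) ω - X (t i.castSucc) ω) P := fun i =>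
    ((h.measurable _).sub (h.measurable _)).aemeasurable
  rw [iIndepFun_iff_charFun_pi hm]
  intro ξ
  refine (h.charFun_eq n t ht ξ).trans (Finset.prod_congr rfl fun i _ => ?_)
  exact (h.charFun_sub (ht (Fin.castSucc_lt_succ).le) _).symm

theorem IsUnimodalAdditiveProcess.isLevyProcess {ψ : E → ℂ}
    (h : IsUnimodalAdditiveProcess X P fun t ξ => (t : ℝ) * ψ ξ) :
    IsLevyProcess X P ∧ HasCharExponent X P ψ := by
  have := h.isProbabilityMeasure
  have hae : ∀ t, (fun ω => X t ω) =ᵐ[P] fun ω => X t ω - X 0 ω := by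
    intro t
    filter_upwards [h.zero] with ω hω
    simp [hω]
  refine ⟨⟨h.isProbabilityMeasure, h.measurable, h.zero, h.hasIndepIncrements, ?_, h.cadlag⟩, ?_⟩
  · intro s t
    refine ⟨((h.measurable _).sub (h.measurable _)).aemeasurable, (h.measurable t).aemeasurable, ?_⟩
    have : IsProbabilityMeasure (P.map fun ω => X (s + t) ω - X s ω) :=
      Measure.isProbabilityMeasure_map ((h.measurable _).sub (h.measurable _)).aemeasurable
    have : IsProbabilityMeasure (P.map (X t)) :=
      Measure.isProbabilityMeasure_map (h.measurable _).aemeasurable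
    refine Measure.ext_of_charFun (funext fun ξ => ?_)
    rw [show P.map (X t) = P.map fun ω => X t ω - X 0 ω from Measure.map_congr (hae t),
      h.charFun_sub (by simp), h.charFun_sub (by simp)]
    congr 1
    push_cast
    ring
  · intro t ξ
    rw [show P.map (X t) = P.map fun ω => X t ω - X 0 ω from Measure.map_congr (hae t),
      h.charFun_sub (by simp)]
    congr 1
    push_cast
    ring

end Additive

/-! ### Series of independent additive processes -/

section Sum

theorem tendsto_charFun_map_of_tendsto_ae {Ω : Type*} [MeasurableSpace Ω] {F : Type*}
    [NormedAddCommGroup F] [InnerProductSpace ℝ F] [MeasurableSpace F] [BorelSpace F]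
    [SecondCountableTopology F] {P : Measure Ω} [IsProbabilityMeasure P] {V : ℕ → Ω → F} {W : Ω → F}
    (hV : ∀ n, Measurable (V n)) (hW : Measurable W)
    (h : ∀ᵐ ω ∂P, Tendsto (fun n => V n ω) atTop (𝓝 (W ω))) (ξ : F) :
    Tendsto (fun n => charFun (P.map (V n)) ξ) atTop (𝓝 (charFun (P.map W) ξ)) := by
  have hmap : ∀ U : Ω → F, Measurable U →
      charFun (P.map U) ξ = ∫ ω, Complex.exp (⟪U ω, ξ⟫ * Complex.I) ∂P := by
    intro U hU
    rw [charFun_apply, integral_map hU.aemeasurable (by fun_prop)]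
  rw [hmap W hW]
  simp_rw [fun n => hmap (V n) (hV n)]
  refine tendsto_integral_of_dominated_convergence (fun _ => 1) (fun n => ?_) (integrable_const _)
    (fun n => Eventually.of_forall fun ω => ?_) ?_
  · have := hV n
    exact Measurable.aestronglyMeasurable (by fun_prop)
  · rw [Complex.norm_exp_ofReal_mul_I]
  · filter_upwards [h] with ω hω
    have hc : Continuous fun v : F => Complex.exp (⟪v, ξ⟫ * Complex.I) := by fun_prop
    exact (hc.tendsto _).comp hω

variable {Ω : ℕ → Type} [∀ p, MeasurableSpace (Ω p)] {E : Type*} [NormedAddCommGroup E]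
  [InnerProductSpace ℝ E] [MeasurableSpace E] [BorelSpace E] [FiniteDimensional ℝ E]
  {P : ∀ p, Measure (Ω p)} {G : ∀ p, ℝ≥0 → Ω p → E} {Φ : ℕ → ℝ≥0 → E → ℂ}

theorem map_infinitePi_eval_comp [∀ p, IsProbabilityMeasure (P p)] {F : Type*} [MeasurableSpace F]
    {p : ℕ} {f : Ω p → F} (hf : Measurable f) :
    (Measure.infinitePi P).map (fun ω => f (ω p)) = (P p).map f := by
  rw [← Measure.infinitePi_map_eval P p, Measure.map_map hf (by fun_prop), Function.comp_def]

theorem isUnimodal_map_sum_infinitePi [∀ p, IsProbabilityMeasure (P p)] {f : ∀ p, Ω p → E}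
    (hf : ∀ p, Measurable (f p)) (h : ∀ p, IsUnimodal ((P p).map (f p))) (n : ℕ) :
    IsUnimodal ((Measure.infinitePi P).map fun ω => ∑ p ∈ Finset.range n, f p (ω p)) := by
  have hfe : ∀ p, Measurable fun ω : ∀ p, Ω p => f p (ω p) := fun p =>
    (hf p).comp (measurable_pi_apply p)
  induction n with
  | zero =>
    simpa using isUnimodal_dirac_zero
  | succ n ih =>
    have hind : iIndepFun (fun p (ω : ∀ p, Ω p) => f p (ω p)) (Measure.infinitePi P) :=
      iIndepFun_infinitePi hf
    have hind' := hind.indepFun_finsetSum_of_notMem hfe (s := Finset.range n) (i := n)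
      Finset.notMem_range_self
    have hSm : Measurable fun ω : ∀ p, Ω p => ∑ p ∈ Finset.range n, f p (ω p) :=
      Finset.measurable_fun_sum _ fun p _ => hfe p
    have heq : (∑ p ∈ Finset.range n, fun ω : ∀ p, Ω p => f p (ω p)) =
        fun ω => ∑ p ∈ Finset.range n, f p (ω p) := by
      ext ω
      simp
    rw [heq] at hind'
    have hmap := hind'.map_add_eq_map_conv_map hSm (hfe n)
    have heq' : (fun ω : ∀ p, Ω p => ∑ p ∈ Finset.range (n + 1), f p (ω p)) =
        (fun ω => ∑ p ∈ Finset.range n, f p (ω p)) + fun ω => f n (ω n) := by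
      ext ω
      simp [Finset.sum_range_succ]
    rw [heq', hmap]
    have : IsFiniteMeasure ((Measure.infinitePi P).map fun ω => ∑ p ∈ Finset.range n, f p (ω p)) :=
      inferInstance
    refine IsUnimodal.conv ih ?_
    rw [map_infinitePi_eval_comp (hf n)]
    exact h n

/-- Superposition of independent additive processes: the series of processes converges almost
surely and locally uniformly in time by the Borel–Cantelli lemma. -/
theorem exists_isUnimodalAdditiveProcess_tsum
    (hG : ∀ p, IsUnimodalAdditiveProcess (G p) (P p) (Φ p)) {b : ℕ → ℝ} (hb : Summable b)
    (hGb : ∀ T : ℝ≥0, ∑' p, P p {ω | ∃ t ≤ T, b p < ‖G p t ω‖} ≠ ∞)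
    {Ψ : ℝ≥0 → E → ℂ}
    (hΨ : ∀ t ξ, Tendsto (fun n => ∑ p ∈ Finset.range n, Φ p t ξ) atTop (𝓝 (Ψ t ξ))) :
    ∃ (Ω' : Type) (_ : MeasurableSpace Ω') (Q : Measure Ω') (Y : ℝ≥0 → Ω' → E),
      IsUnimodalAdditiveProcess Y Q Ψ := by
  have hPp : ∀ p, IsProbabilityMeasure (P p) := fun p => (hG p).isProbabilityMeasure
  set Q := Measure.infinitePi P with hQ
  have hev : ∀ p, MeasurePreserving (fun ω : ∀ p, Ω p => ω p) Q (P p) := fun p =>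
    measurePreserving_eval_infinitePi P p
  have hGm : ∀ p t, Measurable fun ω : ∀ p, Ω p => G p t (ω p) := fun p t =>
    ((hG p).measurable t).comp (measurable_pi_apply p)
  -- the almost sure event on which the series converges
  have hgood : ∀ᵐ ω ∂Q, (∀ p, IsCadlagPath fun t => G p t (ω p)) ∧ (∀ p, G p 0 (ω p) = 0) ∧
      ∀ T : ℝ≥0, ∀ᶠ p in atTop, ∀ t ≤ T, ‖G p t (ω p)‖ ≤ b p := by
    have h1 : ∀ᵐ ω ∂Q, ∀ p, IsCadlagPath fun t => G p t (ω p) :=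
      ae_all_iff.2 fun p => (hev p).quasiMeasurePreserving.ae (hG p).cadlag
    have h2 : ∀ᵐ ω ∂Q, ∀ p, G p 0 (ω p) = 0 :=
      ae_all_iff.2 fun p => (hev p).quasiMeasurePreserving.ae (hG p).zero
    have h3 : ∀ᵐ ω ∂Q, ∀ T : ℕ, ∀ᶠ p in atTop, ∀ t ≤ (T : ℝ≥0), ‖G p t (ω p)‖ ≤ b p := by
      refine ae_all_iff.2 fun T => ?_
      -- these sets need not be measurable, hence the measurable hulls below
      set B : ∀ p, Set (Ω p) := fun p => {ω | ∃ t ≤ (T : ℝ≥0), b p < ‖G p t ω‖} with hB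
      have hBC : Q {ω | ∃ᶠ p in atTop, ω p ∈ toMeasurable (P p) (B p)} = 0 := by
        refine measure_setOfPred_frequently_eq_zero ?_
        have : ∀ p, Q {ω | ω p ∈ toMeasurable (P p) (B p)} = P p (B p) := by
          intro p
          rw [← measure_toMeasurable (B p)]
          exact (hev p).measure_preimage (measurableSet_toMeasurable _ _).nullMeasurableSet
        simp_rw [this]
        exact hGb T
      filter_upwards [measure_eq_zero_iff_ae_notMem.1 hBC] with ω hω
      have hω' := not_frequently.1 hω
      filter_upwards [hω'] with p hp t ht
      by_contra hlt
      exact hp (subset_toMeasurable _ _ ⟨t, ht, not_le.1 hlt⟩)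
    filter_upwards [h1, h2, h3] with ω hω1 hω2 hω3
    refine ⟨hω1, hω2, fun T => ?_⟩
    obtain ⟨n, hn⟩ := exists_nat_ge T
    exact (hω3 n).mono fun p hp t ht => hp t (ht.trans hn)
  obtain ⟨A, hAsub, hAm, hAQ⟩ : ∃ A : Set (∀ p, Ω p), (∀ ω ∈ A,
      (∀ p, IsCadlagPath fun t => G p t (ω p)) ∧ (∀ p, G p 0 (ω p) = 0) ∧
      ∀ T : ℝ≥0, ∀ᶠ p in atTop, ∀ t ≤ T, ‖G p t (ω p)‖ ≤ b p) ∧ MeasurableSet A ∧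
      ∀ᵐ ω ∂Q, ω ∈ A := by
    obtain ⟨N, hN, hNm, hN0⟩ := exists_measurable_superset_of_null (ae_iff.1 hgood)
    refine ⟨Nᶜ, fun ω hω => ?_, hNm.compl, measure_eq_zero_iff_ae_notMem.1 hN0⟩
    by_contra hc
    exact hω (hN hc)
  set S : ℕ → ℝ≥0 → (∀ p, Ω p) → E := fun n t ω => ∑ p ∈ Finset.range n, G p t (ω p) with hS
  set Y : ℝ≥0 → (∀ p, Ω p) → E := fun t => A.indicator fun ω => ∑' p, G p t (ω p) with hY
  have hSm : ∀ n t, Measurable (S n t) := fun n t =>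
    Finset.measurable_fun_sum _ fun p _ => hGm p t
  have hpath : ∀ ω ∈ A, (∀ t, Tendsto (fun n => S n t ω) atTop (𝓝 (Y t ω))) ∧
      IsCadlagPath fun t => Y t ω := by
    intro ω hω
    obtain ⟨h1, -, h3⟩ := hAsub ω hω
    have := isCadlagPath_tsum h1 hb h3
    simpa only [hY, indicator_of_mem hω] using this
  have hlim : ∀ t, ∀ᵐ ω ∂Q, Tendsto (fun n => S n t ω) atTop (𝓝 (Y t ω)) := by
    intro t
    filter_upwards [hAQ] with ω hω using (hpath ω hω).1 t
  have hYm : ∀ t, Measurable (Y t) := by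
    intro t
    refine measurable_of_tendsto_metrizable (f := fun n => A.indicator (S n t))
      (fun n => (hSm n t).indicator hAm) (tendsto_pi_nhds.2 fun ω => ?_)
    by_cases hω : ω ∈ A
    · simpa only [indicator_of_mem hω] using (hpath ω hω).1 t
    · simp [hY, indicator_of_notMem hω]
  refine ⟨∀ p, Ω p, inferInstance, Q, Y, inferInstance, hYm, ?_, ?_, ?_, ?_⟩
  · filter_upwards [hAQ] with ω hω
    simp only [hY, indicator_of_mem hω, (hAsub ω hω).2.1, tsum_zero]
  · filter_upwards [hAQ] with ω hω using (hpath ω hω).2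
  · intro t
    exact isUnimodal_map_of_tendsto_ae (fun n => hSm n t) (hYm t) (hlim t) fun n =>
      isUnimodal_map_sum_infinitePi (fun p => (hG p).measurable t) (fun p => (hG p).unimodal t) n
  · intro n t ht ξ
    have hSvec : ∀ m, Measurable (incrementVector (S m) t) := fun m =>
      measurable_incrementVector (hSm m) t
    have h1 : Tendsto (fun m => charFun (Q.map (incrementVector (S m) t)) ξ) atTop
        (𝓝 (charFun (Q.map (incrementVector Y t)) ξ)) := by
      refine tendsto_charFun_map_of_tendsto_ae hSvec (measurable_incrementVector hYm t) ?_ ξ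
      filter_upwards [hAQ] with ω hω
      refine ((PiLp.continuous_toLp 2 _).tendsto _).comp (tendsto_pi_nhds.2 fun i => ?_)
      exact ((hpath ω hω).1 _).sub ((hpath ω hω).1 _)
    have h2 : ∀ m, charFun (Q.map (incrementVector (S m) t)) ξ =
        ∏ i, Complex.exp (-((∑ p ∈ Finset.range m, Φ p (t i.succ) (ξ i)) -
          ∑ p ∈ Finset.range m, Φ p (t i.castSucc) (ξ i))) := by
      intro m
      have hmG : ∀ p, Measurable (incrementVector (G p) t) := fun p =>
        measurable_incrementVector (hG p).measurable t
      have hmGe : ∀ p, Measurable fun ω : ∀ p, Ω p => incrementVector (G p) t (ω p) := fun p =>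
        (hmG p).comp (measurable_pi_apply p)
      have hind : iIndepFun (fun p (ω : ∀ p, Ω p) => incrementVector (G p) t (ω p)) Q :=
        iIndepFun_infinitePi hmG
      have heq : incrementVector (S m) t =
          fun ω => ∑ p ∈ Finset.range m, incrementVector (G p) t (ω p) := by
        ext ω i
        simp [incrementVector, hS, Finset.sum_sub_distrib]
      rw [heq, (hind.restrict _).charFun_map_fun_finsetSum_eq_prod (fun p _ =>
        (hmGe p).aemeasurable)]
      simp_rw [← Finset.sum_sub_distrib, ← Finset.sum_neg_distrib, Complex.exp_sum]
      rw [Finset.prod_comm, Finset.prod_apply]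
      refine Finset.prod_congr rfl fun p _ => ?_
      rw [map_infinitePi_eval_comp (hmG p), (hG p).charFun_eq n t ht ξ]
    refine tendsto_nhds_unique h1 ?_
    simp_rw [h2]
    refine tendsto_finsetProd _ fun i _ => ?_
    exact (Complex.continuous_exp.tendsto _).comp ((hΨ _ _).sub (hΨ _ _)).neg

end Sum

/-! ### Compound Poisson processes -/

section CompoundPoisson

/-- The law of a Poisson number with mean `c` and an independent sequence of points with law `κ`.
The first `ω.1` points of the sequence form a Poisson point process with intensity `c • κ`. -/
noncomputable def poissonSampleLaw {W : Type*} [MeasurableSpace W] (c : ℝ≥0) (κ : Measure W)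
    [IsProbabilityMeasure κ] : Measure (ℕ × (ℕ → W)) :=
  (poissonMeasure c).prod (Measure.infinitePi fun _ => κ)

instance {W : Type*} [MeasurableSpace W] (c : ℝ≥0) (κ : Measure W) [IsProbabilityMeasure κ] :
    IsProbabilityMeasure (poissonSampleLaw c κ) := by
  unfold poissonSampleLaw
  infer_instance

variable {W : Type} [MeasurableSpace W] {F : Type*} [NormedAddCommGroup F] [InnerProductSpace ℝ F]
  [MeasurableSpace F] [BorelSpace F] [FiniteDimensional ℝ F]

theorem measurable_sum_range_fst {h : W → F} (hh : Measurable h) :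
    Measurable fun ω : ℕ × (ℕ → W) => ∑ i ∈ Finset.range ω.1, h (ω.2 i) := by
  refine measurable_from_prod_countable_right fun n => ?_
  have : ∀ i, Measurable fun w : ℕ → W => h (w i) := fun i => hh.comp (measurable_pi_apply i)
  exact Finset.measurable_fun_sum (Finset.range n) fun i _ => this i

/-- The characteristic function of a compound Poisson distribution. -/
theorem charFun_poissonSampleLaw (c : ℝ≥0) (κ : Measure W) [IsProbabilityMeasure κ] {h : W → F}
    (hh : Measurable h) (ξ : F) :
    charFun ((poissonSampleLaw c κ).map fun ω => ∑ i ∈ Finset.range ω.1, h (ω.2 i)) ξ =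
      Complex.exp (c * (charFun (κ.map h) ξ - 1)) := by
  set z := charFun (κ.map h) ξ with hz
  have hm := measurable_sum_range_fst (W := W) hh
  have hinner : ∀ n : ℕ, ∫ w : ℕ → W, Complex.exp (⟪∑ i ∈ Finset.range n, h (w i), ξ⟫ * Complex.I)
      ∂(Measure.infinitePi fun _ => κ) = z ^ n := by
    intro n
    have hind : iIndepFun (fun i (w : ℕ → W) => h (w i)) (Measure.infinitePi fun _ => κ) :=
      iIndepFun_infinitePi (X := fun _ => h) fun _ => hh
    have hhe : ∀ i, Measurable fun w : ℕ → W => h (w i) := fun i =>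
      hh.comp (measurable_pi_apply i)
    have h1 := congrFun ((hind.restrict (Finset.range n)).charFun_map_fun_finsetSum_eq_prod
      fun i _ => (hhe i).aemeasurable) ξ
    rw [charFun_apply, integral_map (Finset.measurable_fun_sum _ fun i _ => hhe i).aemeasurable
      (by fun_prop)] at h1
    rw [h1, Finset.prod_apply]
    simp_rw [fun i => map_infinitePi_eval_comp (P := fun _ : ℕ => κ) (p := i) hh, ← hz]
    simp
  rw [charFun_apply, integral_map hm.aemeasurable (by fun_prop), poissonSampleLaw, integral_prod]
  · simp only [hinner]
    rw [integral_poissonMeasure]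
    have : ∀ n : ℕ, (Real.exp (-c) * c ^ n / (n.factorial : ℝ)) • z ^ n =
        Complex.exp (-c) * ((c * z) ^ n / (n.factorial : ℂ)) := by
      intro n
      rw [Complex.real_smul]
      push_cast
      rw [mul_pow]
      ring
    simp_rw [this, tsum_mul_left]
    rw [← NormedSpace.exp_eq_tsum_div (𝔸 := ℂ) |> fun h => congrFun h (c * z),
      ← Complex.exp_eq_exp_ℂ, ← Complex.exp_add]
    congr 1
    ring
  · refine Integrable.of_bound (C := 1) ?_ (Eventually.of_forall fun ω => ?_)
    · exact Measurable.aestronglyMeasurable (by fun_prop)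
    · rw [Complex.norm_exp_ofReal_mul_I]

variable {E : Type} [MeasurableSpace E]

/-- Law of a point with uniform time in `(n, n + 1]` and independent mark with law `ρ`. -/
noncomputable def markLaw (n : ℕ) (ρ : Measure E) : Measure (ℝ × E) :=
  (volume.restrict (Ioc (n : ℝ) (n + 1))).prod ρ

instance isProbabilityMeasure_restrict_unit (n : ℕ) :
    IsProbabilityMeasure (volume.restrict (Ioc (n : ℝ) (n + 1))) :=
  ⟨by simp⟩

instance (n : ℕ) (ρ : Measure E) [IsProbabilityMeasure ρ] :
    IsProbabilityMeasure (markLaw n ρ) := by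
  unfold markLaw
  infer_instance

/-- The length of `(n, n + 1] ∩ (0, t]`. -/
noncomputable def unitClock (n : ℕ) (t : ℝ) : ℝ := max (min t (n + 1) - n) 0

theorem sum_unitClock (m : ℕ) {t : ℝ} (ht : 0 ≤ t) :
    ∑ n ∈ Finset.range m, unitClock n t = min t m := by
  induction m with
  | zero => simp [ht]
  | succ m ih =>
    rw [Finset.sum_range_succ, ih, unitClock]
    push_cast
    grind

theorem integral_indicator_Ioc_unit (n : ℕ) {a b : ℝ} (hab : a ≤ b) :
    ∫ u in Ioc (n : ℝ) (n + 1), (Ioc a b).indicator (fun _ => (1 : ℂ)) u =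
      ((unitClock n b - unitClock n a : ℝ) : ℂ) := by
  rw [integral_indicator measurableSet_Ioc, Measure.restrict_restrict measurableSet_Ioc,
    setIntegral_const, Ioc_inter_Ioc, Real.volume_real_Ioc, Complex.real_smul, mul_one]
  congr 1
  simp only [unitClock]
  grind

/-- At most one of the intervals `(t j, t (j + 1)]` contains `u`, so both sides have at most one
term that differs from the value outside of all intervals. -/
theorem exp_sum_indicator_Ioc {n : ℕ} {t : Fin (n + 1) → ℝ≥0} (ht : Monotone t) (a : Fin n → ℂ)
    (u : ℝ) :
    Complex.exp (∑ j, (Ioc (t j.castSucc : ℝ) (t j.succ)).indicator (fun _ => a j) u) =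
      1 + ∑ j, (Ioc (t j.castSucc : ℝ) (t j.succ)).indicator (fun _ => (1 : ℂ)) u *
        (Complex.exp (a j) - 1) := by
  by_cases h : ∃ j : Fin n, u ∈ Ioc (t j.castSucc : ℝ) (t j.succ)
  · obtain ⟨j, hj⟩ := h
    have hne : ∀ i, i ≠ j → u ∉ Ioc (t i.castSucc : ℝ) (t i.succ) := by
      intro i hij hi
      rcases lt_or_gt_of_ne hij with hlt | hlt
      · have : t i.succ ≤ t j.castSucc := ht (Fin.succ_le_castSucc_iff.2 hlt)
        have : (t i.succ : ℝ) ≤ t j.castSucc := this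
        linarith [hi.2, hj.1]
      · have : t j.succ ≤ t i.castSucc := ht (Fin.succ_le_castSucc_iff.2 hlt)
        have : (t j.succ : ℝ) ≤ t i.castSucc := this
        linarith [hj.2, hi.1]
    rw [Finset.sum_eq_single j (fun i _ hi => indicator_of_notMem (hne i hi) _) (by simp),
      Finset.sum_eq_single j (fun i _ hi => by rw [indicator_of_notMem (hne i hi), zero_mul])
        (by simp), indicator_of_mem hj, indicator_of_mem hj]
    ring
  · push Not at h
    rw [Finset.sum_eq_zero fun j _ => indicator_of_notMem (h j) _,
      Finset.sum_eq_zero fun j _ => by rw [indicator_of_notMem (h j), zero_mul]]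
    simp

theorem ae_lt_jump_time (c : ℝ≥0) (n : ℕ) (ρ : Measure E) [IsProbabilityMeasure ρ] :
    ∀ᵐ ω ∂poissonSampleLaw c (markLaw n ρ), ∀ i, (n : ℝ) < (ω.2 i).1 := by
  have h1 : ∀ᵐ w ∂markLaw n ρ, (n : ℝ) < w.1 := by
    have : ∀ᵐ u ∂volume.restrict (Ioc (n : ℝ) (n + 1)), (n : ℝ) < u := by
      filter_upwards [ae_restrict_mem measurableSet_Ioc] with u hu using hu.1
    exact (Measure.quasiMeasurePreserving_fst).ae this
  have h2 : ∀ᵐ w ∂(Measure.infinitePi fun _ : ℕ => markLaw n ρ), ∀ i, (n : ℝ) < (w i).1 :=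
    ae_all_iff.2 fun i =>
      (measurePreserving_eval_infinitePi (fun _ : ℕ => markLaw n ρ) i).quasiMeasurePreserving.ae h1
  exact (Measure.quasiMeasurePreserving_snd).ae h2

variable [NormedAddCommGroup E]

/-- The contribution at time `t` of a jump `w.2` at time `w.1`. -/
noncomputable def jumpAt (t : ℝ≥0) (w : ℝ × E) : E := if w.1 ≤ (t : ℝ) then w.2 else 0

theorem measurable_jumpAt (t : ℝ≥0) : Measurable (jumpAt (E := E) t) :=
  Measurable.ite (measurableSet_le measurable_fst measurable_const) measurable_snd measurable_const

variable [InnerProductSpace ℝ E] [BorelSpace E] [FiniteDimensional ℝ E]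

theorem isUnimodal_map_jumpAt {ρ : Measure E} [IsProbabilityMeasure ρ] (hρ : IsUnimodal ρ) (n : ℕ)
    (t : ℝ≥0) : IsUnimodal ((markLaw n ρ).map (jumpAt t)) := by
  refine isUnimodal_map_prod (measurable_jumpAt t) fun u => ?_
  by_cases h : u ≤ (t : ℝ)
  · simpa [jumpAt, h] using hρ
  · simpa [jumpAt, h] using isUnimodal_dirac_zero

/-- A single marked point contributes to at most one increment, so its joint characteristic function
is affine in those of the increments. This is what makes increments over disjoint intervals
independent for a Poisson number of points. -/
theorem charFun_map_jumpAt_increments {ρ : Measure E} [IsProbabilityMeasure ρ] (k : ℕ) {n : ℕ}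
    {t : Fin (n + 1) → ℝ≥0} (ht : Monotone t) (ξ : PiLp 2 (fun _ : Fin n => E)) :
    charFun ((markLaw k ρ).map (incrementVector jumpAt t)) ξ =
      1 + ∑ j, ((unitClock k (t j.succ) - unitClock k (t j.castSucc) : ℝ) : ℂ) *
        (charFun ρ (ξ j) - 1) := by
  have hm : Measurable (incrementVector (jumpAt (E := E)) t) :=
    measurable_incrementVector measurable_jumpAt t
  rw [charFun_apply, integral_map hm.aemeasurable (by fun_prop)]
  have hpt : ∀ w : ℝ × E,
      Complex.exp (⟪incrementVector jumpAt t w, ξ⟫ * Complex.I) =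
      1 + ∑ j, (Ioc (t j.castSucc : ℝ) (t j.succ)).indicator (fun _ => (1 : ℂ)) w.1 *
        (Complex.exp (⟪w.2, ξ j⟫ * Complex.I) - 1) := by
    intro w
    rw [← exp_sum_indicator_Ioc ht fun j => ⟪w.2, ξ j⟫ * Complex.I]
    congr 1
    rw [PiLp.inner_apply]
    push_cast
    rw [Finset.sum_mul]
    refine Finset.sum_congr rfl fun j _ => ?_
    have hle : (t j.castSucc : ℝ) ≤ t j.succ := ht (Fin.castSucc_lt_succ).le
    simp only [incrementVector, jumpAt, indicator, mem_Ioc]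
    by_cases h1 : w.1 ≤ (t j.castSucc : ℝ)
    · have h2 : w.1 ≤ (t j.succ : ℝ) := h1.trans hle
      simp [h1, h2, not_lt.2 h1]
    · by_cases h2 : w.1 ≤ (t j.succ : ℝ)
      · simp [h1, h2, not_le.1 h1]
      · simp [h1, h2]
  simp_rw [hpt]
  have hint1 : ∀ j : Fin n, Integrable (fun u : ℝ =>
      (Ioc (t j.castSucc : ℝ) (t j.succ)).indicator (fun _ => (1 : ℂ)) u)
      (volume.restrict (Ioc (k : ℝ) (k + 1))) := fun j =>
    (integrable_const _).indicator measurableSet_Ioc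
  have hint2 : ∀ j : Fin n, Integrable (fun x : E => Complex.exp (⟪x, ξ j⟫ * Complex.I)) ρ := by
    intro j
    refine Integrable.of_bound (C := 1) ?_ (Eventually.of_forall fun ω => ?_)
    · exact Measurable.aestronglyMeasurable (by fun_prop)
    · rw [Complex.norm_exp_ofReal_mul_I]
  have hint : ∀ j : Fin n, Integrable (fun w : ℝ × E =>
      (Ioc (t j.castSucc : ℝ) (t j.succ)).indicator (fun _ => (1 : ℂ)) w.1 *
        (Complex.exp (⟪w.2, ξ j⟫ * Complex.I) - 1)) (markLaw k ρ) := fun j =>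
    (hint1 j).mul_prod ((hint2 j).sub (integrable_const 1))
  rw [integral_add (integrable_const _) (integrable_finsetSum _ fun j _ => hint j),
    integral_finsetSum _ fun j _ => hint j]
  congr 1
  · simp
  · refine Finset.sum_congr rfl fun j _ => ?_
    have hle : (t j.castSucc : ℝ) ≤ t j.succ := ht (Fin.castSucc_lt_succ).le
    rw [markLaw, integral_prod_mul (fun u : ℝ =>
      (Ioc (t j.castSucc : ℝ) (t j.succ)).indicator (fun _ => (1 : ℂ)) u)
      (fun x : E => Complex.exp (⟪x, ξ j⟫ * Complex.I) - 1), integral_indicator_Ioc_unit k hle,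
      integral_sub (hint2 j) (integrable_const _), charFun_apply]
    simp

/-- The compound Poisson process with jump rate `c` and jump law `ρ`, run during `(n, n + 1]`. -/
noncomputable def unitCompoundPoisson (t : ℝ≥0) (ω : ℕ × (ℕ → ℝ × E)) : E :=
  ∑ i ∈ Finset.range ω.1, jumpAt t (ω.2 i)

theorem isUnimodalAdditiveProcess_unitCompoundPoisson (c : ℝ≥0) (n : ℕ) {ρ : Measure E}
    [IsProbabilityMeasure ρ] (hρ : IsUnimodal ρ) :
    IsUnimodalAdditiveProcess unitCompoundPoisson (poissonSampleLaw c (markLaw n ρ))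
      (fun t ξ => unitClock n t * (c * (1 - charFun ρ ξ))) where
  isProbabilityMeasure := inferInstance
  measurable t := measurable_sum_range_fst (measurable_jumpAt t)
  zero := by
    filter_upwards [ae_lt_jump_time c n ρ] with ω hω
    refine Finset.sum_eq_zero fun i _ => if_neg ?_
    have : (0 : ℝ) ≤ n := by positivity
    simp only [NNReal.coe_zero, not_le]
    linarith [hω i]
  cadlag := Eventually.of_forall fun ω => IsCadlagPath.sum _ fun i _ => isCadlagPath_step _ _
  unimodal t := by
    refine isUnimodal_map_prod (measurable_sum_range_fst (measurable_jumpAt t)) fun m => ?_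
    exact isUnimodal_map_sum_infinitePi (P := fun _ => markLaw n ρ) (fun _ => measurable_jumpAt t)
      (fun _ => isUnimodal_map_jumpAt hρ n t) m
  charFun_eq m t ht ξ := by
    have heq : incrementVector (unitCompoundPoisson (E := E)) t =
        fun ω => ∑ i ∈ Finset.range ω.1, incrementVector jumpAt t (ω.2 i) := by
      ext ω j
      simp [incrementVector, unitCompoundPoisson, Finset.sum_sub_distrib]
    rw [heq, charFun_poissonSampleLaw c _ (measurable_incrementVector measurable_jumpAt t),
      charFun_map_jumpAt_increments n ht, ← Complex.exp_sum]
    congr 1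
    rw [add_sub_cancel_left, Finset.mul_sum]
    refine Finset.sum_congr rfl fun j _ => ?_
    push_cast
    ring

/-- Existence of compound Poisson processes, with any finite unimodal jump measure. -/
theorem exists_compoundPoisson (m : Measure E) [IsFiniteMeasure m] (hm : IsUnimodal m) :
    ∃ (Ω' : Type) (_ : MeasurableSpace Ω') (Q : Measure Ω') (Y : ℝ≥0 → Ω' → E),
      IsUnimodalAdditiveProcess Y Q (fun t ξ => (t : ℝ) * (charFun m 0 - charFun m ξ)) := by
  obtain ⟨c, ρ, hρp, hρ, hmρ⟩ : ∃ (c : ℝ≥0) (ρ : Measure E), IsProbabilityMeasure ρ ∧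
      IsUnimodal ρ ∧ m = c • ρ := by
    rcases eq_or_ne m 0 with rfl | h0
    -- for the zero measure any jump law will do, at rate zero
    · exact ⟨0, Measure.dirac 0, inferInstance, isUnimodal_dirac_zero, by simp⟩
    · have h1 : m univ ≠ 0 := by simpa using h0
      have : NeZero m := ⟨h0⟩
      refine ⟨(m univ).toNNReal, (m univ)⁻¹ • m, inferInstance, fun r x y hxy => ?_, ?_⟩
      · simp only [Measure.smul_apply, smul_eq_mul]
        exact mul_le_mul_right (hm r x y hxy) _
      · ext s hs
        simp only [Measure.smul_apply, smul_eq_mul, ENNReal.smul_def]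
        rw [ENNReal.coe_toNNReal (measure_ne_top _ _), ← mul_assoc,
          ENNReal.mul_inv_cancel h1 (measure_ne_top _ _), one_mul]
  have hchar : ∀ ξ, charFun m ξ = c * charFun ρ ξ := by
    intro ξ
    rw [hmρ, charFun_apply, integral_smul_nnreal_measure, charFun_apply, NNReal.smul_def,
      Complex.real_smul]
  refine exists_isUnimodalAdditiveProcess_tsum (b := fun _ => 0)
    (fun n => isUnimodalAdditiveProcess_unitCompoundPoisson c n hρ) summable_zero (fun T => ?_)
    (fun t ξ => ?_)
  · obtain ⟨k, hk⟩ := exists_nat_ge T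
    have hz : ∀ n ∉ Finset.range k, poissonSampleLaw c (markLaw n ρ)
        {ω | ∃ t ≤ T, 0 < ‖unitCompoundPoisson t ω‖} = 0 := by
      intro n hn
      have hkn : (k : ℝ) ≤ n := by exact_mod_cast not_lt.1 (fun h => hn (Finset.mem_range.2 h))
      refine measure_mono_null (fun ω hω => ?_) (ae_iff.1 (ae_lt_jump_time c n ρ))
      obtain ⟨t, htT, hpos⟩ := hω
      intro hall
      have : unitCompoundPoisson t ω = 0 := by
        refine Finset.sum_eq_zero fun i _ => if_neg ?_
        have h1 : (t : ℝ) ≤ T := htT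
        have h2 : (T : ℝ) ≤ k := by exact_mod_cast hk
        linarith [hall i]
      simp [this] at hpos
    rw [tsum_eq_sum hz]
    exact ENNReal.sum_ne_top.2 fun n _ => measure_ne_top _ _
  · refine tendsto_const_nhds.congr' ?_
    obtain ⟨k, hk⟩ := exists_nat_ge t
    filter_upwards [eventually_ge_atTop k] with j hj
    rw [← Finset.sum_mul, ← Complex.ofReal_sum, sum_unitClock j (NNReal.coe_nonneg t), hchar, hchar,
      charFun_zero]
    have : (t : ℝ) ≤ j := by
      have h1 : (t : ℝ) ≤ k := by exact_mod_cast hk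
      have h2 : (k : ℝ) ≤ j := by exact_mod_cast hj
      linarith
    rw [min_eq_left this, probReal_univ]
    push_cast
    ring

end CompoundPoisson

/-! ### Maximal inequalities -/

section Maximal

/-- Events that depend on disjoint groups of independent random variables are independent. -/
theorem measure_inter_eq_mul_of_iIndepFun {Ω : Type*} {mΩ : MeasurableSpace Ω} {E : Type*}
    [MeasurableSpace E] {P : Measure Ω} {Z : ℕ → Ω → E} (hZm : ∀ i, Measurable (Z i))
    (hZ : iIndepFun Z P) {s t : Finset ℕ} (hst : Disjoint s t) {A B : Set Ω}
    (hA : ∀ m : MeasurableSpace Ω, (∀ i ∈ s, Measurable[m] (Z i)) → MeasurableSet[m] A)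
    (hB : ∀ m : MeasurableSpace Ω, (∀ i ∈ t, Measurable[m] (Z i)) → MeasurableSet[m] B) :
    P (A ∩ B) = P A * P B := by
  have hle : ∀ i, MeasurableSpace.comap (Z i) inferInstance ≤ mΩ := fun i => (hZm i).comap_le
  have hi := indep_iSup_of_disjoint hle ((iIndepFun_iff_iIndep _ _ _).1 hZ)
    (S := (s : Set ℕ)) (T := (t : Set ℕ)) (Finset.disjoint_coe.2 hst)
  refine (Indep_iff _ _ _).1 hi _ _ (hA _ fun i hi => ?_) (hB _ fun i hi => ?_)
  · exact (comap_measurable (Z i)).mono (le_iSup₂_of_le i hi le_rfl) le_rfl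
  · exact (comap_measurable (Z i)).mono (le_iSup₂_of_le i hi le_rfl) le_rfl

/-- Ottaviani's maximal inequality for sums of independent random vectors. -/
theorem measure_exists_lt_norm_sum_le {Ω : Type*} [MeasurableSpace Ω] {E : Type*}
    [NormedAddCommGroup E] [MeasurableSpace E] [BorelSpace E] [SecondCountableTopology E]
    {P : Measure Ω} [IsProbabilityMeasure P] {Z : ℕ → Ω → E} (hZm : ∀ i, Measurable (Z i))
    (hZ : iIndepFun Z P) {a : ℝ} {n : ℕ}
    (htail : ∀ j ≤ n, P {ω | a < ‖∑ i ∈ Finset.Ico j n, Z i ω‖} ≤ 1 / 2) :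
    P {ω | ∃ j ≤ n, 2 * a < ‖∑ i ∈ Finset.range j, Z i ω‖} ≤
      2 * P {ω | a < ‖∑ i ∈ Finset.range n, Z i ω‖} := by
  set S : ℕ → Ω → E := fun j ω => ∑ i ∈ Finset.range j, Z i ω with hS
  have hSm : ∀ j, Measurable (S j) := fun j => Finset.measurable_fun_sum _ fun i _ => hZm i
  -- `A j` is the event that `2 * a` is exceeded for the first time at index `j`
  set A : ℕ → Set Ω := fun j => {ω | 2 * a < ‖S j ω‖ ∧ ∀ i < j, ‖S i ω‖ ≤ 2 * a} with hA
  set B : ℕ → Set Ω := fun j => {ω | a < ‖∑ i ∈ Finset.Ico j n, Z i ω‖} with hB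
  have hind : ∀ j, P (A j ∩ (B j)ᶜ) = P (A j) * P (B j)ᶜ := by
    intro j
    refine measure_inter_eq_mul_of_iIndepFun hZm hZ
      (s := Finset.range j) (t := Finset.Ico j n) ?_ ?_ ?_
    · exact Finset.disjoint_left.2 fun i h1 h2 => by
        simp at h1 h2
        omega
    · intro m hm
      have hSj : ∀ i ≤ j, Measurable[m] (S i) := fun i hij =>
        @Finset.measurable_fun_sum _ _ _ _ _ _ m _ (Finset.range i) fun l hl =>
          hm l (Finset.range_subset_range.2 hij hl)
      have : A j = {ω | 2 * a < ‖S j ω‖} ∩ ⋂ i ∈ Finset.range j, {ω | ‖S i ω‖ ≤ 2 * a} := by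
        ext ω
        simp [hA]
      rw [this]
      refine MeasurableSet.inter ?_ (Finset.measurableSet_biInter _ fun i hi => ?_)
      · exact (measurable_norm.comp (hSj j le_rfl)) measurableSet_Ioi
      · exact (measurable_norm.comp (hSj i (Finset.mem_range.1 hi).le)) measurableSet_Iic
    · intro m hm
      have h1 : Measurable[m] fun ω => ∑ i ∈ Finset.Ico j n, Z i ω :=
        @Finset.measurable_fun_sum _ _ _ _ _ _ m _ (Finset.Ico j n) hm
      exact ((measurable_norm.comp h1) measurableSet_Ioi).compl
  have hAm : ∀ j, MeasurableSet (A j) := by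
    intro j
    have : A j = {ω | 2 * a < ‖S j ω‖} ∩ ⋂ i ∈ Finset.range j, {ω | ‖S i ω‖ ≤ 2 * a} := by
      ext ω
      simp [hA]
    rw [this]
    refine MeasurableSet.inter ?_ (Finset.measurableSet_biInter _ fun i hi => ?_)
    · exact (measurable_norm.comp (hSm j)) measurableSet_Ioi
    · exact (measurable_norm.comp (hSm i)) measurableSet_Iic
  have hBm : ∀ j, MeasurableSet (B j) := fun j =>
    (measurable_norm.comp (Finset.measurable_fun_sum _ fun i _ => hZm i)) measurableSet_Ioi
  have hhalf : ∀ j ≤ n, P (A j) ≤ 2 * P (A j ∩ (B j)ᶜ) := by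
    intro j hj
    have h1 : (1 : ℝ≥0∞) / 2 ≤ P (B j)ᶜ := by
      rw [prob_compl_eq_one_sub (hBm j)]
      refine le_trans ?_ (tsub_le_tsub_left (htail j hj) 1)
      rw [one_div, ENNReal.one_sub_inv_two]
    calc P (A j) = 2 * (P (A j) * (1 / 2)) := by
          rw [mul_left_comm, one_div, ENNReal.mul_inv_cancel (by simp) (by simp), mul_one]
      _ ≤ 2 * P (A j ∩ (B j)ᶜ) := by
          rw [hind j]
          gcongr
  have hdisj : (Finset.range (n + 1) : Set ℕ).PairwiseDisjoint fun j => A j ∩ (B j)ᶜ := by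
    intro i _ j _ hij
    refine Set.disjoint_left.2 fun ω h1 h2 => ?_
    rcases lt_or_gt_of_ne hij with h | h
    · exact absurd h1.1.1 (not_lt.2 (h2.1.2 i h))
    · exact absurd h2.1.1 (not_lt.2 (h1.1.2 j h))
  calc P {ω | ∃ j ≤ n, 2 * a < ‖S j ω‖}
      ≤ P (⋃ j ∈ Finset.range (n + 1), A j) := by
        refine measure_mono fun ω hω => ?_
        classical
        have hex : ∃ j, 2 * a < ‖S j ω‖ := ⟨hω.choose, hω.choose_spec.2⟩
        obtain ⟨j, hj, hjω⟩ := hω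
        refine mem_iUnion₂.2 ⟨Nat.find hex, Finset.mem_range.2 ?_, Nat.find_spec hex,
          fun i hi => not_lt.1 (Nat.find_min hex hi)⟩
        exact Nat.lt_succ_of_le ((Nat.find_min' hex hjω).trans hj)
    _ ≤ ∑ j ∈ Finset.range (n + 1), P (A j) := measure_biUnion_finset_le _ _
    _ ≤ ∑ j ∈ Finset.range (n + 1), 2 * P (A j ∩ (B j)ᶜ) :=
        Finset.sum_le_sum fun j hj => hhalf j (Nat.lt_succ_iff.1 (Finset.mem_range.1 hj))
    _ = 2 * P (⋃ j ∈ Finset.range (n + 1), A j ∩ (B j)ᶜ) := by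
        rw [← Finset.mul_sum, measure_biUnion_finset hdisj fun j _ => (hAm j).inter (hBm j).compl]
    _ ≤ 2 * P {ω | a < ‖S n ω‖} := by
        gcongr
        refine iUnion₂_subset fun j hj ω hω => ?_
        have hjn : j ≤ n := Nat.lt_succ_iff.1 (Finset.mem_range.1 hj)
        have h1 : 2 * a < ‖S j ω‖ := hω.1.1
        have h2 : ‖∑ i ∈ Finset.Ico j n, Z i ω‖ ≤ a := not_lt.1 hω.2
        have h3 : S n ω = S j ω + ∑ i ∈ Finset.Ico j n, Z i ω :=
          (Finset.sum_range_add_sum_Ico _ hjn).symm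
        show a < ‖S n ω‖
        have h4 : ‖S j ω‖ ≤ ‖S n ω‖ + ‖∑ i ∈ Finset.Ico j n, Z i ω‖ := by
          have : S j ω = S n ω - ∑ i ∈ Finset.Ico j n, Z i ω := by rw [h3]; abel
          rw [this]
          exact norm_sub_le _ _
        linarith

variable {E : Type*} [NormedAddCommGroup E] [InnerProductSpace ℝ E] [MeasurableSpace E]
  [BorelSpace E] [FiniteDimensional ℝ E]

/-- A tail bound for infinitely divisible laws whose exponent is quadratically bounded. -/
theorem measureReal_lt_norm_le_of_charFun_eq {μ : Measure E} [IsProbabilityMeasure μ] {ψ : E → ℝ}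
    {κ a : ℝ} (ha : 0 < a) (hψ0 : ∀ ξ, 0 ≤ ψ ξ) (hψ : ∀ ξ, ψ ξ ≤ κ * ‖ξ‖ ^ 2)
    (hμ : ∀ ξ, charFun μ ξ = Complex.exp (-(ψ ξ : ℂ))) :
    μ.real {x | a < ‖x‖} ≤ 8 * (Module.finrank ℝ E : ℝ) ^ 3 * κ / a ^ 2 := by
  set D := Module.finrank ℝ E with hD
  rcases Nat.eq_zero_or_pos D with h0 | hpos
  · have : Subsingleton E := Module.finrank_zero_iff.1 h0
    have : {x : E | a < ‖x‖} = ∅ := by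
      ext x
      simp [Subsingleton.elim x 0, ha.le]
    rw [this, h0]
    simp
  have hD0 : (0 : ℝ) < D := by exact_mod_cast hpos
  set e := stdOrthonormalBasis ℝ E with he
  have hcoord : ∀ i, μ.real {x | a / D < |⟪e i, x⟫|} ≤ 8 * (D : ℝ) ^ 2 * κ / a ^ 2 := by
    intro i
    have hr : 0 < a / D := by positivity
    have h1 := measureReal_abs_inner_gt_le_integral_charFun (μ := μ) (a := e i) hr
    refine h1.trans ?_
    have h2 : ‖∫ t in -2 * (a / D)⁻¹..2 * (a / D)⁻¹, 1 - charFun μ (t • e i)‖ ≤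
        (κ * (2 * (a / D)⁻¹) ^ 2) * |2 * (a / D)⁻¹ - -2 * (a / D)⁻¹| := by
      refine intervalIntegral.norm_integral_le_of_norm_le_const fun t ht => ?_
      have htab : |t| ≤ 2 * (a / D)⁻¹ := by
        rw [uIoc_of_le (by nlinarith [inv_pos.2 hr])] at ht
        exact abs_le.2 ⟨by linarith [ht.1], ht.2⟩
      have hbound : ψ (t • e i) ≤ κ * t ^ 2 := by
        have := hψ (t • e i)
        rwa [norm_smul, e.norm_eq_one, mul_one, Real.norm_eq_abs, sq_abs] at this
      have hκ : 0 ≤ κ := by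
        have := (hψ0 (e i)).trans (hψ (e i))
        simpa using this
      rw [hμ, ← Complex.ofReal_neg, ← Complex.ofReal_exp, ← Complex.ofReal_one,
        ← Complex.ofReal_sub, Complex.norm_real, Real.norm_of_nonneg
          (by simpa using hψ0 (t • e i))]
      have h3 := Real.add_one_le_exp (-ψ (t • e i))
      have h4 : t ^ 2 ≤ (2 * (a / D)⁻¹) ^ 2 := by
        rw [← sq_abs t]
        gcongr
      nlinarith [mul_le_mul_of_nonneg_left h4 hκ]
    calc 2⁻¹ * (a / D) * ‖∫ t in -2 * (a / D)⁻¹..2 * (a / D)⁻¹, 1 - charFun μ (t • e i)‖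
        ≤ 2⁻¹ * (a / D) *
          ((κ * (2 * (a / D)⁻¹) ^ 2) * |2 * (a / D)⁻¹ - -2 * (a / D)⁻¹|) := by gcongr
      _ = 8 * (D : ℝ) ^ 2 * κ / a ^ 2 := by
          rw [abs_of_pos (by nlinarith [inv_pos.2 hr])]
          field_simp
          ring
  calc μ.real {x | a < ‖x‖} ≤ μ.real (⋃ i, {x | a / D < |⟪e i, x⟫|}) := by
        refine measureReal_mono (fun x hx => ?_)
        by_contra hc
        simp only [mem_iUnion, mem_ofPred_eq, not_exists, not_lt] at hc
        have h1 : ‖x‖ ≤ ∑ i, ‖⟪e i, x⟫ • e i‖ := by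
          conv_lhs => rw [← e.sum_repr' x]
          exact norm_sum_le _ _
        have h2 : ∑ i, ‖⟪e i, x⟫ • e i‖ ≤ ∑ _i : Fin D, a / D := by
          refine Finset.sum_le_sum fun i _ => ?_
          rw [norm_smul, e.norm_eq_one, mul_one]
          exact hc i
        rw [Finset.sum_const, Finset.card_univ, Fintype.card_fin, nsmul_eq_mul,
          mul_div_cancel₀ _ hD0.ne'] at h2
        exact absurd hx (not_lt.2 (h1.trans h2))
    _ ≤ ∑ i, μ.real {x | a / D < |⟪e i, x⟫|} := measureReal_iUnion_fintype_le _
    _ ≤ ∑ _i : Fin D, 8 * (D : ℝ) ^ 2 * κ / a ^ 2 := Finset.sum_le_sum fun i _ => hcoord i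
    _ = 8 * (D : ℝ) ^ 3 * κ / a ^ 2 := by
        rw [Finset.sum_const, Finset.card_univ, Fintype.card_fin, nsmul_eq_mul]
        ring

/-- Maximal inequality for Lévy processes with quadratically bounded exponent. -/
theorem IsUnimodalAdditiveProcess.measure_exists_lt_norm_le {Ω : Type*} [MeasurableSpace Ω]
    {P : Measure Ω} {X : ℝ≥0 → Ω → E} {ψ : E → ℝ} {κ a : ℝ} (ha : 0 < a) (hψ0 : ∀ ξ, 0 ≤ ψ ξ)
    (hψ : ∀ ξ, ψ ξ ≤ κ * ‖ξ‖ ^ 2) (hκ : 0 ≤ κ)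
    (hX : IsUnimodalAdditiveProcess X P fun t ξ => (t : ℝ) * (ψ ξ : ℂ)) (T : ℝ≥0) :
    P {ω | ∃ t ≤ T, 2 * a < ‖X t ω‖} ≤
      ENNReal.ofReal (2 * (8 * (Module.finrank ℝ E : ℝ) ^ 3 * (T * κ) / a ^ 2)) := by
  have hP := hX.isProbabilityMeasure
  set K := 8 * (Module.finrank ℝ E : ℝ) ^ 3 * (T * κ) / a ^ 2 with hK
  -- Ottaviani's inequality needs the tail bound `K ≤ 1 / 2`; otherwise the claim is trivial
  rcases lt_or_ge (1 / 2) K with hbig | hsmall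
  · refine prob_le_one.trans ?_
    rw [ENNReal.one_le_ofReal]
    linarith
  have htail : ∀ s t : ℝ≥0, s ≤ t → t ≤ T →
      P {ω | a < ‖X t ω - X s ω‖} ≤ ENNReal.ofReal K := by
    intro s t hst htT
    have hm : Measurable fun ω => X t ω - X s ω := (hX.measurable t).sub (hX.measurable s)
    have : IsProbabilityMeasure (P.map fun ω => X t ω - X s ω) :=
      Measure.isProbabilityMeasure_map hm.aemeasurable
    have hst' : (0 : ℝ) ≤ t - s := sub_nonneg.2 hst
    have h1 := measureReal_lt_norm_le_of_charFun_eq (μ := P.map fun ω => X t ω - X s ω)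
      (ψ := fun ξ => ((t : ℝ) - s) * ψ ξ) (κ := (t - s) * κ) ha
      (fun ξ => mul_nonneg hst' (hψ0 ξ))
      (fun ξ => by rw [mul_assoc]; exact mul_le_mul_of_nonneg_left (hψ ξ) hst')
      (fun ξ => by
        rw [hX.charFun_sub hst]
        congr 1
        push_cast
        ring)
    rw [map_measureReal_apply hm (measurableSet_lt measurable_const measurable_norm)] at h1
    rw [← ofReal_measureReal]
    refine ENNReal.ofReal_le_ofReal (h1.trans ?_)
    have : (t : ℝ) - s ≤ T := by
      have h2 : (t : ℝ) ≤ T := htT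
      linarith [s.2]
    rw [hK]
    gcongr
  -- the maximum over a dyadic grid
  set grid : ℕ → ℕ → ℝ≥0 := fun m j => T * ((min j (2 ^ m) : ℕ) : ℝ≥0) / 2 ^ m with hgrid
  have hgridT : ∀ m j, grid m j ≤ T := by
    intro m j
    rw [hgrid]
    beta_reduce
    rw [div_le_iff₀ (by positivity)]
    gcongr
    exact_mod_cast min_le_right _ _
  have hgridmono : ∀ m, Monotone (grid m) := by
    intro m i j hij
    simp only [hgrid]
    gcongr
  have hmax : ∀ m, P {ω | ∃ j ≤ 2 ^ m, 2 * a < ‖X (grid m j) ω‖} ≤ ENNReal.ofReal (2 * K) := by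
    intro m
    set Z : ℕ → Ω → E := fun i ω => X (grid m (i + 1)) ω - X (grid m i) ω with hZ
    have hZm : ∀ i, Measurable (Z i) := fun i => (hX.measurable _).sub (hX.measurable _)
    have hsum : ∀ i j, i ≤ j → ∀ ω,
        ∑ l ∈ Finset.Ico i j, Z l ω = X (grid m j) ω - X (grid m i) ω := fun i j hij ω =>
      Finset.sum_Ico_sub (fun l => X (grid m l) ω) hij
    have hott := measure_exists_lt_norm_sum_le (P := P) (a := a) (n := 2 ^ m) hZm
      (hX.hasIndepIncrements.nat (hgridmono m)) (fun j hj => by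
        simp_rw [hsum j _ hj]
        refine (htail _ _ (hgridmono m hj) (hgridT m _)).trans ?_
        refine (ENNReal.ofReal_le_ofReal hsmall).trans ?_
        rw [ENNReal.ofReal_div_of_pos (by norm_num)]
        simp)
    have hrange : ∀ j ω, ∑ i ∈ Finset.range j, Z i ω = X (grid m j) ω - X (grid m 0) ω :=
      fun j ω => Finset.sum_range_sub (fun l => X (grid m l) ω) j
    simp_rw [hrange] at hott
    have h0 : grid m 0 = 0 := by simp [hgrid]
    have hae : P {ω | ∃ j ≤ 2 ^ m, 2 * a < ‖X (grid m j) ω‖} ≤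
        P {ω | ∃ j ≤ 2 ^ m, 2 * a < ‖X (grid m j) ω - X (grid m 0) ω‖} := by
      refine measure_mono_ae ?_
      filter_upwards [hX.zero] with ω hω hex
      obtain ⟨j, hj, hlt⟩ := hex
      exact ⟨j, hj, by rwa [h0, hω, sub_zero]⟩
    refine (hae.trans hott).trans ?_
    rw [ENNReal.ofReal_mul (by norm_num), ENNReal.ofReal_ofNat]
    gcongr
    exact htail _ _ (hgridmono m (Nat.zero_le _)) (hgridT m _)
  have hmono : Monotone fun m => {ω | ∃ j ≤ 2 ^ m, 2 * a < ‖X (grid m j) ω‖} := by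
    refine monotone_nat_of_le_succ fun m ω hω => ?_
    obtain ⟨j, hj, hlt⟩ := hω
    refine ⟨2 * j, by rw [pow_succ]; omega, ?_⟩
    have : grid (m + 1) (2 * j) = grid m j := by
      simp only [hgrid]
      rw [min_eq_left hj, min_eq_left (by rw [pow_succ]; omega), pow_succ]
      push_cast
      field_simp
    rwa [this]
  have hunion : P (⋃ m, {ω | ∃ j ≤ 2 ^ m, 2 * a < ‖X (grid m j) ω‖}) ≤ ENNReal.ofReal (2 * K) := by
    rw [hmono.measure_iUnion]
    exact iSup_le hmax
  refine (measure_mono_ae ?_).trans hunion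
  filter_upwards [hX.cadlag] with ω hω hex
  obtain ⟨t, htT, hlt⟩ := hex
  refine mem_iUnion.2 ?_
  -- by right-continuity the level is exceeded on an interval to the right of `t`
  have hev : ∀ᶠ s in 𝓝[≥] t, 2 * a < ‖X s ω‖ := (hω t).1.norm.eventually_const_lt hlt
  obtain ⟨u, htu, hu⟩ := (mem_nhdsGE_iff_exists_Ico_subset' (lt_add_one t)).1 hev
  rcases eq_or_ne T 0 with hT0 | hT0
  · refine ⟨0, 0, by simp, ?_⟩
    have h1 : t = 0 := le_antisymm (htT.trans hT0.le) zero_le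
    have h2 : grid 0 0 = 0 := by simp [hgrid]
    rw [h2, ← h1]
    exact hlt
  have hTpos : 0 < T := pos_iff_ne_zero.2 hT0
  have htu' : 0 < (u : ℝ) - t := sub_pos.2 htu
  obtain ⟨m, hm⟩ := exists_nat_gt ((T : ℝ) / (u - t))
  have hm2 : (T : ℝ) / (u - t) < 2 ^ m :=
    hm.trans (by exact_mod_cast Nat.lt_two_pow_self)
  rw [div_lt_iff₀ htu'] at hm2
  have hTr : (0 : ℝ) < T := hTpos
  set j := ⌈(t : ℝ) * 2 ^ m / T⌉₊ with hj
  have hj1 : (t : ℝ) * 2 ^ m / T ≤ j := Nat.le_ceil _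
  have hj2 : (j : ℝ) < (t : ℝ) * 2 ^ m / T + 1 := Nat.ceil_lt_add_one (by positivity)
  have hj3 : j ≤ 2 ^ m := by
    refine Nat.ceil_le.2 ?_
    rw [div_le_iff₀ hTr]
    push_cast
    have : (t : ℝ) ≤ T := htT
    nlinarith [pow_pos (two_pos : (0 : ℝ) < 2) m]
  refine ⟨m, j, hj3, hu ?_⟩
  have hg : (grid m j : ℝ) = T * j / 2 ^ m := by
    simp only [hgrid]
    rw [min_eq_left hj3]
    push_cast
    rfl
  have h2m : (0 : ℝ) < 2 ^ m := by positivity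
  rw [div_le_iff₀ hTr] at hj1
  rw [← sub_lt_iff_lt_add, lt_div_iff₀ hTr] at hj2
  constructor
  · rw [← NNReal.coe_le_coe, hg, le_div_iff₀ h2m]
    linarith
  · rw [← NNReal.coe_lt_coe, hg, div_lt_iff₀ h2m]
    nlinarith

end Maximal

/-! ### The exponent of a symmetric Lévy measure -/

section JumpExponent

theorem one_sub_cos_inner_le {E : Type*} [NormedAddCommGroup E] [InnerProductSpace ℝ E]
    (ξ x : E) : 1 - Real.cos ⟪ξ, x⟫ ≤ ‖ξ‖ ^ 2 * ‖x‖ ^ 2 := by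
  have h1 := Real.one_sub_sq_div_two_le_cos (x := ⟪ξ, x⟫)
  have h2 : ⟪ξ, x⟫ ^ 2 ≤ (‖ξ‖ * ‖x‖) ^ 2 := sq_le_sq' (by
    have := neg_le_of_abs_le (abs_real_inner_le_norm ξ x)
    linarith) (real_inner_le_norm ξ x)
  nlinarith [sq_nonneg ⟪ξ, x⟫]

variable {E : Type*} [NormedAddCommGroup E] [InnerProductSpace ℝ E] [MeasurableSpace E]

theorem jumpExponent_nonneg (μ : Measure E) (ξ : E) : 0 ≤ jumpExponent μ ξ :=
  integral_nonneg fun _ => sub_nonneg.2 (Real.cos_le_one _)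

variable [BorelSpace E] [FiniteDimensional ℝ E]

theorem integrable_one_sub_cos_inner {μ : Measure E} (hμ : IsLevyMeasure μ) (ξ : E) :
    Integrable (fun x => 1 - Real.cos ⟪ξ, x⟫) μ := by
  have hint : Integrable (fun x : E => min 1 (‖x‖ ^ 2)) μ := by
    refine ⟨by fun_prop, ?_⟩
    rw [hasFiniteIntegral_iff_ofReal (Eventually.of_forall fun x => by positivity)]
    exact hμ.2
  refine (hint.const_mul (2 + ‖ξ‖ ^ 2)).mono' (by fun_prop) (Eventually.of_forall fun x => ?_)
  rw [Real.norm_of_nonneg (sub_nonneg.2 (Real.cos_le_one _))]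
  rcases le_total 1 (‖x‖ ^ 2) with h | h
  · rw [min_eq_left h]
    linarith [Real.neg_one_le_cos ⟪ξ, x⟫, sq_nonneg ‖ξ‖]
  · rw [min_eq_right h]
    nlinarith [one_sub_cos_inner_le ξ x, sq_nonneg ‖x‖]

/-- A second moment bound on the Lévy measure gives a quadratic bound on the exponent. -/
theorem jumpExponent_le {μ : Measure E} {κ : ℝ} (hκ : 0 ≤ κ)
    (h : ∫⁻ x, ENNReal.ofReal (‖x‖ ^ 2) ∂μ ≤ ENNReal.ofReal κ) (ξ : E) :
    jumpExponent μ ξ ≤ κ * ‖ξ‖ ^ 2 := by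
  rw [jumpExponent, integral_eq_lintegral_of_nonneg_ae
    (Eventually.of_forall fun x => sub_nonneg.2 (Real.cos_le_one _)) (by fun_prop)]
  refine ENNReal.toReal_le_of_le_ofReal (by positivity) ?_
  calc ∫⁻ x, ENNReal.ofReal (1 - Real.cos ⟪ξ, x⟫) ∂μ
      ≤ ∫⁻ x, ENNReal.ofReal (‖ξ‖ ^ 2) * ENNReal.ofReal (‖x‖ ^ 2) ∂μ := by
        refine lintegral_mono fun x => ?_
        rw [← ENNReal.ofReal_mul (by positivity)]
        exact ENNReal.ofReal_le_ofReal (one_sub_cos_inner_le ξ x)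
    _ ≤ ENNReal.ofReal (κ * ‖ξ‖ ^ 2) := by
        rw [lintegral_const_mul _ (by fun_prop), mul_comm κ, ENNReal.ofReal_mul (by positivity)]
        gcongr

/-- For a finite symmetric jump measure the exponent of the compound Poisson process is the jump
exponent. -/
theorem charFun_zero_sub_charFun {μ : Measure E} [IsFiniteMeasure μ]
    (hsymm : μ.map (fun x => -x) = μ) (ξ : E) :
    charFun μ 0 - charFun μ ξ = (jumpExponent μ ξ : ℂ) := by
  have hint : ∀ η : E, Integrable (fun x : E => Complex.exp (⟪x, η⟫ * Complex.I)) μ := by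
    intro η
    refine Integrable.of_bound (C := 1) ?_ (Eventually.of_forall fun ω => ?_)
    · exact Measurable.aestronglyMeasurable (by fun_prop)
    · rw [Complex.norm_exp_ofReal_mul_I]
  have hneg : charFun μ (-ξ) = charFun μ ξ := by
    conv_rhs => rw [← hsymm]
    rw [charFun_apply, charFun_apply, integral_map (by fun_prop) (by fun_prop)]
    simp
  have hcosi : Integrable (fun x : E => Real.cos ⟪ξ, x⟫) μ := by
    refine Integrable.of_bound (C := 1) (by fun_prop) (Eventually.of_forall fun x => ?_)
    exact Real.abs_cos_le_one _
  have hcos : charFun μ ξ = ((∫ x, Real.cos ⟪ξ, x⟫ ∂μ : ℝ) : ℂ) := by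
    have h2 : charFun μ ξ + charFun μ (-ξ) = 2 * ((∫ x, Real.cos ⟪ξ, x⟫ ∂μ : ℝ) : ℂ) := by
      rw [charFun_apply, charFun_apply, ← integral_add (hint ξ) (hint (-ξ)),
        ← integral_complex_ofReal, ← integral_const_mul]
      refine integral_congr_ae (Eventually.of_forall fun x => ?_)
      simp only [inner_neg_right, Complex.ofReal_neg, Complex.ofReal_cos, Complex.cos,
        real_inner_comm x ξ]
      ring
    rw [hneg] at h2
    linear_combination h2 / 2
  rw [hcos, charFun_zero, jumpExponent, integral_sub (integrable_const _) hcosi]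
  simp

end JumpExponent

/-! ### Lévy processes from a decomposition of the Lévy measure -/

section Levy

variable {E : Type} [NormedAddCommGroup E] [InnerProductSpace ℝ E] [MeasurableSpace E]
  [BorelSpace E] [FiniteDimensional ℝ E]

/-- A Lévy measure that splits into finite symmetric unimodal pieces with rapidly decreasing second
moments is the Lévy measure of a pure-jump Lévy process with unimodal laws. -/
theorem exists_levyProcess_of_sum {m : ℕ → Measure E} (hfin : ∀ k, IsFiniteMeasure (m k))
    (hm : ∀ k, IsUnimodal (m k)) (hsymm : ∀ k, (m k).map (fun x => -x) = m k)
    (hsq : ∀ k, ∫⁻ x, ENNReal.ofReal (‖x‖ ^ 2) ∂m (k + 1) ≤ ENNReal.ofReal ((1 / 8) ^ (k + 1)))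
    (hlevy : IsLevyMeasure (Measure.sum m)) :
    ∃ (Ω' : Type) (_ : MeasurableSpace Ω') (Q : Measure Ω') (Y : ℝ≥0 → Ω' → E),
      IsUnimodalAdditiveProcess Y Q
        (fun t ξ => (t : ℝ) * (jumpExponent (Measure.sum m) ξ : ℂ)) := by
  choose Ω' mΩ' Q Y hY using fun k => exists_compoundPoisson (m k) (hm k)
  simp_rw [fun k => charFun_zero_sub_charFun (hsymm k)] at hY
  refine exists_isUnimodalAdditiveProcess_tsum (b := fun k => 2 * (1 / 2) ^ k) hY
    (summable_geometric_two.mul_left 2) (fun T => ?_) (fun t ξ => ?_)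
  · have hQ : ∀ k, IsProbabilityMeasure (Q k) := fun k => (hY k).isProbabilityMeasure
    set C : ℝ := 16 * (Module.finrank ℝ E : ℝ) ^ 3 * T with hC
    have hbound : ∀ k, Q (k + 1) {ω | ∃ t ≤ T, 2 * (1 / 2 : ℝ) ^ (k + 1) < ‖Y (k + 1) t ω‖} ≤
        ENNReal.ofReal (C * (1 / 2) ^ (k + 1)) := by
      intro k
      refine ((hY (k + 1)).measure_exists_lt_norm_le (κ := (1 / 8) ^ (k + 1)) (by positivity)
        (fun ξ => jumpExponent_nonneg _ ξ) (jumpExponent_le (by positivity) (hsq k))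
        (by positivity) T).trans (ENNReal.ofReal_le_ofReal (le_of_eq ?_))
      -- a second moment `8⁻ᵏ` over a squared threshold `4⁻ᵏ` leaves the summable `2⁻ᵏ`
      have h8 : (1 / 8 : ℝ) ^ (k + 1) = (1 / 2) ^ (k + 1) * ((1 / 2) ^ (k + 1)) ^ 2 := by
        rw [← pow_mul, mul_comm (k + 1) 2, pow_mul, ← mul_pow]
        norm_num
      have : ((1 / 2 : ℝ) ^ (k + 1)) ^ 2 ≠ 0 := by positivity
      rw [h8, hC, ← mul_assoc (T : ℝ), ← mul_assoc _ ((T : ℝ) * _), mul_div_assoc, div_self this]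
      ring
    rw [tsum_eq_zero_add' ENNReal.summable]
    refine ENNReal.add_ne_top.2 ⟨measure_ne_top _ _, ?_⟩
    refine ne_top_of_le_ne_top
      (Summable.tsum_ofReal_ne_top (f := fun k => C * (1 / 2) ^ (k + 1)) ?_)
      (ENNReal.tsum_le_tsum hbound)
    exact ((summable_nat_add_iff 1).2 summable_geometric_two).mul_left C
  · have hs := (hasSum_integral_measure (integrable_one_sub_cos_inner hlevy ξ)).tendsto_sum_nat
    have h1 : ∀ n, ∑ p ∈ Finset.range n, ((t : ℝ) : ℂ) * (jumpExponent (m p) ξ : ℂ) =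
        ((t : ℝ) : ℂ) * ((∑ p ∈ Finset.range n, jumpExponent (m p) ξ : ℝ) : ℂ) := by
      intro n
      push_cast
      rw [Finset.mul_sum]
    simp_rw [h1]
    exact ((Complex.continuous_ofReal.tendsto _).comp hs).const_mul _

end Levy

/-! ### Lévy processes with a radially nonincreasing Lévy density -/

section Radial

theorem map_radialMeasure_linearIsometryEquiv {d : ℕ} (f : ℝ → ℝ)
    (R : EuclideanSpace ℝ (Fin d) ≃ₗᵢ[ℝ] EuclideanSpace ℝ (Fin d)) :
    (radialMeasure d f).map R = radialMeasure d f := by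
  ext s hs
  have hRm : Measurable R := R.continuous.measurable
  rw [Measure.map_apply hRm hs, radialMeasure, withDensity_apply _ (hRm hs), withDensity_apply _ hs]
  simpa using R.measurePreserving.setLIntegral_comp_preimage_emb R.toHomeomorph.measurableEmbedding
    (fun x => ENNReal.ofReal (f ‖x‖)) s

theorem ae_norm_pos {d : ℕ} (hd : 1 ≤ d) : ∀ᵐ x : EuclideanSpace ℝ (Fin d), 0 < ‖x‖ := by
  have : Nonempty (Fin d) := ⟨⟨0, hd⟩⟩
  have : ∀ᵐ x : EuclideanSpace ℝ (Fin d), x ≠ 0 := by rw [ae_iff]; simp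
  filter_upwards [this] with x hx using norm_pos_iff.2 hx

theorem radialMeasure_congr {d : ℕ} (hd : 1 ≤ d) {f g : ℝ → ℝ} (h : ∀ r, 0 < r → f r = g r) :
    radialMeasure d f = radialMeasure d g := by
  refine withDensity_congr_ae ?_
  filter_upwards [ae_norm_pos hd] with x hx
  rw [h _ hx]

/-- The part of `g` between the levels `c (k - 1)` and `c k`. -/
noncomputable def heightLayer (g : ℝ → ℝ) (c : ℕ → ℕ) : ℕ → ℝ → ℝ
  | 0, r => min (g r) (c 0)
  | k + 1, r => min (g r) (c (k + 1)) - min (g r) (c k)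

variable {g : ℝ → ℝ} {c : ℕ → ℕ}

theorem measurable_heightLayer (hg : Measurable g) (k : ℕ) : Measurable (heightLayer g c k) := by
  cases k with
  | zero => exact hg.min measurable_const
  | succ k => exact (hg.min measurable_const).sub (hg.min measurable_const)

theorem heightLayer_nonneg (hg0 : ∀ r, 0 ≤ g r) (hc : Monotone c) (k : ℕ) (r : ℝ) :
    0 ≤ heightLayer g c k r := by
  cases k with
  | zero => exact le_min (hg0 r) (Nat.cast_nonneg _)
  | succ k =>
    have : (c k : ℝ) ≤ c (k + 1) := by exact_mod_cast hc (Nat.le_succ k)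
    exact sub_nonneg.2 (min_le_min_left _ this)

theorem heightLayer_le_min (hg0 : ∀ r, 0 ≤ g r) (k : ℕ) (r : ℝ) :
    heightLayer g c k r ≤ min (g r) (c k) := by
  cases k with
  | zero => exact le_rfl
  | succ k => exact sub_le_self _ (le_min (hg0 r) (Nat.cast_nonneg _))

theorem heightLayer_succ_le (k : ℕ) (r : ℝ) :
    heightLayer g c (k + 1) r ≤ max (g r - c k) 0 := by
  simp only [heightLayer]
  grind

theorem antitoneOn_heightLayer (hg : AntitoneOn g (Ioi 0)) (hc : Monotone c) (k : ℕ) :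
    AntitoneOn (heightLayer g c k) (Ioi 0) := by
  intro a ha b hb hab
  have h := hg ha hb hab
  cases k with
  | zero => exact min_le_min_right _ h
  | succ k =>
    have : (c k : ℝ) ≤ c (k + 1) := by exact_mod_cast hc (Nat.le_succ k)
    simp only [heightLayer]
    grind

theorem sum_heightLayer (k : ℕ) (r : ℝ) :
    ∑ i ∈ Finset.range (k + 1), heightLayer g c i r = min (g r) (c k) := by
  induction k with
  | zero => simp [heightLayer]
  | succ k ih =>
    rw [Finset.sum_range_succ, ih]
    simp [heightLayer]

theorem tsum_ofReal_heightLayer (hg0 : ∀ r, 0 ≤ g r) (hc : StrictMono c) (r : ℝ) :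
    ∑' k, ENNReal.ofReal (heightLayer g c k r) = ENNReal.ofReal (g r) := by
  refine tendsto_nhds_unique ((tendsto_add_atTop_iff_nat 1).2
    (ENNReal.tendsto_nat_tsum fun k => ENNReal.ofReal (heightLayer g c k r))) ?_
  refine tendsto_const_nhds.congr' ?_
  obtain ⟨n, hn⟩ := exists_nat_ge (g r)
  filter_upwards [eventually_ge_atTop n] with k hk
  rw [← ENNReal.ofReal_sum_of_nonneg fun i _ => heightLayer_nonneg hg0 hc.monotone i r,
    sum_heightLayer, min_eq_left]
  have : n ≤ c k := hk.trans (hc.id_le k)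
  exact hn.trans (by exact_mod_cast this)

theorem isUnimodal_radialMeasure {d : ℕ} (hd : 1 ≤ d) {f : ℝ → ℝ} (hf : AntitoneOn f (Ioi 0)) :
    IsUnimodal (radialMeasure d f) := by
  have : Nonempty (Fin d) := ⟨⟨0, hd⟩⟩
  refine isUnimodal_withDensity fun x y hx hxy => ENNReal.ofReal_le_ofReal ?_
  have := norm_pos_iff.2 hx
  exact hf this (this.trans_le hxy) hxy

variable {d : ℕ}

theorem lintegral_min_mul_radial (hg : Measurable g) :
    ∫⁻ x, ENNReal.ofReal (min 1 (‖x‖ ^ 2)) ∂radialMeasure d g =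
      ∫⁻ x : EuclideanSpace ℝ (Fin d),
        ENNReal.ofReal (min 1 (‖x‖ ^ 2)) * ENNReal.ofReal (g ‖x‖) := by
  rw [radialMeasure, lintegral_withDensity_eq_lintegral_mul _ (by fun_prop) (by fun_prop)]
  refine lintegral_congr fun x => ?_
  rw [Pi.mul_apply, mul_comm]

/-- The mass of a Lévy measure truncated in height is finite. -/
theorem lintegral_ofReal_min_lt_top (hg : Measurable g)
    (hlevy : IsLevyMeasure (radialMeasure d g)) (a : ℝ) :
    ∫⁻ x : EuclideanSpace ℝ (Fin d), ENNReal.ofReal (min (g ‖x‖) a) < ∞ := by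
  have hle : ∀ x : EuclideanSpace ℝ (Fin d), ENNReal.ofReal (min (g ‖x‖) a) ≤
      (Metric.closedBall (0 : EuclideanSpace ℝ (Fin d)) 1).indicator (fun _ => ENNReal.ofReal a) x +
        ENNReal.ofReal (min 1 (‖x‖ ^ 2)) * ENNReal.ofReal (g ‖x‖) := by
    intro x
    by_cases hx : x ∈ Metric.closedBall (0 : EuclideanSpace ℝ (Fin d)) 1
    · rw [indicator_of_mem hx]
      exact le_add_right (ENNReal.ofReal_le_ofReal (min_le_right _ _))
    · rw [indicator_of_notMem hx, zero_add]
      have h1 : 1 < ‖x‖ := by simpa using hx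
      rw [min_eq_left (a := (1 : ℝ)) (by nlinarith), ENNReal.ofReal_one, one_mul]
      exact ENNReal.ofReal_le_ofReal (min_le_left _ _)
  refine (lintegral_mono hle).trans_lt ?_
  rw [lintegral_add_right _ (by fun_prop), ← lintegral_min_mul_radial hg,
    lintegral_indicator_const Metric.isClosed_closedBall.measurableSet]
  exact ENNReal.add_lt_top.2
    ⟨ENNReal.mul_lt_top ENNReal.ofReal_lt_top measure_closedBall_lt_top, hlevy.2⟩

/-- The second moment of the part of the Lévy density above the level `n` tends to zero. -/
theorem tendsto_secondMoment_above (hd : 1 ≤ d) (hg : Measurable g) (hga : AntitoneOn g (Ioi 0))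
    (hlevy : IsLevyMeasure (radialMeasure d g)) :
    Tendsto (fun n : ℕ => ∫⁻ x : EuclideanSpace ℝ (Fin d),
      ENNReal.ofReal (‖x‖ ^ 2) * ENNReal.ofReal (max (g ‖x‖ - n) 0)) atTop (𝓝 0) := by
  obtain ⟨n₀, hn₀⟩ := exists_nat_ge (g 1)
  have hlim : Tendsto (fun n : ℕ => ∫⁻ x : EuclideanSpace ℝ (Fin d),
      ENNReal.ofReal (‖x‖ ^ 2) * ENNReal.ofReal (max (g ‖x‖ - (n + n₀ : ℕ)) 0)) atTop
      (𝓝 (∫⁻ _ : EuclideanSpace ℝ (Fin d), 0)) := by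
    refine tendsto_lintegral_of_dominated_convergence
      (fun x => ENNReal.ofReal (min 1 (‖x‖ ^ 2)) * ENNReal.ofReal (g ‖x‖))
      (fun n => by fun_prop) (fun n => ?_) ?_ (Eventually.of_forall fun x => ?_)
    · filter_upwards [ae_norm_pos hd] with x hx
      have hn : (n₀ : ℝ) ≤ (n + n₀ : ℕ) := by exact_mod_cast Nat.le_add_left _ _
      rcases le_or_gt 1 ‖x‖ with h | h
      · have : g ‖x‖ ≤ g 1 := hga (mem_Ioi.2 one_pos) (mem_Ioi.2 hx) h
        rw [max_eq_right (by linarith)]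
        simp
      · rw [min_eq_right (by nlinarith)]
        refine mul_le_mul_right ?_ _
        rw [ENNReal.ofReal_max, ENNReal.ofReal_zero, max_eq_left zero_le]
        refine ENNReal.ofReal_le_ofReal ?_
        linarith [(Nat.cast_nonneg (n + n₀) : (0 : ℝ) ≤ (n + n₀ : ℕ))]
    · rw [← lintegral_min_mul_radial hg]
      exact hlevy.2.ne
    · refine tendsto_const_nhds.congr' ?_
      obtain ⟨n, hn⟩ := exists_nat_ge (g ‖x‖)
      filter_upwards [eventually_ge_atTop n] with k hk
      have : (n : ℝ) ≤ (k + n₀ : ℕ) := by exact_mod_cast hk.trans (Nat.le_add_right _ _)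
      rw [max_eq_right (by linarith)]
      simp
  rw [lintegral_zero] at hlim
  exact (tendsto_add_atTop_iff_nat n₀).1 hlim

/-- Existence of the isotropic unimodal Lévy process with a given Lévy density. The density is cut
into layers at rapidly increasing heights, each of which is the density of a unimodal finite jump
measure. -/
theorem exists_unimodal_levyProcess (hd : 1 ≤ d) (hg : Measurable g) (hg0 : ∀ r, 0 ≤ g r)
    (hga : AntitoneOn g (Ioi 0)) (hlevy : IsLevyMeasure (radialMeasure d g)) :
    ∃ (Ω' : Type) (_ : MeasurableSpace Ω') (Q : Measure Ω')
      (Y : ℝ≥0 → Ω' → EuclideanSpace ℝ (Fin d)),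
      IsUnimodalAdditiveProcess Y Q
        (fun t ξ => (t : ℝ) * (jumpExponent (radialMeasure d g) ξ : ℂ)) := by
  obtain ⟨c, hc, hcsq⟩ : ∃ c : ℕ → ℕ, StrictMono c ∧ ∀ k, ∫⁻ x : EuclideanSpace ℝ (Fin d),
      ENNReal.ofReal (‖x‖ ^ 2) * ENNReal.ofReal (max (g ‖x‖ - c k) 0) ≤
        ENNReal.ofReal ((1 / 8) ^ (k + 1)) := by
    refine extraction_forall_of_eventually (P := fun k n =>
      ∫⁻ x : EuclideanSpace ℝ (Fin d), ENNReal.ofReal (‖x‖ ^ 2) * ENNReal.ofReal (max (g ‖x‖ - n) 0)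
        ≤ ENNReal.ofReal ((1 / 8) ^ (k + 1))) fun k => ?_
    exact (tendsto_secondMoment_above hd hg hga hlevy).eventually_le_const
      (ENNReal.ofReal_pos.2 (by positivity))
  have hlm : ∀ k, Measurable (heightLayer g c k) := measurable_heightLayer hg
  have hsum : radialMeasure d g = Measure.sum fun k => radialMeasure d (heightLayer g c k) := by
    simp only [radialMeasure]
    rw [← withDensity_tsum fun k => (by have := hlm k; fun_prop)]
    congr 1
    ext x
    rw [tsum_apply (Pi.summable.2 fun x => ENNReal.summable), tsum_ofReal_heightLayer hg0 hc]
  rw [hsum] at hlevy ⊢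
  refine exists_levyProcess_of_sum (fun k => ⟨?_⟩)
    (fun k => isUnimodal_radialMeasure hd (antitoneOn_heightLayer hga hc.monotone k))
    (fun k => map_radialMeasure_linearIsometryEquiv _ (LinearIsometryEquiv.neg ℝ))
    (fun k => ?_) hlevy
  · rw [radialMeasure, withDensity_apply _ MeasurableSet.univ, Measure.restrict_univ]
    refine (lintegral_mono fun x => ?_).trans_lt
      (lintegral_ofReal_min_lt_top (d := d) hg (hsum ▸ hlevy) (c k))
    exact ENNReal.ofReal_le_ofReal (heightLayer_le_min hg0 k _)
  · have := hlm (k + 1)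
    rw [radialMeasure, lintegral_withDensity_eq_lintegral_mul _ (by fun_prop) (by fun_prop)]
    refine (lintegral_mono fun x => ?_).trans (hcsq k)
    rw [Pi.mul_apply, mul_comm]
    exact mul_le_mul_right (ENNReal.ofReal_le_ofReal (heightLayer_succ_le k _)) _

end Radial

/-! ### The projection of a radial measure on `ℝ^(d+2)` to `ℝ^d` -/

section Projection

/-- The splitting of `ℝ^(d+2)` into `ℝ^d` and a plane, identified with `ℂ` for the sake of polar
coordinates. -/
noncomputable def splitPlane (d : ℕ) :
    EuclideanSpace ℝ (Fin (d + 2)) ≃ₗᵢ[ℝ] WithLp 2 (EuclideanSpace ℝ (Fin d) × ℂ) :=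
  ((LinearIsometryEquiv.piLpCongrLeft 2 ℝ ℝ finSumFinEquiv.symm).trans
    (PiLp.sumPiLpEquivProdLpPiLp 2 (fun _ : Fin d ⊕ Fin 2 => ℝ))).trans
    (LinearIsometryEquiv.withLpProdCongr 2 (LinearIsometryEquiv.refl ℝ (EuclideanSpace ℝ (Fin d)))
      Complex.orthonormalBasisOneI.repr.symm)

/-- The projection of `ℝ^(d+2)` onto `ℝ^d`. -/
noncomputable def planarProjection (d : ℕ) (x : EuclideanSpace ℝ (Fin (d + 2))) :
    EuclideanSpace ℝ (Fin d) :=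
  (splitPlane d x).fst

/-- The inclusion of `ℝ^d` into `ℝ^(d+2)`, adjoint to the projection. -/
noncomputable def planarInclusion (d : ℕ) (ξ : EuclideanSpace ℝ (Fin d)) :
    EuclideanSpace ℝ (Fin (d + 2)) :=
  (splitPlane d).symm (WithLp.toLp 2 (ξ, 0))

theorem norm_planarInclusion {d : ℕ} (ξ : EuclideanSpace ℝ (Fin d)) :
    ‖planarInclusion d ξ‖ = ‖ξ‖ := by
  rw [planarInclusion, LinearIsometryEquiv.norm_map, WithLp.prod_norm_eq_of_L2]
  simp

theorem inner_planarProjection {d : ℕ} (x : EuclideanSpace ℝ (Fin (d + 2)))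
    (ξ : EuclideanSpace ℝ (Fin d)) : ⟪planarProjection d x, ξ⟫ = ⟪x, planarInclusion d ξ⟫ := by
  rw [planarInclusion, ← (splitPlane d).inner_map_map, LinearIsometryEquiv.apply_symm_apply,
    WithLp.prod_inner_apply]
  simp [planarProjection]

theorem measurePreserving_ofLp_splitPlane (d : ℕ) :
    MeasurePreserving (fun x => WithLp.ofLp (splitPlane d x)) (volume)
      ((volume : Measure (EuclideanSpace ℝ (Fin d))).prod (volume : Measure ℂ)) :=
  (WithLp.volume_preserving_ofLp (EuclideanSpace ℝ (Fin d)) ℂ).comp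
    (splitPlane d).measurePreserving

theorem measurable_planarProjection (d : ℕ) : Measurable (planarProjection d) :=
  measurable_fst.comp (measurePreserving_ofLp_splitPlane d).measurable

/-- Polar coordinates for radial functions on the plane. -/
theorem lintegral_complex_fun_norm {F : ℝ → ℝ≥0∞} (hF : Measurable F) :
    ∫⁻ z : ℂ, F ‖z‖ = ENNReal.ofReal (2 * Real.pi) *
      ∫⁻ s in Ioi (0 : ℝ), ENNReal.ofReal s * F s := by
  have hvol : volume (Ioo (-Real.pi) Real.pi) = ENNReal.ofReal (2 * Real.pi) := by
    rw [Real.volume_Ioo]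
    congr 1
    ring
  rw [← Complex.lintegral_comp_polarCoord_symm, polarCoord_target]
  have : ∀ p ∈ Ioi (0 : ℝ) ×ˢ Ioo (-Real.pi) Real.pi,
      ENNReal.ofReal p.1 • F ‖Complex.polarCoord.symm p‖ = ENNReal.ofReal p.1 * F p.1 := by
    intro p hp
    rw [Complex.norm_polarCoord_symm, abs_of_pos hp.1, smul_eq_mul]
  rw [setLIntegral_congr_fun (measurableSet_Ioi.prod measurableSet_Ioo) this,
    Measure.volume_eq_prod, ← Measure.prod_restrict,
    lintegral_prod _ (by fun_prop)]
  simp only [lintegral_const, Measure.restrict_apply MeasurableSet.univ, univ_inter, hvol]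
  rw [lintegral_mul_const _ (by fun_prop), mul_comm]

/-- The integral of a radial function over a plane at distance `r` from the origin, by the
substitution `u = √(r² + s²)`. -/
theorem lintegral_complex_fun_sqrt {F : ℝ → ℝ≥0∞} (hF : Measurable F) {r : ℝ} (hr : 0 < r) :
    ∫⁻ z : ℂ, F (√(r ^ 2 + ‖z‖ ^ 2)) = ENNReal.ofReal (2 * Real.pi) *
      ∫⁻ u in Ioi r, ENNReal.ofReal u * F u := by
  rw [lintegral_complex_fun_norm (F := fun s => F (√(r ^ 2 + s ^ 2))) (by fun_prop)]
  congr 1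
  have hpos : ∀ s : ℝ, 0 < r ^ 2 + s ^ 2 := fun s => by positivity
  have hder : ∀ s ∈ Ioi (0 : ℝ), HasDerivWithinAt (fun s : ℝ => √(r ^ 2 + s ^ 2))
      (s / √(r ^ 2 + s ^ 2)) (Ioi 0) s := by
    intro s _
    have h1 : HasDerivAt (fun s : ℝ => r ^ 2 + s ^ 2) (2 * s) s := by
      simpa using (hasDerivAt_pow 2 s).const_add (r ^ 2)
    have h2 := h1.sqrt (hpos s).ne'
    rw [mul_div_mul_left _ _ two_ne_zero] at h2
    exact h2.hasDerivWithinAt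
  have hinj : InjOn (fun s : ℝ => √(r ^ 2 + s ^ 2)) (Ioi 0) := by
    intro a ha b hb hab
    have h1 := (Real.sqrt_inj (hpos a).le (hpos b).le).1 hab
    have ha' : (0 : ℝ) < a := ha
    have hb' : (0 : ℝ) < b := hb
    exact (sq_eq_sq₀ ha'.le hb'.le).1 (by linarith)
  have himage : (fun s : ℝ => √(r ^ 2 + s ^ 2)) '' Ioi 0 = Ioi r := by
    ext u
    constructor
    · rintro ⟨s, hs, rfl⟩
      have hs' : (0 : ℝ) < s := hs
      exact Real.lt_sqrt_of_sq_lt (by nlinarith)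
    · intro hu
      have hu' : r < u := hu
      have h1 : 0 < u ^ 2 - r ^ 2 := by nlinarith
      refine ⟨√(u ^ 2 - r ^ 2), Real.sqrt_pos.2 h1, ?_⟩
      beta_reduce
      rw [Real.sq_sqrt h1.le, add_sub_cancel, Real.sqrt_sq (by linarith)]
  rw [← himage, lintegral_image_eq_lintegral_abs_deriv_mul measurableSet_Ioi hder hinj]
  refine setLIntegral_congr_fun measurableSet_Ioi fun s hs => ?_
  have hs' : (0 : ℝ) < s := hs
  have hsq : 0 < √(r ^ 2 + s ^ 2) := Real.sqrt_pos.2 (hpos s)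
  rw [← mul_assoc, ← ENNReal.ofReal_mul (abs_nonneg _), abs_of_pos (by positivity),
    div_mul_cancel₀ _ hsq.ne']

/-- Integrating a radial density on `ℝ^(d+2)` over the planes orthogonal to `ℝ^d`. -/
theorem map_planarProjection_withDensity {d : ℕ} (hd : 1 ≤ d) {F : ℝ → ℝ≥0∞} (hF : Measurable F) :
    ((volume : Measure (EuclideanSpace ℝ (Fin (d + 2)))).withDensity fun x => F ‖x‖).map
      (planarProjection d) =
    (volume : Measure (EuclideanSpace ℝ (Fin d))).withDensity fun y =>
      ENNReal.ofReal (2 * Real.pi) * ∫⁻ u in Ioi ‖y‖, ENNReal.ofReal u * F u := by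
  ext s hs
  have hπ := measurable_planarProjection d
  have hfm : Measurable fun w : EuclideanSpace ℝ (Fin d) × ℂ =>
      (s ×ˢ (univ : Set ℂ)).indicator (fun w => F (√(‖w.1‖ ^ 2 + ‖w.2‖ ^ 2))) w :=
    Measurable.indicator (by fun_prop) (hs.prod MeasurableSet.univ)
  rw [Measure.map_apply hπ hs, withDensity_apply _ (hπ hs), withDensity_apply _ hs,
    ← lintegral_indicator (hπ hs)]
  have h1 : ∀ x : EuclideanSpace ℝ (Fin (d + 2)),
      (planarProjection d ⁻¹' s).indicator (fun x => F ‖x‖) x =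
      (s ×ˢ (univ : Set ℂ)).indicator (fun w => F (√(‖w.1‖ ^ 2 + ‖w.2‖ ^ 2)))
        (WithLp.ofLp (splitPlane d x)) := by
    intro x
    have hn : ‖x‖ = √(‖(splitPlane d x).fst‖ ^ 2 + ‖(splitPlane d x).snd‖ ^ 2) := by
      rw [← WithLp.prod_norm_eq_of_L2, LinearIsometryEquiv.norm_map]
    by_cases hx : planarProjection d x ∈ s
    · rw [indicator_of_mem (show x ∈ planarProjection d ⁻¹' s from hx),
        indicator_of_mem (show WithLp.ofLp (splitPlane d x) ∈ s ×ˢ univ from ⟨hx, trivial⟩), hn]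
      rfl
    · rw [indicator_of_notMem (show x ∉ planarProjection d ⁻¹' s from hx),
        indicator_of_notMem (fun h => hx h.1)]
  simp_rw [h1]
  rw [(measurePreserving_ofLp_splitPlane d).lintegral_comp hfm, lintegral_prod _ hfm.aemeasurable,
    ← lintegral_indicator hs]
  refine lintegral_congr_ae ?_
  filter_upwards [ae_norm_pos hd] with y hy
  by_cases hys : y ∈ s
  · rw [indicator_of_mem hys, ← lintegral_complex_fun_sqrt hF hy]
    refine lintegral_congr fun z => ?_
    rw [indicator_of_mem (show (y, z) ∈ s ×ˢ univ from ⟨hys, trivial⟩)]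
  · rw [indicator_of_notMem hys, ← lintegral_zero]
    refine lintegral_congr fun z => ?_
    rw [indicator_of_notMem (fun h => hys h.1)]

theorem charFun_map_planarProjection {d : ℕ} (μ : Measure (EuclideanSpace ℝ (Fin (d + 2))))
    (ξ : EuclideanSpace ℝ (Fin d)) :
    charFun (μ.map (planarProjection d)) ξ = charFun μ (planarInclusion d ξ) := by
  rw [charFun_apply, integral_map (measurable_planarProjection d).aemeasurable (by fun_prop),
    charFun_apply]
  simp_rw [inner_planarProjection]

theorem jumpExponent_map_planarProjection {d : ℕ} (μ : Measure (EuclideanSpace ℝ (Fin (d + 2))))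
    (ξ : EuclideanSpace ℝ (Fin d)) :
    jumpExponent (μ.map (planarProjection d)) ξ = jumpExponent μ (planarInclusion d ξ) := by
  rw [jumpExponent, integral_map (measurable_planarProjection d).aemeasurable (by fun_prop),
    jumpExponent]
  simp_rw [real_inner_comm _ ξ, inner_planarProjection, real_inner_comm (planarInclusion d ξ)]

/-- Integrals of a function of `⟪x, ξ⟫` against a radial measure depend only on `‖ξ‖`. -/
theorem lintegral_inner_radialMeasure_congr {d : ℕ} (f : ℝ → ℝ) {G : ℝ → ℝ≥0∞} (hG : Measurable G)
    {ξ η : EuclideanSpace ℝ (Fin d)} (h : ‖ξ‖ = ‖η‖) :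
    ∫⁻ x, G ⟪x, ξ⟫ ∂radialMeasure d f = ∫⁻ x, G ⟪x, η⟫ ∂radialMeasure d f := by
  set R := (ℝ ∙ (ξ - η))ᗮ.reflection
  have hR : R ξ = η := Submodule.reflection_sub h
  conv_rhs => rw [← map_radialMeasure_linearIsometryEquiv f R,
    lintegral_map (by fun_prop) R.continuous.measurable]
  simp_rw [← hR, R.inner_map_map]

theorem jumpExponent_radialMeasure_congr {d : ℕ} (f : ℝ → ℝ) {ξ η : EuclideanSpace ℝ (Fin d)}
    (h : ‖ξ‖ = ‖η‖) :
    jumpExponent (radialMeasure d f) ξ = jumpExponent (radialMeasure d f) η := by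
  have hnn : ∀ ζ : EuclideanSpace ℝ (Fin d), jumpExponent (radialMeasure d f) ζ =
      (∫⁻ x, ENNReal.ofReal (1 - Real.cos ⟪x, ζ⟫) ∂radialMeasure d f).toReal := by
    intro ζ
    rw [jumpExponent, integral_eq_lintegral_of_nonneg_ae
      (Eventually.of_forall fun x => sub_nonneg.2 (Real.cos_le_one _)) (by fun_prop)]
    simp_rw [real_inner_comm _ ζ]
  rw [hnn, hnn, lintegral_inner_radialMeasure_congr f
    (G := fun s => ENNReal.ofReal (1 - Real.cos s)) (by fun_prop) h]

end Projection

/-! ### The Lévy density in dimension `d + 2` -/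

section RaisedDensity

variable {f f' : ℝ → ℝ}

/-- A positive value of `f'` would bound `f'` from below by a positive constant on a half-line,
since `-f'(r) / r` is nonincreasing. -/
theorem IsRadialDerivative.nonpos (h : IsRadialDerivative f f')
    (hmono : AntitoneOn (fun r => -f' r / r) (Ioi 0)) {r : ℝ} (hr : 0 < r) : f' r ≤ 0 := by
  by_contra! hpos
  have hle : ∀ ρ ∈ Ioi r, f' r ≤ f' ρ := by
    intro ρ hρ
    have hρ' : r < ρ := hρ
    have h1 : -f' ρ / ρ ≤ -f' r / r := hmono hr (hr.trans hρ') hρ'.le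
    rw [div_le_div_iff₀ (hr.trans hρ') hr] at h1
    nlinarith
  have hconst : IntegrableOn (fun _ : ℝ => f' r) (Ioi r) := by
    refine Integrable.mono' (h r hr).1 (by fun_prop) ?_
    filter_upwards [ae_restrict_mem measurableSet_Ioi] with ρ hρ
    rw [Real.norm_of_nonneg hpos.le]
    exact hle ρ hρ
  rw [integrableOn_const_iff] at hconst
  simp [hpos.ne'] at hconst

/-- The radial profile `-f'(r) / (2πr)`, whose integral over the planes orthogonal to `ℝ^d` in
`ℝ^(d+2)` gives back `f`. It is set to zero outside `(0, ∞)` to make it measurable. -/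
noncomputable def raisedDensity (f' : ℝ → ℝ) : ℝ → ℝ :=
  (Ioi 0).indicator fun r => (2 * Real.pi)⁻¹ * (-f' r / r)

theorem antitoneOn_inv_mul (hmono : AntitoneOn (fun r => -f' r / r) (Ioi 0)) :
    AntitoneOn (fun r => (2 * Real.pi)⁻¹ * (-f' r / r)) (Ioi 0) := fun _ hx _ hy hxy =>
  mul_le_mul_of_nonneg_left (hmono hx hy hxy) (by positivity)

theorem measurable_raisedDensity (hmono : AntitoneOn (fun r => -f' r / r) (Ioi 0)) :
    Measurable (raisedDensity f') :=
  measurable_indicator_of_antitoneOn (antitoneOn_inv_mul hmono)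

theorem antitoneOn_raisedDensity (hmono : AntitoneOn (fun r => -f' r / r) (Ioi 0)) :
    AntitoneOn (raisedDensity f') (Ioi 0) :=
  (antitoneOn_inv_mul hmono).congr fun r hr => by rw [raisedDensity, indicator_of_mem hr]

theorem raisedDensity_nonneg (h : IsRadialDerivative f f')
    (hmono : AntitoneOn (fun r => -f' r / r) (Ioi 0)) (r : ℝ) : 0 ≤ raisedDensity f' r := by
  refine indicator_nonneg (fun u hu => ?_) r
  have hu' : (0 : ℝ) < u := hu
  have := h.nonpos hmono hu'
  have : 0 ≤ -f' u / u := div_nonneg (by linarith) hu'.le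
  positivity

/-- Integrating the raised profile over planes recovers `f`. -/
theorem lintegral_mul_raisedDensity (h : IsRadialDerivative f f')
    (hmono : AntitoneOn (fun r => -f' r / r) (Ioi 0)) {r : ℝ} (hr : 0 < r) :
    ENNReal.ofReal (2 * Real.pi) *
      ∫⁻ u in Ioi r, ENNReal.ofReal u * ENNReal.ofReal (raisedDensity f' u) =
      ENNReal.ofReal (f r) := by
  have hg := measurable_raisedDensity hmono
  rw [← lintegral_const_mul _ (by fun_prop), (h r hr).2, ← integral_neg,
    ofReal_integral_eq_lintegral_ofReal (f := fun u => -f' u) (h r hr).1.neg]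
  · refine setLIntegral_congr_fun measurableSet_Ioi fun u hu => ?_
    have hu' : 0 < u := hr.trans hu
    rw [raisedDensity, indicator_of_mem (mem_Ioi.2 hu'), ← ENNReal.ofReal_mul hu'.le,
      ← ENNReal.ofReal_mul (by positivity)]
    congr 1
    field_simp
  · filter_upwards [ae_restrict_mem measurableSet_Ioi] with u hu
    simpa using h.nonpos hmono (hr.trans hu)

theorem map_planarProjection_radialMeasure {d : ℕ} (hd : 1 ≤ d) {g : ℝ → ℝ} (hg : Measurable g)
    (h : ∀ r, 0 < r → ENNReal.ofReal (2 * Real.pi) *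
      ∫⁻ u in Ioi r, ENNReal.ofReal u * ENNReal.ofReal (g u) = ENNReal.ofReal (f r)) :
    (radialMeasure (d + 2) g).map (planarProjection d) = radialMeasure d f := by
  rw [radialMeasure, map_planarProjection_withDensity hd (F := fun r => ENNReal.ofReal (g r))
    (by fun_prop)]
  refine withDensity_congr_ae ?_
  filter_upwards [ae_norm_pos hd] with x hx using h _ hx

/-- A radial measure is a Lévy measure as soon as its projection is: each coordinate is distributed
like a coordinate of the projection, and `1 ∧ |x|²` is at most the sum of the `1 ∧ x_i²`. -/
theorem isLevyMeasure_of_map_planarProjection {d : ℕ} (hd : 1 ≤ d) {g : ℝ → ℝ}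
    (h : IsLevyMeasure ((radialMeasure (d + 2) g).map (planarProjection d))) :
    IsLevyMeasure (radialMeasure (d + 2) g) := by
  refine ⟨withDensity_absolutelyContinuous _ _ (by simp), ?_⟩
  set μ := radialMeasure (d + 2) g
  have hG : Measurable fun s : ℝ => ENNReal.ofReal (min 1 (s ^ 2)) := by fun_prop
  set b := EuclideanSpace.basisFun (Fin (d + 2)) ℝ
  set e : EuclideanSpace ℝ (Fin d) := EuclideanSpace.single ⟨0, hd⟩ 1
  have he : ‖e‖ = 1 := by simp [e]
  have hcoord : ∀ i, ∫⁻ x, ENNReal.ofReal (min 1 (⟪x, b i⟫ ^ 2)) ∂μ < ∞ := by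
    intro i
    rw [lintegral_inner_radialMeasure_congr g hG (η := planarInclusion d e)
      (by rw [norm_planarInclusion, he, b.norm_eq_one])]
    simp_rw [← inner_planarProjection]
    rw [← lintegral_map (f := fun y => ENNReal.ofReal (min 1 (⟪y, e⟫ ^ 2))) (by fun_prop)
      (measurable_planarProjection d)]
    refine lt_of_le_of_lt (lintegral_mono fun y => ENNReal.ofReal_le_ofReal ?_) h.2
    refine min_le_min le_rfl (sq_le_sq' ?_ ?_)
    · have := abs_real_inner_le_norm y e
      rw [he, mul_one, abs_le] at this
      exact this.1
    · have := real_inner_le_norm y e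
      rwa [he, mul_one] at this
  refine lt_of_le_of_lt (b := ∑ i, ∫⁻ x, ENNReal.ofReal (min 1 (⟪x, b i⟫ ^ 2)) ∂μ) ?_
    (ENNReal.sum_lt_top.2 fun i _ => hcoord i)
  rw [← lintegral_finsetSum _ fun i _ => by fun_prop]
  refine lintegral_mono fun x => ?_
  beta_reduce
  rw [← ENNReal.ofReal_sum_of_nonneg fun i _ => by positivity]
  refine ENNReal.ofReal_le_ofReal ?_
  have hnorm : ‖x‖ ^ 2 = ∑ i, ⟪x, b i⟫ ^ 2 := (b.sum_sq_inner_left x).symm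
  by_cases hbig : ∃ i, 1 ≤ ⟪x, b i⟫ ^ 2
  · obtain ⟨i, hi⟩ := hbig
    calc min 1 (‖x‖ ^ 2) ≤ min 1 (⟪x, b i⟫ ^ 2) := by rw [min_eq_left hi]; exact min_le_left _ _
      _ ≤ _ := Finset.single_le_sum (f := fun i => min 1 (⟪x, b i⟫ ^ 2))
        (fun i _ => by positivity) (Finset.mem_univ i)
  · push Not at hbig
    refine (min_le_right _ _).trans ?_
    rw [hnorm]
    exact Finset.sum_le_sum fun i _ => (min_eq_right (hbig i).le).ge

end RaisedDensity

/-! ### Growth of the exponent for infinite Lévy measures -/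

section Decay

variable {d : ℕ}

/-- The Riemann–Lebesgue lemma for characteristic functions. -/
theorem tendsto_charFun_radialMeasure {f : ℝ → ℝ} (hf : Measurable f) :
    Tendsto (charFun (radialMeasure d f)) (cocompact _) (𝓝 0) := by
  -- the normalisations of the Fourier transform and of `charFun` differ by this factor
  set c : ℝ := -(2 * Real.pi)⁻¹ with hc
  have hc0 : -c ≠ 0 := by rw [hc, neg_neg]; positivity
  have h1 := tendsto_integral_exp_inner_smul_cocompact
    (fun x : EuclideanSpace ℝ (Fin d) => ((max (f ‖x‖) 0 : ℝ) : ℂ))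
  have h2 : Tendsto (fun ξ : EuclideanSpace ℝ (Fin d) => c • ξ) (cocompact _) (cocompact _) :=
    (Homeomorph.smulOfNeZero c (by simpa using hc0)).isClosedEmbedding.tendsto_cocompact
  refine (h1.comp h2).congr fun ξ => ?_
  rw [charFun_eq_fourierIntegral', radialMeasure, VectorFourier.fourierIntegral]
  have : (fun x : EuclideanSpace ℝ (Fin d) => ENNReal.ofReal (f ‖x‖)) =
    fun x => ((Real.toNNReal (f ‖x‖) : ℝ≥0) : ℝ≥0∞) := rfl
  rw [this, integral_withDensity_eq_integral_smul (by fun_prop)]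
  refine integral_congr_ae (Eventually.of_forall fun x => ?_)
  simp only [innerₗ_apply_apply]
  rw [smul_comm, NNReal.smul_def, Real.coe_toNNReal']
  simp [hc]

/-- The exponent dominates those of the finite measures obtained by truncating the density in
height, which tend to the total masses at infinity; these masses are arbitrarily large. -/
theorem tendsto_jumpExponent_radialMeasure {g : ℝ → ℝ} (hg : Measurable g)
    (hlevy : IsLevyMeasure (radialMeasure d g)) (hinf : radialMeasure d g univ = ∞) :
    Tendsto (jumpExponent (radialMeasure d g)) (cocompact _) atTop := by
  have hmass : Tendsto (fun n : ℕ => radialMeasure d (fun r => min (g r) n) univ) atTop (𝓝 ∞) := by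
    rw [← hinf]
    simp only [radialMeasure, withDensity_apply _ MeasurableSet.univ, Measure.restrict_univ]
    refine lintegral_tendsto_of_tendsto_of_monotone (fun n => by fun_prop)
      (Eventually.of_forall fun x m n hmn => ENNReal.ofReal_le_ofReal
        (min_le_min le_rfl (by exact_mod_cast hmn)))
      (Eventually.of_forall fun x => tendsto_const_nhds.congr' ?_)
    filter_upwards [eventually_ge_atTop ⌈g ‖x‖⌉₊] with n hn
    rw [min_eq_left ((Nat.le_ceil _).trans (by exact_mod_cast hn))]
  refine tendsto_atTop.2 fun b => ?_
  obtain ⟨n, hn⟩ := (hmass.eventually (lt_mem_nhds (a := ENNReal.ofReal (b + 1))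
    ENNReal.ofReal_lt_top)).exists
  set m := radialMeasure d (fun r => min (g r) n) with hm
  have hfin : IsFiniteMeasure m := by
    refine ⟨?_⟩
    rw [hm, radialMeasure, withDensity_apply _ MeasurableSet.univ, Measure.restrict_univ]
    exact lintegral_ofReal_min_lt_top hg hlevy n
  have hle : m ≤ radialMeasure d g := withDensity_mono
    (Eventually.of_forall fun x => ENNReal.ofReal_le_ofReal (min_le_left _ _))
  have hb : b + 1 < m.real univ := by
    by_contra! h
    exact absurd (ENNReal.le_ofReal_iff_toReal_le (measure_ne_top _ _)
      (measureReal_nonneg.trans h) |>.2 h) (not_le.2 hn)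
  have hsymm : m.map (fun x => -x) = m :=
    map_radialMeasure_linearIsometryEquiv _ (LinearIsometryEquiv.neg ℝ)
  have hsmall := (tendsto_charFun_radialMeasure (d := d) (f := fun r => min (g r) n)
    (by fun_prop)).eventually (Metric.ball_mem_nhds _ one_pos)
  filter_upwards [hsmall] with ξ hξ
  have h1 := congrArg Complex.re (charFun_zero_sub_charFun hsymm ξ)
  rw [charFun_zero, Complex.sub_re, Complex.ofReal_re, Complex.ofReal_re] at h1
  have h2 : (charFun m ξ).re < 1 := (Complex.re_le_norm _).trans_lt (by simpa using hξ)
  have h3 : jumpExponent m ξ ≤ jumpExponent (radialMeasure d g) ξ :=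
    integral_mono_measure hle (Eventually.of_forall fun x => sub_nonneg.2 (Real.cos_le_one _))
      (integrable_one_sub_cos_inner hlevy ξ)
  linarith

end Decay

/-! ### Densities of projected measures -/

section LoweredDensity

theorem radialMeasure_indicator {d : ℕ} (hd : 1 ≤ d) (q : ℝ → ℝ) :
    radialMeasure d ((Ioi 0).indicator q) = radialMeasure d q :=
  radialMeasure_congr hd fun _ hr => indicator_of_mem hr q

/-- A radially nonincreasing density is determined everywhere on `(0, ∞)` if it has a continuous
version. -/
theorem eq_of_radialMeasure_eq {d : ℕ} (hd : 1 ≤ d) {p q : ℝ → ℝ} (hp : AntitoneOn p (Ioi 0))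
    (hq : AntitoneOn q (Ioi 0)) (hp0 : ∀ r, 0 < r → 0 ≤ p r) (hq0 : ∀ r, 0 < r → 0 ≤ q r)
    (hqc : ∀ r, 0 < r → ContinuousAt q r) (h : radialMeasure d p = radialMeasure d q) {r : ℝ}
    (hr : 0 < r) : p r = q r := by
  have : Nonempty (Fin d) := ⟨⟨0, hd⟩⟩
  have hpm := measurable_indicator_of_antitoneOn hp
  have hqm := measurable_indicator_of_antitoneOn hq
  rw [← radialMeasure_indicator hd p, ← radialMeasure_indicator hd q, radialMeasure, radialMeasure,
    withDensity_eq_iff_of_sigmaFinite (by fun_prop) (by fun_prop)] at h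
  have hae : ∀ᵐ x : EuclideanSpace ℝ (Fin d), p ‖x‖ = q ‖x‖ := by
    filter_upwards [h, ae_norm_pos hd] with x hx hx0
    rw [indicator_of_mem (show ‖x‖ ∈ Ioi (0 : ℝ) from hx0),
      indicator_of_mem (show ‖x‖ ∈ Ioi (0 : ℝ) from hx0)] at hx
    exact (ENNReal.ofReal_eq_ofReal_iff (hp0 _ hx0) (hq0 _ hx0)).1 hx
  obtain ⟨x, hx⟩ := exists_norm_eq (EuclideanSpace ℝ (Fin d)) hr.le
  have hx0 : x ≠ 0 := by
    rintro rfl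
    rw [norm_zero] at hx
    exact hr.ne hx
  have hqx : ContinuousAt q ‖x‖ := hx ▸ hqc r hr
  have := (continuousAt_of_ae_eq_of_antitoneOn hp hx0 (G := fun y => q ‖y‖)
    (hqx.comp continuous_norm.continuousAt) hae).1
  rwa [hx] at this

/-- The radial profile on `ℝ^d` obtained by integrating the radial function with profile `q` on
`ℝ^(d+2)` over the planes orthogonal to `ℝ^d`. -/
noncomputable def loweredDensity (q : ℝ → ℝ) (r : ℝ) : ℝ :=
  2 * Real.pi * ∫ u in Ioi r, u * q u

variable {q : ℝ → ℝ}

/-- The profile of a finite radially nonincreasing measure on `ℝ^(d+2)` is integrable over the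
planes parallel to, but distinct from, a fixed one: such an integral is nonincreasing in the
distance, and it is almost everywhere finite. -/
theorem integrableOn_mul_of_isFiniteMeasure {d : ℕ} (hd : 1 ≤ d) (hq : AntitoneOn q (Ioi 0))
    (hq0 : ∀ r, 0 < r → 0 ≤ q r) [IsFiniteMeasure (radialMeasure (d + 2) q)] {r : ℝ} (hr : 0 < r) :
    IntegrableOn (fun u => u * q u) (Ioi r) := by
  have hqm := measurable_indicator_of_antitoneOn hq
  set H : ℝ → ℝ≥0∞ := fun r => ENNReal.ofReal (2 * Real.pi) *
    ∫⁻ u in Ioi r, ENNReal.ofReal u * ENNReal.ofReal ((Ioi 0).indicator q u)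
  have hH : Antitone H := fun a b hab =>
    mul_le_mul_right (lintegral_mono_set (Ioi_subset_Ioi hab)) _
  have hmap := map_planarProjection_withDensity hd
    (F := fun r => ENNReal.ofReal ((Ioi 0).indicator q r)) (by fun_prop)
  have hfin : ∀ᵐ y : EuclideanSpace ℝ (Fin d), H ‖y‖ < ∞ := by
    refine ae_lt_top (hH.measurable.comp measurable_norm) ?_
    have h1 : ∫⁻ y : EuclideanSpace ℝ (Fin d), H ‖y‖ =
        (radialMeasure (d + 2) q).map (planarProjection d) univ := by
      rw [← radialMeasure_indicator (by omega), radialMeasure, hmap,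
        withDensity_apply _ MeasurableSet.univ, Measure.restrict_univ]
    rw [h1]
    exact measure_ne_top _ _
  obtain ⟨y, hyr, hy⟩ := (Measure.dense_of_ae hfin).inter_open_nonempty _ Metric.isOpen_ball
    ⟨0, Metric.mem_ball_self hr⟩
  have hy' : H ‖y‖ < ∞ := hy
  -- `H` is finite somewhere in the ball of radius `r`, hence at `r`
  have hHr : H r < ∞ := (hH (mem_ball_zero_iff.1 hyr).le).trans_lt hy'
  have hlt : ∫⁻ u in Ioi r, ENNReal.ofReal u * ENNReal.ofReal ((Ioi 0).indicator q u) < ∞ := by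
    refine lt_of_le_of_ne le_top fun h => ?_
    simp only [H, h] at hHr
    rw [ENNReal.mul_top (by simp [Real.pi_pos])] at hHr
    exact lt_irrefl _ hHr
  have hint : IntegrableOn (fun u => u * (Ioi 0).indicator q u) (Ioi r) := by
    refine ⟨by fun_prop, ?_⟩
    rw [hasFiniteIntegral_iff_ofReal]
    · refine lt_of_eq_of_lt (setLIntegral_congr_fun measurableSet_Ioi fun u hu => ?_) hlt
      exact ENNReal.ofReal_mul (hr.trans hu).le
    · filter_upwards [ae_restrict_mem measurableSet_Ioi] with u hu
      have hu0 : 0 < u := hr.trans hu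
      rw [indicator_of_mem (mem_Ioi.2 hu0)]
      exact mul_nonneg hu0.le (hq0 u hu0)
  refine hint.congr_fun (fun u hu => ?_) measurableSet_Ioi
  have hu0 : 0 < u := hr.trans hu
  beta_reduce
  rw [indicator_of_mem (mem_Ioi.2 hu0)]

theorem map_planarProjection_eq_loweredDensity {d : ℕ} (hd : 1 ≤ d) (hq : AntitoneOn q (Ioi 0))
    (hq0 : ∀ r, 0 < r → 0 ≤ q r) [IsFiniteMeasure (radialMeasure (d + 2) q)] :
    (radialMeasure (d + 2) q).map (planarProjection d) = radialMeasure d (loweredDensity q) := by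
  rw [← radialMeasure_indicator (by omega)]
  refine map_planarProjection_radialMeasure hd (measurable_indicator_of_antitoneOn hq) ?_
  intro r hr
  rw [loweredDensity, ENNReal.ofReal_mul (p := 2 * Real.pi) (by positivity),
    ofReal_integral_eq_lintegral_ofReal (integrableOn_mul_of_isFiniteMeasure hd hq hq0 hr)]
  · congr 1
    refine setLIntegral_congr_fun measurableSet_Ioi fun u hu => ?_
    have hu0 : 0 < u := hr.trans hu
    rw [indicator_of_mem (mem_Ioi.2 hu0), ENNReal.ofReal_mul hu0.le]
  · filter_upwards [ae_restrict_mem measurableSet_Ioi] with u hu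
    have hu0 : 0 < u := hr.trans hu
    exact mul_nonneg hu0.le (hq0 u hu0)

theorem loweredDensity_nonneg (hq0 : ∀ r, 0 < r → 0 ≤ q r) {r : ℝ} (hr : 0 < r) :
    0 ≤ loweredDensity q r := by
  refine mul_nonneg (by positivity) (setIntegral_nonneg measurableSet_Ioi fun u hu => ?_)
  have hu0 : 0 < u := hr.trans hu
  exact mul_nonneg hu0.le (hq0 u hu0)

theorem antitoneOn_loweredDensity (hq0 : ∀ r, 0 < r → 0 ≤ q r)
    (hint : ∀ r, 0 < r → IntegrableOn (fun u => u * q u) (Ioi r)) :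
    AntitoneOn (loweredDensity q) (Ioi 0) := by
  intro a ha b _ hab
  refine mul_le_mul_of_nonneg_left (setIntegral_mono_set (hint a ha) ?_
    (Ioi_subset_Ioi hab).eventuallyLE) (by positivity)
  filter_upwards [ae_restrict_mem measurableSet_Ioi] with u hu
  have hu0 : 0 < u := lt_trans ha hu
  exact mul_nonneg hu0.le (hq0 u hu0)

theorem hasDerivAt_loweredDensity (hint : ∀ r, 0 < r → IntegrableOn (fun u => u * q u) (Ioi r))
    (hqc : ∀ r, 0 < r → ContinuousAt q r) {r : ℝ} (hr : 0 < r) :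
    HasDerivAt (loweredDensity q) (-(2 * Real.pi * r * q r)) r := by
  have ha : 0 < r / 2 := by positivity
  have hcont : ContinuousOn (fun u => u * q u) (Ioi 0) := fun u hu =>
    (continuousAt_id.mul (hqc u hu)).continuousWithinAt
  have h1 : HasDerivAt (fun s => ∫ u in (r / 2)..s, u * q u) (r * q r) r := by
    refine intervalIntegral.integral_hasDerivAt_right ?_ ?_ (continuousAt_id.mul (hqc r hr))
    · rw [intervalIntegrable_iff_integrableOn_Ioc_of_le (by linarith)]
      exact (hint _ ha).mono_set Ioc_subset_Ioi_self
    · exact hcont.stronglyMeasurableAtFilter isOpen_Ioi r hr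
  have h2 := ((h1.const_sub (∫ u in Ioi (r / 2), u * q u)).const_mul (2 * Real.pi))
  refine (h2.congr_of_eventuallyEq ?_).congr_deriv (by ring)
  filter_upwards [lt_mem_nhds (show r / 2 < r by linarith)] with s hs
  rw [loweredDensity, ← intervalIntegral.integral_interval_add_Ioi (hint _ ha)
    (hint _ (ha.trans hs)), add_sub_cancel_left]

end LoweredDensity

/-! ### Transition densities -/

section Densities

variable {Ω : Type*} [MeasurableSpace Ω] {d : ℕ}

/-- A Lévy process with unimodal laws whose exponent tends to infinity has transition densities.
They are continuous off the origin, because the law at time `t` is the convolution square of the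
law at time `t / 2`. -/
theorem exists_radialTransitionDensity (hd : 1 ≤ d) {Y : ℝ≥0 → Ω → EuclideanSpace ℝ (Fin d)}
    {Q : Measure Ω} {Ψ : EuclideanSpace ℝ (Fin d) → ℝ} (hY : IsLevyProcess Y Q)
    (hYΨ : HasCharExponent Y Q fun ξ => (Ψ ξ : ℂ)) (hYu : ∀ t, IsUnimodal (Q.map (Y t)))
    (hΨ : Tendsto Ψ (cocompact _) atTop) :
    ∃ q : ℝ≥0 → ℝ → ℝ, IsRadialTransitionDensity Y Q q ∧
      ∀ t, 0 < t → ∀ r, 0 < r → ContinuousAt (q t) r := by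
  have : Nonempty (Fin d) := ⟨⟨0, hd⟩⟩
  have := hY.isProbabilityMeasure
  have hprob : ∀ t, IsProbabilityMeasure (Q.map (Y t)) := fun t =>
    Measure.isProbabilityMeasure_map (hY.measurable t).aemeasurable
  have hatom : ∀ t, 0 < t → Q.map (Y t) {0} = 0 := by
    intro t ht
    refine measure_singleton_zero_of_tendsto_charFun ?_
    rw [tendsto_zero_iff_norm_tendsto_zero]
    have h1 : Tendsto (fun ξ => Real.exp (-((t : ℝ) * Ψ ξ))) (cocompact _) (𝓝 0) :=
      Real.tendsto_exp_neg_atTop_nhds_zero.comp (hΨ.const_mul_atTop (by exact_mod_cast ht))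
    refine h1.congr fun ξ => ?_
    rw [hYΨ t ξ, Complex.norm_exp]
    simp
  choose q hq0 hqa hq using fun t : {t : ℝ≥0 // 0 < t} => (hYu t).exists_density (hatom t t.2)
  refine ⟨fun t => if ht : 0 < t then q ⟨t, ht⟩ else 0, ⟨fun t ht r _ => ?_, fun t ht => ?_,
    fun t ht => ?_⟩, fun t ht r hr => ?_⟩
  · rw [dif_pos ht]
    exact hq0 _ r
  · rw [dif_pos ht]
    exact hqa _
  · rw [dif_pos ht]
    exact hq ⟨t, ht⟩
  · simp only [dif_pos ht]
    have ht2 : 0 < t / 2 := half_pos ht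
    refine continuousAt_density_selfConvolution (hqa ⟨t / 2, ht2⟩) (hqa ⟨t, ht⟩)
      (fun r _ => hq0 _ r) (hq ⟨t / 2, ht2⟩) ?_ hr
    rw [← hq ⟨t, ht⟩]
    refine Measure.ext_of_charFun (funext fun ξ => ?_)
    rw [charFun_conv, hYΨ, hYΨ, ← Complex.exp_add]
    congr 1
    push_cast
    ring

end Densities

theorem theorem1p4 {Ω : Type*} [MeasurableSpace Ω] (P : Measure Ω) (d : ℕ) (hd : 1 ≤ d)
    (X : ℝ≥0 → Ω → EuclideanSpace ℝ (Fin d)) (ν ν' ψ : ℝ → ℝ)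
    (hX : IsPureJumpIsotropicLevyProcess X P (radialMeasure d ν))
    (hψ : HasCharExponent X P (fun ξ => (ψ ‖ξ‖ : ℂ)))
    (hinf : radialMeasure d ν univ = ∞)
    (hν : AntitoneOn ν (Ioi 0))
    (hν' : IsRadialDerivative ν ν')
    (hmono : AntitoneOn (fun r => -ν' r / r) (Ioi 0)) :
    (∃ p : ℝ≥0 → ℝ → ℝ, IsRadialTransitionDensity X P p) ∧
    ∃ (Ω₂ : Type) (_ : MeasurableSpace Ω₂) (Q : Measure Ω₂)
      (Y : ℝ≥0 → Ω₂ → EuclideanSpace ℝ (Fin (d + 2))) (q : ℝ≥0 → ℝ → ℝ),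
      IsLevyProcess Y Q ∧
      HasCharExponent Y Q (fun ξ => (ψ ‖ξ‖ : ℂ)) ∧
      IsRadialTransitionDensity Y Q q ∧
      (∀ t, 0 < t → ∀ x : EuclideanSpace ℝ (Fin (d + 2)), x ≠ 0 →
        ContinuousAt (fun y : EuclideanSpace ℝ (Fin (d + 2)) => q t ‖y‖) x) ∧
      ∀ p : ℝ≥0 → ℝ → ℝ, IsRadialTransitionDensity X P p →
        ∀ t, 0 < t → ∀ r, 0 < r →
          DifferentiableAt ℝ (p t) r ∧ q t r = -1 / (2 * Real.pi * r) * deriv (p t) r := by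
  have : Nonempty (Fin d) := ⟨⟨0, hd⟩⟩
  have hd2 : 1 ≤ d + 2 := by omega
  have hg := measurable_raisedDensity hmono
  have hmap : (radialMeasure (d + 2) (raisedDensity ν')).map (planarProjection d) =
      radialMeasure d ν :=
    map_planarProjection_radialMeasure hd hg fun r hr => lintegral_mul_raisedDensity hν' hmono hr
  have hlevy : IsLevyMeasure (radialMeasure (d + 2) (raisedDensity ν')) :=
    isLevyMeasure_of_map_planarProjection hd (hmap ▸ hX.isLevyMeasure)
  -- the exponent is real, so it can be read off from the characteristic function at time one
  have hψJ : ∀ ξ, ψ ‖ξ‖ = jumpExponent (radialMeasure d ν) ξ := by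
    intro ξ
    have h1 := (hψ 1 ξ).symm.trans (hX.charExponent 1 ξ)
    simp only [NNReal.coe_one, Complex.ofReal_one, neg_mul, one_mul, ← Complex.ofReal_neg,
      ← Complex.ofReal_exp] at h1
    exact neg_injective (Real.exp_injective (Complex.ofReal_injective h1))
  have hJ : ∀ η, jumpExponent (radialMeasure (d + 2) (raisedDensity ν')) η = ψ ‖η‖ := by
    intro η
    obtain ⟨ξ, hξ⟩ := exists_norm_eq (EuclideanSpace ℝ (Fin d)) (norm_nonneg η)
    rw [← hξ, hψJ, ← hmap, jumpExponent_map_planarProjection]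
    exact jumpExponent_radialMeasure_congr _ (by rw [norm_planarInclusion, hξ])
  obtain ⟨Ω₂, _, Q, Y, hYadd⟩ := exists_unimodal_levyProcess hd2 hg
    (raisedDensity_nonneg hν' hmono) (antitoneOn_raisedDensity hmono) hlevy
  obtain ⟨hY, hYψ⟩ := hYadd.isLevyProcess
  have hinf2 : radialMeasure (d + 2) (raisedDensity ν') univ = ∞ := by
    rw [← hinf, ← hmap, Measure.map_apply (measurable_planarProjection d) MeasurableSet.univ,
      preimage_univ]
  obtain ⟨q, hq, hqc⟩ := exists_radialTransitionDensity hd2 hY hYψ hYadd.unimodal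
    (tendsto_jumpExponent_radialMeasure hg hlevy hinf2)
  simp only [hJ] at hYψ
  have hXprob := hX.isLevyProcess.isProbabilityMeasure
  have hYprob := hY.isProbabilityMeasure
  have hfin : ∀ t, 0 < t → IsFiniteMeasure (radialMeasure (d + 2) (q t)) := fun t ht => by
    rw [← hq.law_eq t ht]
    infer_instance
  have hint : ∀ t, 0 < t → ∀ r, 0 < r → IntegrableOn (fun u => u * q t u) (Ioi r) :=
    fun t ht r hr => have := hfin t ht
      integrableOn_mul_of_isFiniteMeasure hd (hq.antitoneOn t ht) (hq.nonneg t ht) hr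
  -- the law of `X t` is the projection of the law of `Y t`
  have hp : IsRadialTransitionDensity X P fun t => loweredDensity (q t) := by
    refine ⟨fun t ht r hr => loweredDensity_nonneg (hq.nonneg t ht) hr, fun t ht =>
      antitoneOn_loweredDensity (hq.nonneg t ht) (hint t ht), fun t ht => ?_⟩
    have := hfin t ht
    rw [← map_planarProjection_eq_loweredDensity hd (hq.antitoneOn t ht) (hq.nonneg t ht),
      ← hq.law_eq t ht]
    refine Measure.ext_of_charFun (funext fun ξ => ?_)
    rw [charFun_map_planarProjection, hYψ, hψ]
    simp only [norm_planarInclusion]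
  have hderiv : ∀ t, 0 < t → ∀ r, 0 < r →
      HasDerivAt (loweredDensity (q t)) (-(2 * Real.pi * r * q t r)) r := fun t ht _ hr =>
    hasDerivAt_loweredDensity (hint t ht) (hqc t ht) hr
  refine ⟨⟨_, hp⟩, Ω₂, _, Q, Y, q, hY, hYψ, hq, fun t ht x hx =>
    (hqc t ht _ (norm_pos_iff.2 hx)).comp continuous_norm.continuousAt, fun p hp' t ht r hr => ?_⟩
  have heq : p t =ᶠ[𝓝 r] loweredDensity (q t) := by
    filter_upwards [lt_mem_nhds hr] with s hs
    exact eq_of_radialMeasure_eq hd (hp'.antitoneOn t ht) (hp.antitoneOn t ht)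
      (hp'.nonneg t ht) (hp.nonneg t ht) (fun u hu => (hderiv t ht u hu).continuousAt)
      ((hp'.law_eq t ht).symm.trans (hp.law_eq t ht)) hs
  have hd' := (hderiv t ht r hr).congr_of_eventuallyEq heq
  refine ⟨hd'.differentiableAt, ?_⟩
  rw [hd'.deriv]
  field_simp
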